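/- Let $R$ be an associative unital ring, not necessarily commutative, and let $L = R[x,x^{-1},y,y^{-1}]$ be the Laurent polynomial ring in two variables which commute with each other and with the elements of $R$. Modules are unital right modules, and cochain complexes are indexed by $\mathbb{Z}$. For a ring $S$ write $S((z)) = S[[z]][z^{-1}]$ for the ring of formal Laurent series $\sum_{i \ge k} s_i z^i$ ($k \in \mathbb{Z}$, $s_i \in S$), where $z$ commutes with $S$. For signs $\varepsilon, \delta \in \{1,-1\}$ write $R((x^{\varepsilon}, y^{\delta})) = R[[x^{\varepsilon}, y^{\delta}]][(x^{\varepsilon}y^{\delta})^{-1}]$ for the ring of formal Laurent series $\sum_{p,q \ge k} a_{p,q}\, x^{\varepsilon p} y^{\delta q}$ ($k \in \mathbb{Z}$, $a_{p,q} \in R$). All these rings contain $L$, and are regarded as left $L$-modules by multiplication. Let $C$ be a bounded cochain complex of finitely generated free $L$-modules. Then the following two statements are equivalent: (a) The complex $C$ is $R$-finitely dominated, i.e., $C$ is homotopy equivalent, as a cochain complex of $R$-modules, to a bounded cochain complex of finitely generated projective $R$-modules. (b) The following eight cochain complexes are acyclic: $$C \otimes_L R[x,x^{-1}]((y)), \quad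 C \otimes_L R[x,x^{-1}]((y^{-1})), \quad C \otimes_L R[y,y^{-1}]((x)), \quad C \otimes_L R[y,y^{-1}]((x^{-1})),$$ $$C \otimes_L R((x,y)), \quad C \otimes_L R((x^{-1},y^{-1})), \quad C \otimes_L R((x,y^{-1})), \quad C \otimes_L R((x^{-1},y)).$$ -/

import Mathlib

open CategoryTheory
open scoped TensorProduct

universe u

noncomputable section

/-! Right modules over a (possibly non-commutative) ring `A` are modules over `Aᵐᵒᵖ`:
the element `MulOpposite.op a • m` is `m · a`. -/

section Tensor

variable {A : Type u} [Ring A]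

/-- The subgroup of `M ⊗_ℤ N` generated by the elements `(m · a) ⊗ n - m ⊗ (a · n)`,
for a right `A`-module `M` and a left `A`-module `N`. -/
def balancedRelations (M : Type u) [AddCommGroup M] [Module Aᵐᵒᵖ M]
    (N : Type u) [AddCommGroup N] [Module A N] : Submodule ℤ (M ⊗[ℤ] N) :=
  Submodule.span ℤ {t | ∃ (m : M) (a : A) (n : N),
    t = (MulOpposite.op a • m) ⊗ₜ[ℤ] n - m ⊗ₜ[ℤ] (a • n)}

lemma balancedRelations_le_comap {M M' : Type u} [AddCommGroup M] [Module Aᵐᵒᵖ M]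
    [AddCommGroup M'] [Module Aᵐᵒᵖ M'] (N : Type u) [AddCommGroup N] [Module A N]
    (f : M →ₗ[Aᵐᵒᵖ] M') :
    balancedRelations (A := A) M N ≤
      (balancedRelations (A := A) M' N).comap
        (f.toAddMonoidHom.toIntLinearMap.rTensor N) := by
  refine Submodule.span_le.2 ?_
  rintro _ ⟨m, a, n, rfl⟩
  refine Submodule.subset_span ⟨f m, a, n, ?_⟩
  simp

/-- The functor `M ↦ M ⊗_A N` from right `A`-modules to abelian groups,
for a left `A`-module `N`. -/
def tensorFunctor (N : ModuleCat.{u} A) : ModuleCat.{u} Aᵐᵒᵖ ⥤ ModuleCat.{u} ℤ where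
  obj M := ModuleCat.of ℤ ((M ⊗[ℤ] N) ⧸ balancedRelations (A := A) M N)
  map {M M'} f := ModuleCat.ofHom
    (Submodule.mapQ (balancedRelations (A := A) M N) (balancedRelations (A := A) M' N)
      (f.hom.toAddMonoidHom.toIntLinearMap.rTensor N)
      (balancedRelations_le_comap N f.hom))
  map_id M := by
    ext : 1
    refine Submodule.linearMap_qext _ (TensorProduct.ext' fun m n => ?_)
    rfl
  map_comp f g := by
    ext : 1
    refine Submodule.linearMap_qext _ (TensorProduct.ext' fun m n => ?_)
    rfl

instance (N : ModuleCat.{u} A) : (tensorFunctor N).Additive where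
  map_add {M M' f g} := by
    ext : 1
    refine Submodule.linearMap_qext _ (TensorProduct.ext' fun m n => ?_)
    change Submodule.Quotient.mk ((f.hom m + g.hom m) ⊗ₜ[ℤ] n) = _
    rw [TensorProduct.add_tmul]
    rfl

/-- The cochain complex `C ⊗_A S` of abelian groups, where the ring `S` is a left `A`-module
through the ring homomorphism `φ : A → S`. -/
def tensorComplex {S : Type u} [Ring S] (φ : A →+* S)
    (C : CochainComplex (ModuleCat.{u} Aᵐᵒᵖ) ℤ) : CochainComplex (ModuleCat.{u} ℤ) ℤ :=
  ((tensorFunctor ((ModuleCat.restrictScalars φ).obj (ModuleCat.of S S))).mapHomologicalComplex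
    (ComplexShape.up ℤ)).obj C

end Tensor

section FiniteDomination

/-- A cochain complex is bounded if it vanishes outside a finite range of degrees. -/
def IsBoundedComplex {A : Type u} [Ring A] (C : CochainComplex (ModuleCat.{u} A) ℤ) : Prop :=
  ∃ a b : ℤ, C.IsStrictlyGE a ∧ C.IsStrictlyLE b

/-- A cochain complex `C` of right `A`-modules is `R`-finitely dominated, for a ring homomorphism
`ι : R → A`, if it is homotopy equivalent, as a complex of right `R`-modules, to a bounded complex
of finitely generated projective right `R`-modules. -/
def IsFinitelyDominated {R A : Type u} [Ring R] [Ring A] (ι : R →+* A)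
    (C : CochainComplex (ModuleCat.{u} Aᵐᵒᵖ) ℤ) : Prop :=
  ∃ B : CochainComplex (ModuleCat.{u} Rᵐᵒᵖ) ℤ,
    IsBoundedComplex B ∧
    (∀ n, Module.Finite Rᵐᵒᵖ (B.X n) ∧ Module.Projective Rᵐᵒᵖ (B.X n)) ∧
    Nonempty (HomotopyEquiv
      (((ModuleCat.restrictScalars (RingHom.op ι)).mapHomologicalComplex
        (ComplexShape.up ℤ)).obj C) B)

end FiniteDomination

section Rings

variable (R : Type u) [Ring R]

/-- The Laurent polynomial ring `L = R[x, x⁻¹, y, y⁻¹]`; the monomial `r x^p y^q` is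
`AddMonoidAlgebra.single (p, q) r`. The variables commute with each other and with `R`. -/
abbrev LaurentPoly₂ : Type u := AddMonoidAlgebra R (ℤ × ℤ)

/-- The ring `R((s, t)) = R[[s, t]][(s t)⁻¹]` of formal Laurent series in two variables whose
support is contained in `{(p, q) | p ≥ k, q ≥ k}` for some `k`. For the componentwise order on
`ℤ × ℤ` these are precisely the Hahn series, see `isPWO_support_iff`. -/
abbrev Novikov₂ : Type u := HahnSeries (ℤ × ℤ) R

/-- The ring `R[s, s⁻¹]((t))` of formal Laurent series in `t` over `R[s, s⁻¹]`. -/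
abbrev EdgeNovikov : Type u := LaurentSeries (LaurentPolynomial R)

variable {R}

lemma isPWO_support_iff (f : ℤ × ℤ → R) :
    (Function.support f).IsPWO ↔ ∃ k : ℤ, ∀ p q : ℤ, f (p, q) ≠ 0 → k ≤ p ∧ k ≤ q := by
  constructor
  · intro h
    have hf := (h.image_of_monotone monotone_fst).isWF
    have hs := (h.image_of_monotone monotone_snd).isWF
    obtain ⟨a, ha⟩ : BddBelow (Prod.fst '' Function.support f) := by
      rcases (Prod.fst '' Function.support f).eq_empty_or_nonempty with h0 | h0
      · simp [h0]
      · exact ⟨hf.min h0, fun b hb => hf.min_le h0 hb⟩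
    obtain ⟨b, hb⟩ : BddBelow (Prod.snd '' Function.support f) := by
      rcases (Prod.snd '' Function.support f).eq_empty_or_nonempty with h0 | h0
      · simp [h0]
      · exact ⟨hs.min h0, fun b hb => hs.min_le h0 hb⟩
    refine ⟨min a b, fun p q hpq => ⟨?_, ?_⟩⟩
    · exact (min_le_left _ _).trans (ha ⟨(p, q), hpq, rfl⟩)
    · exact (min_le_right _ _).trans (hb ⟨(p, q), hpq, rfl⟩)
  · rintro ⟨k, hk⟩
    have hI : (Set.Ici k).IsPWO := by
      rw [Set.isPWO_iff_isWF]
      exact BddBelow.isWF ⟨k, fun _ h => h⟩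
    exact (hI.prod hI).mono fun x hx => hk x.1 x.2 hx

variable (R)

/-- The inclusion `L → R((x^ε, y^δ))` for signs `ε, δ`. The target is `R((s, t))` with
`s = x^ε` and `t = y^δ`, so that `r x^p y^q` is sent to `r s^(ε p) t^(δ q)`. -/
def vertexHom (ε δ : ℤˣ) : LaurentPoly₂ R →+* Novikov₂ R :=
  AddMonoidAlgebra.liftNCRingHom (HahnSeries.C : R →+* Novikov₂ R)
    { toFun := fun g => HahnSeries.single
        ((ε : ℤ) * g.toAdd.1, (δ : ℤ) * g.toAdd.2) (1 : R)
      map_one' := by simp; rfl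
      map_mul' := fun g h => by
        simp [HahnSeries.single_mul_single, mul_add] }
    (fun r g => by
      simp [Commute, SemiconjBy, HahnSeries.C_apply, HahnSeries.single_mul_single])

/-- The inclusion `L → R[x, x⁻¹]((y^δ))` for a sign `δ`. The target is `R[s, s⁻¹]((t))` with
`s = x` and `t = y^δ`, so that `r x^p y^q` is sent to `r s^p t^(δ q)`. -/
def edgeHomY (δ : ℤˣ) : LaurentPoly₂ R →+* EdgeNovikov R :=
  AddMonoidAlgebra.liftNCRingHom
    ((HahnSeries.C : LaurentPolynomial R →+* EdgeNovikov R).comp LaurentPolynomial.C)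
    { toFun := fun g => HahnSeries.single ((δ : ℤ) * g.toAdd.2)
        (LaurentPolynomial.T g.toAdd.1 : LaurentPolynomial R)
      map_one' := by simp
      map_mul' := fun g h => by
        rw [HahnSeries.single_mul_single, ← LaurentPolynomial.T_add, ← mul_add]
        rfl }
    (fun r g => by
      simp [Commute, SemiconjBy, HahnSeries.C_apply, HahnSeries.single_mul_single])

/-- The inclusion `L → R[y, y⁻¹]((x^ε))` for a sign `ε`. The target is `R[s, s⁻¹]((t))` with
`s = y` and `t = x^ε`, so that `r x^p y^q` is sent to `r s^q t^(ε p)`. -/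
def edgeHomX (ε : ℤˣ) : LaurentPoly₂ R →+* EdgeNovikov R :=
  AddMonoidAlgebra.liftNCRingHom
    ((HahnSeries.C : LaurentPolynomial R →+* EdgeNovikov R).comp LaurentPolynomial.C)
    { toFun := fun g => HahnSeries.single ((ε : ℤ) * g.toAdd.1)
        (LaurentPolynomial.T g.toAdd.2 : LaurentPolynomial R)
      map_one' := by simp
      map_mul' := fun g h => by
        rw [HahnSeries.single_mul_single, ← LaurentPolynomial.T_add, ← mul_add]
        rfl }
    (fun r g => by
      simp [Commute, SemiconjBy, HahnSeries.C_apply, HahnSeries.single_mul_single])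

end Rings

end

/-! Bases turn `C` into a square matrix `D` over `L` with `D * D = 0`, and acyclicity of `C ⊗ S`
into exactness of `D` on `S ^ T`. Both (a) and (b) are shown equivalent to a third condition,
`HomotopyFinite`: for some `R`-linear `H`, all values of the defect `1 - dH - Hd` are supported in
one finite set `K` of monomials.

From (b) to `HomotopyFinite`: exactness over `S` gives a contracting matrix over `S`, which sends
polynomial vectors to formal series. Contractions over `R[x,x⁻¹]((y))` and `R[x,x⁻¹]((y⁻¹))` yield
series that are finite on opposite half planes; gluing them (`exists_glue`) gives an operator whose
defect lives in a horizontal strip. A vertical strip is obtained in the same way from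
`R((x^ε))[y,y⁻¹]`. This ring is preferred to `R[y,y⁻¹]((x^ε))` because its matrices move
`y`-exponents by a bounded amount only, so that composing the two defects confines everything to a
box (`homotopyFinite_of_exact`). Exactness over it is a Mayer-Vietoris argument (`thin_exact`): it
is the intersection of `R((x^ε,y))` and `R((x^ε,y⁻¹))`, whose sum is `R[[y,y⁻¹]]((x^ε))`, a module
over `R[y,y⁻¹]((x^ε))`.

From `HomotopyFinite` to (b): in each of the eight rings some variable, say `y`, admits power
series. Exactness over `S` follows once `y ⊗ 1 - 1 ⊗ y` is bijective on the homology of `C ⊗_R S`.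
With `θ` the defect, the geometric series `∑ θ(y⁻ᵏ ·) ⊗ yᵏ` makes sense because all values of `θ`
lie over `K`; up to the factor `y ⊗ 1` it is a homotopy inverse
(`HomotopyFinite.exact_of_powerSeries`).

Between (a) and `HomotopyFinite`: a domination factors a map homotopic to the identity through
finitely generated modules, so its image has finite support. Conversely, let `F` be a subcomplex of
finitely generated free modules that contains the values of the defect. The polynomials `F[u]`, with
`u` of degree `-1`, carry a differential for which `F[u]` is homotopy equivalent to `C`, and below
the range of `C` the variable `u` is a contraction, so `F[u]` can be truncated there
(`exists_finite_model`). -/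

noncomputable section

/-! ### Differential modules given by matrices, and contractions. -/

section MatrixAction

variable {T : Type*} [Fintype T] [DecidableEq T]

lemma endSum_apply {ι N : Type*} [AddCommGroup N] (s : Finset ι) (f : ι → AddMonoid.End N)
    (v : N) : (∑ i ∈ s, f i) v = ∑ i ∈ s, f i v :=
  AddMonoidHom.finsetSum_apply f s v

/-- A square matrix over `A` acts on vectors with entries in an additive group on which `A` acts
from the left through `ρ`. -/
def matAct {A N : Type*} [Ring A] [AddCommGroup N] (ρ : A →+* AddMonoid.End N) :
    Matrix T T A →+* AddMonoid.End (T → N) where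
  toFun D :=
    { toFun := fun v s => ∑ t, ρ (D s t) (v t)
      map_zero' := by ext; simp
      map_add' := fun v w => by ext; simp [Finset.sum_add_distrib] }
  map_one' := by
    ext v s
    change ∑ t, ρ ((1 : Matrix T T A) s t) (v t) = v s
    rw [Finset.sum_eq_single s]
    · rw [Matrix.one_apply_eq, map_one]; rfl
    · intro t _ h
      rw [Matrix.one_apply_ne h.symm, map_zero]; rfl
    · simp
  map_mul' D E := by
    ext v s
    change ∑ t, ρ ((D * E) s t) (v t) = ∑ r, ρ (D s r) (∑ t, ρ (E r t) (v t))
    simp only [Matrix.mul_apply, map_sum, map_mul, endSum_apply]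
    rw [Finset.sum_comm]
    rfl
  map_zero' := by
    ext v s
    change ∑ t, ρ ((0 : Matrix T T A) s t) (v t) = 0
    refine Finset.sum_eq_zero fun t _ => ?_
    rw [Matrix.zero_apply, map_zero]; rfl
  map_add' D E := by
    ext v s
    change ∑ t, ρ ((D + E) s t) (v t) = ∑ t, ρ (D s t) (v t) + ∑ t, ρ (E s t) (v t)
    rw [← Finset.sum_add_distrib]
    refine Finset.sum_congr rfl fun t _ => ?_
    rw [Matrix.add_apply, map_add]; rfl

lemma matAct_apply {A N : Type*} [Ring A] [AddCommGroup N] (ρ : A →+* AddMonoid.End N)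
    (D : Matrix T T A) (v : T → N) (s : T) : matAct ρ D v s = ∑ t, ρ (D s t) (v t) := rfl

lemma matAct_single {A N : Type*} [Ring A] [AddCommGroup N] (ρ : A →+* AddMonoid.End N)
    (D : Matrix T T A) (t : T) (n : N) (s : T) :
    matAct ρ D (Pi.single t n) s = ρ (D s t) n := by
  rw [matAct_apply, Finset.sum_eq_single t]
  · simp
  · intro t' _ h
    simp [Pi.single_eq_of_ne h]
  · simp

lemma matAct_comp {A B N : Type*} [Ring A] [Ring B] [AddCommGroup N]
    (ρ : B →+* AddMonoid.End N) (φ : A →+* B) (D : Matrix T T A) :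
    matAct (ρ.comp φ) D = matAct ρ (D.map φ) := rfl

/-- The action of a square matrix is compatible with equivariant maps. -/
lemma matAct_map {A N N' : Type*} [Ring A] [AddCommGroup N] [AddCommGroup N']
    (ρ : A →+* AddMonoid.End N) (ρ' : A →+* AddMonoid.End N') (f : N →+ N')
    (hf : ∀ a n, f (ρ a n) = ρ' a (f n)) (D : Matrix T T A) (v : T → N) :
    matAct ρ' D (fun t => f (v t)) = fun s => f (matAct ρ D v s) := by
  ext s
  simp [matAct_apply, hf]

/-- The differential group given by the matrix `D` acting on vectors with entries in `N` has
vanishing homology. -/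
def DExact {A N : Type*} [Ring A] [AddCommGroup N] (ρ : A →+* AddMonoid.End N)
    (D : Matrix T T A) : Prop :=
  ∀ v, matAct ρ D v = 0 → ∃ w, matAct ρ D w = v

/-- The action of `A` on `S` by left multiplication through a ring homomorphism. -/
def leftReg {A S : Type*} [Ring A] [Ring S] (φ : A →+* S) : A →+* AddMonoid.End S :=
  (Module.toAddMonoidEnd S S).comp φ

@[simp] lemma leftReg_apply {A S : Type*} [Ring A] [Ring S] (φ : A →+* S) (a : A) (s : S) :
    leftReg φ a s = φ a * s := rfl

/-- A differential graded matrix over `S` which is exact admits a contraction. -/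
lemma exists_contraction {S : Type*} [Ring S] (D : Matrix T T S) (hD : D * D = 0) (deg : T → ℤ)
    (hdeg : ∀ s t, D s t ≠ 0 → deg s = deg t + 1)
    (hex : DExact (leftReg (RingHom.id S)) D) : ∃ s : Matrix T T S, D * s + s * D = 1 := by
  obtain ⟨b, hb⟩ : ∃ b, ∀ t, deg t ≤ b := by
    obtain ⟨b, hb⟩ := (Set.finite_range deg).bddAbove
    exact ⟨b, fun t => hb ⟨t, rfl⟩⟩
  obtain ⟨a, ha⟩ : ∃ a, ∀ t, a ≤ deg t := by
    obtain ⟨b, hb⟩ := (Set.finite_range deg).bddBelow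
    exact ⟨b, fun t => hb ⟨t, rfl⟩⟩
  -- The columns of `s` are constructed by descending degree, one degree at each stage.
  have key : ∀ n : ℕ, ∃ s : Matrix T T S, ∀ t, b - n < deg t →
      ∀ r, (D * s + s * D) r t = (1 : Matrix T T S) r t := by
    intro n
    induction n with
    | zero =>
      refine ⟨0, fun t ht => absurd (hb t) ?_⟩
      simpa using ht
    | succ n ih =>
      obtain ⟨s, hs⟩ := ih
      have hz : ∀ t, b - (n + 1 : ℕ) < deg t → ∃ w : T → S,
          ∀ r, ∑ q, D r q * w q = (1 - s * D) r t := by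
        intro t ht
        -- Column `t` of the right side involves only columns of the bracket of degree `deg t + 1`,
        -- where it already vanishes. So the columns of `1 - s * D` are cycles.
        have h0 : D * (1 - s * D) = (1 - (D * s + s * D)) * D := by
          have : s * D * D = 0 := by rw [mul_assoc, hD, mul_zero]
          rw [mul_sub, sub_mul, add_mul, this, mul_one, one_mul, add_zero, mul_assoc]
        obtain ⟨w, hw⟩ := hex (fun r => (1 - s * D) r t) (by
          ext r
          have h1 : matAct (leftReg (RingHom.id S)) D (fun r => (1 - s * D) r t) r
              = (D * (1 - s * D)) r t := by
            simp [matAct_apply, Matrix.mul_apply]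
          rw [h1, h0, Matrix.mul_apply, Pi.zero_apply]
          refine Finset.sum_eq_zero fun q _ => ?_
          by_cases hq : D q t = 0
          · rw [hq, mul_zero]
          · have := hdeg q t hq
            rw [Matrix.sub_apply, hs q (by push_cast at ht; omega), sub_self, zero_mul])
        exact ⟨w, fun r => by simpa [matAct_apply] using congrFun hw r⟩
      choose! w hw using hz
      refine ⟨Matrix.of fun r t => if deg t = b - n then w t r else s r t, fun t ht r => ?_⟩
      -- Column `t` of `s * D` uses columns of `s` of degree `deg t + 1 > b - n`, which have not
      -- been changed.
      have h2 : ∀ t, b - (n + 1 : ℕ) < deg t →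
          ((Matrix.of fun r t => if deg t = b - n then w t r else s r t) * D) r t
            = (s * D) r t := by
        intro t ht
        rw [Matrix.mul_apply, Matrix.mul_apply]
        refine Finset.sum_congr rfl fun q _ => ?_
        by_cases hq : D q t = 0
        · rw [hq, mul_zero, mul_zero]
        · have := hdeg q t hq
          rw [Matrix.of_apply, if_neg (by push_cast at ht; omega)]
      rw [Matrix.add_apply, h2 t ht, Matrix.mul_apply]
      by_cases hn : deg t = b - n
      · simp only [Matrix.of_apply, if_pos hn]
        rw [hw t ht, Matrix.sub_apply, sub_add_cancel]
      · simp only [Matrix.of_apply, if_neg hn]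
        rw [← hs t (by push_cast at ht; omega) r, Matrix.add_apply, Matrix.mul_apply (M := D) (N := s)]
  obtain ⟨s, hs⟩ := key (b - a + 1).toNat
  refine ⟨s, Matrix.ext fun r t => hs t ?_ r⟩
  have := ha t
  have := hb t
  rw [Int.toNat_of_nonneg (by omega)]
  omega

/-- A contraction over `S` makes every `S`-module exact. -/
lemma DExact.of_contraction {S N : Type*} [Ring S] [AddCommGroup N] (ρ : S →+* AddMonoid.End N)
    (D s : Matrix T T S) (h : D * s + s * D = 1) : DExact ρ D := by
  intro v hv
  refine ⟨matAct ρ s v, ?_⟩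
  have := congrArg (fun f => f v) (congrArg (matAct ρ) h)
  rw [map_add, map_mul, map_mul, map_one] at this
  change matAct ρ D (matAct ρ s v) + matAct ρ s (matAct ρ D v) = v at this
  rwa [hv, map_zero, add_zero] at this

end MatrixAction


/-! ### All rings over `L` compared inside the `L`-module of two-sided series. -/

section CoefficientFunctions

variable {R : Type u} [Ring R]

/-- The shift `f ↦ f (· - g)` on functions `ℤ × ℤ → R`. -/
def shiftEnd (g : ℤ × ℤ) : AddMonoid.End (ℤ × ℤ → R) where
  toFun f k := f (k - g)
  map_zero' := rfl
  map_add' _ _ := rfl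

/-- The convolution action of Laurent polynomials on arbitrary functions `ℤ × ℤ → R`, that is,
on two-sided formal power series. -/
def funAct : LaurentPoly₂ R →+* AddMonoid.End (ℤ × ℤ → R) :=
  AddMonoidAlgebra.liftNCRingHom (Module.toAddMonoidEnd R (ℤ × ℤ → R))
    { toFun := fun g => shiftEnd g.toAdd
      map_one' := by
        ext f k
        change f (k - 0) = f k
        rw [sub_zero]
      map_mul' := fun g h => by
        ext f k
        change f (k - (g.toAdd + h.toAdd)) = f (k - g.toAdd - h.toAdd)
        rw [sub_add_eq_sub_sub] }
    (fun _ _ => rfl)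

lemma funAct_single (g : ℤ × ℤ) (r : R) (f : ℤ × ℤ → R) (k : ℤ × ℤ) :
    funAct (AddMonoidAlgebra.single g r) f k = r * f (k - g) := by
  have h : (funAct (AddMonoidAlgebra.single g r) : AddMonoid.End (ℤ × ℤ → R))
      = Module.toAddMonoidEnd R (ℤ × ℤ → R) r * shiftEnd g :=
    AddMonoidAlgebra.liftNC_single _ _ _ _
  rw [h]
  rfl

lemma laurent_sum_single (l : LaurentPoly₂ R) :
    l = ∑ g ∈ l.coeff.support, AddMonoidAlgebra.single g (l.coeff g) := by
  ext k
  simp [AddMonoidAlgebra.coeff_sum, Finsupp.finsetSum_apply, Finsupp.single_apply]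

lemma funAct_apply (l : LaurentPoly₂ R) (f : ℤ × ℤ → R) (k : ℤ × ℤ) :
    funAct l f k = ∑ g ∈ l.coeff.support, l.coeff g * f (k - g) := by
  conv_lhs => rw [laurent_sum_single l]
  rw [map_sum, endSum_apply, Finset.sum_apply]
  simp only [funAct_single]

/-- A map between groups with an action of the Laurent polynomial ring is equivariant if it is so
for monomials. -/
lemma equivariant_of_single {N N' : Type*} [AddCommGroup N] [AddCommGroup N']
    (ρ : LaurentPoly₂ R →+* AddMonoid.End N) (ρ' : LaurentPoly₂ R →+* AddMonoid.End N')
    (f : N →+ N') (h : ∀ g r n, f (ρ (AddMonoidAlgebra.single g r) n)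
      = ρ' (AddMonoidAlgebra.single g r) (f n)) (l : LaurentPoly₂ R) (n : N) :
    f (ρ l n) = ρ' l (f n) := by
  rw [laurent_sum_single l, map_sum, map_sum, endSum_apply, endSum_apply, map_sum]
  exact Finset.sum_congr rfl fun g _ => h g _ n

/-- A realisation of the elements of a ring `S` under the Laurent polynomial ring by formal
series in two variables. -/
structure SeriesMap {S : Type*} [Ring S] (φ : LaurentPoly₂ R →+* S) where
  /-- the coefficients of an element of `S` -/
  toHom : S →+ (ℤ × ℤ → R)
  map_single_mul : ∀ g r s k,
    toHom (φ (AddMonoidAlgebra.single g r) * s) k = r * toHom s (k - g)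
  map_one : toHom 1 = Pi.single 0 1
  map_mul_right : ∀ s r k, toHom (s * φ (AddMonoidAlgebra.single 0 r)) k = toHom s k * r

namespace SeriesMap

variable {S : Type*} [Ring S] {φ : LaurentPoly₂ R →+* S} (c : SeriesMap φ)
include c

lemma map_mul (l : LaurentPoly₂ R) (s : S) : c.toHom (φ l * s) = funAct l (c.toHom s) :=
  equivariant_of_single (leftReg φ) funAct c.toHom (fun g r n => by
    ext k
    rw [leftReg_apply, c.map_single_mul, funAct_single]) l s

lemma map_coe (l : LaurentPoly₂ R) : c.toHom (φ l) = fun g => l.coeff g := by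
  ext k
  rw [← mul_one (φ l), c.map_mul, c.map_one, funAct_apply]
  rw [Finset.sum_eq_single k]
  · simp
  · intro g _ hg
    rw [Pi.single_eq_of_ne (sub_ne_zero.2 hg.symm), mul_zero]
  · intro h
    rw [Finsupp.notMem_support_iff.1 h, zero_mul]

variable {T : Type*} [Fintype T] [DecidableEq T]

lemma matAct_eq (D : Matrix T T (LaurentPoly₂ R)) (v : T → S) :
    matAct funAct D (fun t => c.toHom (v t)) = fun t => c.toHom (matAct (leftReg φ) D v t) :=
  matAct_map (leftReg φ) funAct c.toHom (fun l s => c.map_mul l s) D v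

end SeriesMap

lemma units_mul_mul (ε : ℤˣ) (p : ℤ) : (ε : ℤ) * (ε * p) = p := by
  rcases Int.units_eq_one_or ε with rfl | rfl <;> simp

lemma vertexHom_single (ε δ : ℤˣ) (g : ℤ × ℤ) (r : R) :
    vertexHom R ε δ (AddMonoidAlgebra.single g r)
      = HahnSeries.single ((ε : ℤ) * g.1, (δ : ℤ) * g.2) r := by
  change AddMonoidAlgebra.liftNC _ _ _ = _
  rw [AddMonoidAlgebra.liftNC_single]
  change HahnSeries.C r * HahnSeries.single _ 1 = _
  rw [HahnSeries.C_apply, HahnSeries.single_mul_single, zero_add, mul_one]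
  rfl

lemma edgeHomY_single (δ : ℤˣ) (g : ℤ × ℤ) (r : R) :
    edgeHomY R δ (AddMonoidAlgebra.single g r)
      = HahnSeries.single ((δ : ℤ) * g.2) (AddMonoidAlgebra.single g.1 r) := by
  change AddMonoidAlgebra.liftNC _ _ _ = _
  rw [AddMonoidAlgebra.liftNC_single]
  change HahnSeries.C (LaurentPolynomial.C r) * HahnSeries.single _ (LaurentPolynomial.T _) = _
  rw [HahnSeries.C_apply, HahnSeries.single_mul_single, zero_add,
    ← LaurentPolynomial.single_eq_C_mul_T]
  rfl

lemma edgeHomX_single (ε : ℤˣ) (g : ℤ × ℤ) (r : R) :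
    edgeHomX R ε (AddMonoidAlgebra.single g r)
      = HahnSeries.single ((ε : ℤ) * g.1) (AddMonoidAlgebra.single g.2 r) := by
  change AddMonoidAlgebra.liftNC _ _ _ = _
  rw [AddMonoidAlgebra.liftNC_single]
  change HahnSeries.C (LaurentPolynomial.C r) * HahnSeries.single _ (LaurentPolynomial.T _) = _
  rw [HahnSeries.C_apply, HahnSeries.single_mul_single, zero_add,
    ← LaurentPolynomial.single_eq_C_mul_T]
  rfl

/-- The coefficients of an element of `R((x^ε, y^δ))`. -/
def vertexCoeff (ε δ : ℤˣ) : Novikov₂ R →+ (ℤ × ℤ → R) where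
  toFun f g := f.coeff ((ε : ℤ) * g.1, (δ : ℤ) * g.2)
  map_zero' := rfl
  map_add' _ _ := rfl

lemma vertexCoeff_apply (ε δ : ℤˣ) (f : Novikov₂ R) (g : ℤ × ℤ) :
    vertexCoeff ε δ f g = f.coeff ((ε : ℤ) * g.1, (δ : ℤ) * g.2) := rfl

/-- The coefficients of an element of `R[x, x⁻¹]((y^δ))`. -/
def edgeCoeffY (δ : ℤˣ) : EdgeNovikov R →+ (ℤ × ℤ → R) where
  toFun f g := (f.coeff ((δ : ℤ) * g.2)).coeff g.1
  map_zero' := rfl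
  map_add' _ _ := rfl

lemma edgeCoeffY_apply (δ : ℤˣ) (f : EdgeNovikov R) (g : ℤ × ℤ) :
    edgeCoeffY δ f g = (f.coeff ((δ : ℤ) * g.2)).coeff g.1 := rfl

/-- The realisation of `R((x^ε, y^δ))` by formal series. -/
def vertexSeries (ε δ : ℤˣ) : SeriesMap (vertexHom R ε δ) where
  toHom := vertexCoeff ε δ
  map_single_mul g r s k := by
    rw [vertexCoeff_apply, vertexCoeff_apply, vertexHom_single, HahnSeries.coeff_single_mul]
    simp [mul_sub]
  map_one := by
    ext k
    rw [vertexCoeff_apply, HahnSeries.coeff_one, Pi.single_apply]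
    by_cases hk : k = 0
    · simp [hk]
    · have : ((ε : ℤ) * k.1, (δ : ℤ) * k.2) ≠ 0 := by simpa [Prod.ext_iff] using hk
      rw [if_neg hk, if_neg this]
  map_mul_right s r k := by
    rw [vertexCoeff_apply, vertexCoeff_apply, vertexHom_single, HahnSeries.coeff_mul_single]
    simp

/-- The realisation of `R[x, x⁻¹]((y^δ))` by formal series. -/
def edgeSeriesY (δ : ℤˣ) : SeriesMap (edgeHomY R δ) where
  toHom := edgeCoeffY δ
  map_single_mul g r s k := by
    rw [edgeCoeffY_apply, edgeCoeffY_apply, edgeHomY_single, HahnSeries.coeff_single_mul,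
      AddMonoidAlgebra.coeff_single_mul_eq_mul_coeff (k.1 - g.1)]
    · simp [mul_sub]
    · intro m _
      omega
  map_one := by
    ext k
    rw [edgeCoeffY_apply, HahnSeries.coeff_one, Pi.single_apply]
    obtain ⟨p, q⟩ := k
    by_cases hq : q = 0
    · subst hq
      rw [mul_zero, if_pos rfl]
      change Finsupp.single 0 1 p = _
      by_cases hp : p = 0
      · rw [hp, Finsupp.single_eq_same]
        exact (if_pos rfl).symm
      · rw [Finsupp.single_eq_of_ne hp, if_neg (fun h => hp (congrArg Prod.fst h))]
    · simp [hq, Prod.ext_iff]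
  map_mul_right s r k := by
    rw [edgeCoeffY_apply, edgeCoeffY_apply, edgeHomY_single, HahnSeries.coeff_mul_single]
    simp only [Prod.snd_zero, mul_zero, sub_zero, Prod.fst_zero]
    exact AddMonoidAlgebra.coeff_mul_single_zero _ _ _

section Operators

variable {T : Type*} [Fintype T] [DecidableEq T]

lemma op_smul_eq_mul_single (r : Rᵐᵒᵖ) (l : LaurentPoly₂ R) :
    r • l = l * AddMonoidAlgebra.single 0 r.unop := by
  ext k
  rw [AddMonoidAlgebra.coeff_mul_single_zero, AddMonoidAlgebra.coeff_smul_apply]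
  rfl

/-- Left multiplication by a matrix over the Laurent polynomial ring, as a map of right
`R`-modules. -/
def leftMulLin (D : Matrix T T (LaurentPoly₂ R)) :
    (T → LaurentPoly₂ R) →ₗ[Rᵐᵒᵖ] (T → LaurentPoly₂ R) where
  toFun v := matAct (leftReg (RingHom.id _)) D v
  map_add' := map_add _
  map_smul' r v := by
    ext1 t
    simp [matAct_apply, Finset.smul_sum, mul_smul_comm]

lemma leftMulLin_apply (D : Matrix T T (LaurentPoly₂ R)) (v : T → LaurentPoly₂ R) :
    leftMulLin D v = matAct (leftReg (RingHom.id _)) D v := rfl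

lemma leftMulLin_comp_self {D : Matrix T T (LaurentPoly₂ R)} (hD : D * D = 0)
    (v : T → LaurentPoly₂ R) : leftMulLin D (leftMulLin D v) = 0 := by
  have := congrArg (fun f => f v) (congrArg (matAct (leftReg (RingHom.id (LaurentPoly₂ R)))) hD)
  rw [map_mul, map_zero] at this
  exact this

/-- The coefficient functions of a vector of Laurent polynomials. -/
def coeffFun (v : T → LaurentPoly₂ R) : T → ℤ × ℤ → R := fun t g => (v t).coeff g

lemma matAct_coeffFun (D : Matrix T T (LaurentPoly₂ R)) (v : T → LaurentPoly₂ R) :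
    matAct funAct D (coeffFun v) = coeffFun (leftMulLin D v) := by
  let f : LaurentPoly₂ R →+ (ℤ × ℤ → R) :=
    { toFun := fun l g => l.coeff g
      map_zero' := rfl
      map_add' := fun _ _ => rfl }
  have hf : ∀ l l', f (leftReg (RingHom.id (LaurentPoly₂ R)) l l') = funAct l (f l') := by
    refine equivariant_of_single (leftReg (RingHom.id (LaurentPoly₂ R))) funAct f ?_
    intro g r l
    ext k
    rw [funAct_single]
    change (AddMonoidAlgebra.single g r * l).coeff k = r * l.coeff (k - g)
    exact AddMonoidAlgebra.coeff_single_mul_eq_mul_coeff (k - g)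
      (fun m _ => ⟨fun h => by rw [← h]; abel, fun h => by rw [h]; abel⟩)
  exact matAct_map (leftReg (RingHom.id (LaurentPoly₂ R))) funAct f hf D v

variable {S : Type*} [Ring S] {φ : LaurentPoly₂ R →+* S}

/-- The operator on vectors of Laurent polynomials given by a matrix over `S`, with values in
vectors of formal series. -/
def seriesOp (c : SeriesMap φ) (s : Matrix T T S) :
    (T → LaurentPoly₂ R) →ₗ[Rᵐᵒᵖ] (T → ℤ × ℤ → R) where
  toFun v t := c.toHom (matAct (leftReg (RingHom.id S)) s (fun t => φ (v t)) t)
  map_add' v w := by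
    ext1 t
    simp only [Pi.add_apply, map_add, matAct_apply, Finset.sum_add_distrib]
  map_smul' r v := by
    ext t g
    simp only [matAct_apply, leftReg_apply, RingHom.id_apply, Pi.smul_apply,
      op_smul_eq_mul_single, _root_.map_mul, ← mul_assoc, ← Finset.sum_mul]
    exact c.map_mul_right _ _ _

lemma seriesOp_apply (c : SeriesMap φ) (s : Matrix T T S) (v : T → LaurentPoly₂ R) (t : T) :
    seriesOp c s v t = c.toHom (∑ t', s t t' * φ (v t')) := rfl

/-- The contraction identity over `S`, evaluated on polynomial vectors and read off in coefficients.
The source consists of polynomials and the target of series, so the identity becomes the inclusion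
`coeffFun`. -/
lemma seriesOp_contraction (c : SeriesMap φ) (D : Matrix T T (LaurentPoly₂ R))
    (s : Matrix T T S) (h : D.map φ * s + s * D.map φ = 1) (v : T → LaurentPoly₂ R) :
    matAct funAct D (seriesOp c s v) + seriesOp c s (leftMulLin D v) = coeffFun v := by
  have h1 : matAct funAct D (seriesOp c s v) = fun t => c.toHom
      (matAct (leftReg (RingHom.id S)) (D.map φ)
        (matAct (leftReg (RingHom.id S)) s (fun t => φ (v t))) t) :=
    c.matAct_eq D _
  have h2 : (fun t => φ (leftMulLin D v t))
      = matAct (leftReg (RingHom.id S)) (D.map φ) (fun t => φ (v t)) :=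
    (matAct_map (leftReg (RingHom.id (LaurentPoly₂ R))) (leftReg φ) φ.toAddMonoidHom
      (fun a n => map_mul φ a n) D v).symm
  have h3 : seriesOp c s (leftMulLin D v) = fun t => c.toHom
      (matAct (leftReg (RingHom.id S)) s
        (matAct (leftReg (RingHom.id S)) (D.map φ) (fun t => φ (v t))) t) := by
    rw [← h2]; rfl
  have h4 := congrArg (fun f => f (fun t => φ (v t)))
    (congrArg (matAct (leftReg (RingHom.id S))) h)
  rw [map_add, map_mul, map_mul, map_one] at h4
  rw [h1, h3]
  ext t g
  have h5 := congrArg (fun w => c.toHom (w t) g) h4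
  have h6 : coeffFun v t g = c.toHom (φ (v t)) g := by rw [c.map_coe]; rfl
  rw [h6]
  refine Eq.trans ?_ h5
  exact (congrFun (map_add c.toHom _ _) g).symm

end Operators

end CoefficientFunctions

/-! ### Gluing contractions along complementary half planes. -/

section Gluing

variable {R : Type u} [Ring R] {T : Type*} [Fintype T]

lemma exists_support_bound (D : Matrix T T (LaurentPoly₂ R)) (π : ℤ × ℤ →+ ℤ) :
    ∃ N : ℤ, ∀ s t g, (D s t).coeff g ≠ 0 → |π g| ≤ N := by
  have hfin : (⋃ s, ⋃ t, (fun g => |π g|) '' ((D s t).coeff.support : Set (ℤ × ℤ))).Finite :=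
    Set.finite_iUnion fun s => Set.finite_iUnion fun t => (Finset.finite_toSet _).image _
  obtain ⟨N, hN⟩ := hfin.bddAbove
  refine ⟨N, fun s t g hg => hN ?_⟩
  simp only [Set.mem_iUnion]
  exact ⟨s, t, g, by simpa using hg, rfl⟩

variable [DecidableEq T]

/-- Convolution is local: the coefficient at `k` sees only the positions `k - g` with `g` in the
support of `D`. -/
lemma matAct_funAct_congr (D : Matrix T T (LaurentPoly₂ R)) (f f' : T → ℤ × ℤ → R) (s : T)
    (k : ℤ × ℤ) (h : ∀ t g, (D s t).coeff g ≠ 0 → f t (k - g) = f' t (k - g)) :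
    matAct funAct D f s k = matAct funAct D f' s k := by
  rw [matAct_apply, matAct_apply, Finset.sum_apply, Finset.sum_apply]
  refine Finset.sum_congr rfl fun t _ => ?_
  rw [funAct_apply, funAct_apply]
  refine Finset.sum_congr rfl fun g hg => ?_
  rw [h t g (Finsupp.mem_support_iff.1 hg)]

/-- Two contractions with values in formal series which are finite on complementary half planes
glue to an endomorphism of the Laurent polynomial vectors, which is a contraction away from a
strip. -/
lemma exists_glue (D : Matrix T T (LaurentPoly₂ R)) (π : ℤ × ℤ →+ ℤ)
    (O₁ O₂ : (T → LaurentPoly₂ R) →ₗ[Rᵐᵒᵖ] (T → ℤ × ℤ → R))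
    (h₁ : ∀ v, matAct funAct D (O₁ v) + O₁ (leftMulLin D v) = coeffFun v)
    (h₂ : ∀ v, matAct funAct D (O₂ v) + O₂ (leftMulLin D v) = coeffFun v)
    (f₁ : ∀ v t, {g | π g < 0 ∧ O₁ v t g ≠ 0}.Finite)
    (f₂ : ∀ v t, {g | 0 ≤ π g ∧ O₂ v t g ≠ 0}.Finite) :
    ∃ σ : (T → LaurentPoly₂ R) →ₗ[Rᵐᵒᵖ] (T → LaurentPoly₂ R),
      (∀ v t g, (σ v t).coeff g = if π g < 0 then O₁ v t g else O₂ v t g) ∧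
      ∃ N : ℤ, ∀ v t g, N < |π g| →
        ((v - leftMulLin D (σ v) - σ (leftMulLin D v)) t).coeff g = 0 := by
  have hfin : ∀ v t, (Function.support
      fun g => if π g < 0 then O₁ v t g else O₂ v t g).Finite := by
    intro v t
    refine ((f₁ v t).union (f₂ v t)).subset fun g hg => ?_
    rw [Function.mem_support] at hg
    by_cases h : π g < 0
    · rw [if_pos h] at hg
      exact Or.inl ⟨h, hg⟩
    · rw [if_neg h] at hg
      exact Or.inr ⟨not_lt.1 h, hg⟩
  let σ : (T → LaurentPoly₂ R) →ₗ[Rᵐᵒᵖ] (T → LaurentPoly₂ R) :=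
    { toFun := fun v t => AddMonoidAlgebra.ofCoeff (Finsupp.ofSupportFinite _ (hfin v t))
      map_add' := fun v w => by
        ext t g
        change (if π g < 0 then O₁ (v + w) t g else O₂ (v + w) t g) =
          (if π g < 0 then O₁ v t g else O₂ v t g) + (if π g < 0 then O₁ w t g else O₂ w t g)
        rw [map_add, map_add]
        split_ifs <;> rfl
      map_smul' := fun r v => by
        ext t g
        change (if π g < 0 then O₁ (r • v) t g else O₂ (r • v) t g) =
          r • (if π g < 0 then O₁ v t g else O₂ v t g)
        rw [map_smul, map_smul]
        split_ifs <;> rfl }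
  have hσ : ∀ v t g, (σ v t).coeff g = if π g < 0 then O₁ v t g else O₂ v t g :=
    fun _ _ _ => rfl
  refine ⟨σ, hσ, ?_⟩
  obtain ⟨N, hN⟩ := exists_support_bound D π
  -- Farther than `N` from the line `π = 0`, a shift by an exponent of `D` does not change the side,
  -- so `σ` may be replaced by one `Oᵢ`, which is a contraction. The case `k = 0` is listed
  -- separately because `N` may be negative.
  have main : ∀ v t g, N < |π g| → ∀ O : (T → LaurentPoly₂ R) →ₗ[Rᵐᵒᵖ] (T → ℤ × ℤ → R),
      (∀ v, matAct funAct D (O v) + O (leftMulLin D v) = coeffFun v) →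
      (∀ w k, |π k| ≤ N ∨ k = 0 → ∀ t, (σ w t).coeff (g - k) = O w t (g - k)) →
      ((v - leftMulLin D (σ v) - σ (leftMulLin D v)) t).coeff g = 0 := by
    intro v t g hg O hO hk
    have e1 : coeffFun (leftMulLin D (σ v)) t g = matAct funAct D (O v) t g := by
      rw [← matAct_coeffFun]
      exact matAct_funAct_congr D _ _ t g fun t' k hk' => hk v k (Or.inl (hN t t' k hk')) t'
    have e2 : (σ (leftMulLin D v) t).coeff g = O (leftMulLin D v) t g := by
      simpa using hk (leftMulLin D v) 0 (Or.inr rfl) t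
    have e3 := congrFun (congrFun (hO v) t) g
    change (v t).coeff g - coeffFun (leftMulLin D (σ v)) t g -
      (σ (leftMulLin D v) t).coeff g = 0
    rw [e1, e2]
    change _ = (v t).coeff g at e3
    rw [← e3]
    simp
  refine ⟨N, fun v t g hg => ?_⟩
  rcases lt_or_ge (π g) 0 with h | h
  · refine main v t g hg O₁ h₁ fun w k hk t => ?_
    rw [hσ, if_pos]
    rcases hk with hk | rfl
    · rw [map_sub]
      rw [abs_of_neg h] at hg
      have := (abs_le.1 hk).1
      omega
    · simpa using h
  · refine main v t g hg O₂ h₂ fun w k hk t => ?_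
    rw [hσ, if_neg]
    rcases hk with hk | rfl
    · rw [map_sub]
      rw [abs_of_nonneg h] at hg
      have := (abs_le.1 hk).2
      omega
    · simpa using h

end Gluing

/-! ### The ring `R((x^ε))[y,y⁻¹]`. -/

section ThinRing

variable (R : Type u) [Ring R]

/-- The ring `R((s))[t, t⁻¹]`, as a subring of `R((s, t))`. -/
def thinSubring : Subring (Novikov₂ R) where
  carrier := {f | ∃ k : ℤ, ∀ g : ℤ × ℤ, f.coeff g ≠ 0 → g.2 ≤ k}
  zero_mem' := ⟨0, fun g h => absurd rfl h⟩
  one_mem' := ⟨0, fun g h => by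
    rw [HahnSeries.coeff_one] at h
    by_cases hg : g = 0
    · simp [hg]
    · exact absurd (if_neg hg) h⟩
  add_mem' := by
    rintro f f' ⟨k, hk⟩ ⟨k', hk'⟩
    refine ⟨max k k', fun g hg => ?_⟩
    by_cases h : f.coeff g = 0
    · refine (hk' g fun h' => hg ?_).trans (le_max_right _ _)
      rw [HahnSeries.coeff_add, h, h', add_zero]
    · exact (hk g h).trans (le_max_left _ _)
  neg_mem' := by
    rintro f ⟨k, hk⟩
    refine ⟨k, fun g hg => hk g fun h => hg ?_⟩
    rw [HahnSeries.coeff_neg, h, neg_zero]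
  mul_mem' := by
    rintro f f' ⟨k, hk⟩ ⟨k', hk'⟩
    refine ⟨k + k', fun g hg => ?_⟩
    obtain ⟨a, ha, b, hb, rfl⟩ := HahnSeries.support_mul_subset (HahnSeries.mem_support _ _ |>.2 hg)
    exact add_le_add (hk a ha) (hk' b hb)

variable {R}

lemma mem_thinSubring {f : Novikov₂ R} :
    f ∈ thinSubring R ↔ ∃ k : ℤ, ∀ g : ℤ × ℤ, f.coeff g ≠ 0 → g.2 ≤ k := Iff.rfl

lemma exists_lower_bound (f : Novikov₂ R) :
    ∃ k : ℤ, ∀ g : ℤ × ℤ, f.coeff g ≠ 0 → k ≤ g.1 ∧ k ≤ g.2 := by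
  obtain ⟨k, hk⟩ := (isPWO_support_iff f.coeff).1 f.isPWO_support
  exact ⟨k, fun g => hk g.1 g.2⟩

lemma vertexHom_mem_thinSubring (ε δ : ℤˣ) (l : LaurentPoly₂ R) :
    vertexHom R ε δ l ∈ thinSubring R := by
  rw [laurent_sum_single l, map_sum]
  refine sum_mem fun g _ => ?_
  rw [vertexHom_single]
  refine ⟨(δ : ℤ) * g.2, fun h hh => ?_⟩
  by_cases heq : h = ((ε : ℤ) * g.1, (δ : ℤ) * g.2)
  · rw [heq]
  · exact absurd (HahnSeries.coeff_single_of_ne heq) hh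

/-- The inclusion of the Laurent polynomials into `R((x^ε))[y, y⁻¹]`. -/
def thinHom (ε : ℤˣ) : LaurentPoly₂ R →+* thinSubring R :=
  (vertexHom R ε 1).codRestrict (thinSubring R) (vertexHom_mem_thinSubring ε 1)

/-- The realisation of `R((x^ε))[y, y⁻¹]` by formal series. -/
def thinSeries (ε : ℤˣ) : SeriesMap (thinHom (R := R) ε) where
  toHom := (vertexCoeff ε 1).comp (thinSubring R).subtype.toAddMonoidHom
  map_single_mul g r s k := (vertexSeries ε 1).map_single_mul g r s k
  map_one := (vertexSeries ε 1).map_one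
  map_mul_right s r k := (vertexSeries ε 1).map_mul_right s r k

lemma vertexCoeff_injective (ε δ : ℤˣ) : Function.Injective (vertexCoeff (R := R) ε δ) := by
  intro f f' h
  ext g
  have := congrFun h ((ε : ℤ) * g.1, (δ : ℤ) * g.2)
  simpa [vertexCoeff_apply, units_mul_mul] using this

lemma exists_vertexCoeff_eq (ε δ : ℤˣ) (f : ℤ × ℤ → R) (k : ℤ)
    (hk : ∀ g, f g ≠ 0 → k ≤ (ε : ℤ) * g.1 ∧ k ≤ (δ : ℤ) * g.2) :
    ∃ s, vertexCoeff ε δ s = f := by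
  let f' : ℤ × ℤ → R := fun g => f ((ε : ℤ) * g.1, (δ : ℤ) * g.2)
  refine ⟨⟨f', (isPWO_support_iff f').2 ⟨k, fun p q h => ?_⟩⟩, ?_⟩
  · simpa [units_mul_mul] using hk _ h
  · ext g
    change f ((ε : ℤ) * ((ε : ℤ) * g.1), (δ : ℤ) * ((δ : ℤ) * g.2)) = f g
    rw [units_mul_mul, units_mul_mul]

lemma vertexCoeff_bound (ε δ : ℤˣ) (s : Novikov₂ R) :
    ∃ k : ℤ, ∀ g, vertexCoeff ε δ s g ≠ 0 → k ≤ (ε : ℤ) * g.1 ∧ k ≤ (δ : ℤ) * g.2 := by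
  obtain ⟨k, hk⟩ := exists_lower_bound s
  exact ⟨k, fun g hg => hk _ hg⟩

end ThinRing

/-! ### The module `R[[y,y⁻¹]]((x^ε))`. -/

section TwoSided

variable (R : Type u) [Ring R]

/-- Two-sided formal power series in one variable. -/
def BiSeries : Type u := ℤ → R

instance : AddCommGroup (BiSeries R) := inferInstanceAs (AddCommGroup (ℤ → R))

instance : Module R (BiSeries R) := inferInstanceAs (Module R (ℤ → R))

/-- The shift on two-sided formal power series. -/
def biShift (q : ℤ) : AddMonoid.End (BiSeries R) where
  toFun f k := f (k - q)
  map_zero' := rfl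
  map_add' _ _ := rfl

/-- The action of `R[s, s⁻¹]` on two-sided formal power series. -/
def biSeriesAct : LaurentPolynomial R →+* AddMonoid.End (BiSeries R) :=
  AddMonoidAlgebra.liftNCRingHom (Module.toAddMonoidEnd R (BiSeries R))
    { toFun := fun g => biShift R g.toAdd
      map_one' := by
        ext f
        funext k
        change f (k - 0) = f k
        rw [sub_zero]
      map_mul' := fun g h => by
        ext f
        funext k
        change f (k - (g.toAdd + h.toAdd)) = f (k - g.toAdd - h.toAdd)
        rw [sub_add_eq_sub_sub] }
    (fun _ _ => rfl)

instance : Module (LaurentPolynomial R) (BiSeries R) :=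
  Module.compHom (BiSeries R) (biSeriesAct R)

variable {R}

lemma single_smul_biSeries (q : ℤ) (r : R) (f : BiSeries R) (k : ℤ) :
    ((AddMonoidAlgebra.single q r : LaurentPolynomial R) • f) k = r * f (k - q) := by
  have h : biSeriesAct R (AddMonoidAlgebra.single q r)
      = Module.toAddMonoidEnd R (BiSeries R) r * biShift R q :=
    AddMonoidAlgebra.liftNC_single _ _ _ _
  exact congrFun (congrArg (fun F : AddMonoid.End (BiSeries R) => F f) h) k

/-- The module `R[[s, s⁻¹]]((t))` over the ring `R[s, s⁻¹]((t))`. -/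
abbrev BiSeriesLaurent (R : Type u) [Ring R] : Type u :=
  HahnModule ℤ (LaurentPolynomial R) (BiSeries R)

/-- The coefficients of an element of `R[[y, y⁻¹]]((x^ε))`. -/
def biSeriesCoeff (ε : ℤˣ) : BiSeriesLaurent R →+ (ℤ × ℤ → R) where
  toFun f g := ((HahnModule.of _).symm f).coeff ((ε : ℤ) * g.1) g.2
  map_zero' := rfl
  map_add' _ _ := rfl

lemma biSeriesCoeff_apply (ε : ℤˣ) (f : BiSeriesLaurent R) (g : ℤ × ℤ) :
    biSeriesCoeff ε f g = ((HahnModule.of _).symm f).coeff ((ε : ℤ) * g.1) g.2 := rfl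

/-- The action of the Laurent polynomials on `R[[y, y⁻¹]]((x^ε))`. -/
def biSeriesLaurentAct (ε : ℤˣ) : LaurentPoly₂ R →+* AddMonoid.End (BiSeriesLaurent R) :=
  (Module.toAddMonoidEnd (EdgeNovikov R) (BiSeriesLaurent R)).comp (edgeHomX R ε)

lemma biSeriesCoeff_act (ε : ℤˣ) (l : LaurentPoly₂ R) (f : BiSeriesLaurent R) :
    biSeriesCoeff ε (biSeriesLaurentAct ε l f) = funAct l (biSeriesCoeff ε f) := by
  refine equivariant_of_single _ _ _ (fun g r f => ?_) l f
  ext k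
  rw [funAct_single, biSeriesCoeff_apply, biSeriesCoeff_apply]
  change ((HahnModule.of _).symm (edgeHomX R ε (AddMonoidAlgebra.single g r) • f)).coeff _ _ = _
  rw [edgeHomX_single]
  have : (ε : ℤ) * k.1 = (ε : ℤ) * g.1 +ᵥ ((ε : ℤ) * (k.1 - g.1)) := by
    rw [vadd_eq_add]; ring
  rw [this, HahnModule.coeff_single_smul_vadd, single_smul_biSeries]
  rfl

lemma biSeriesCoeff_injective (ε : ℤˣ) : Function.Injective (biSeriesCoeff (R := R) ε) := by
  intro f f' h
  refine HahnModule.ext _ _ ?_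
  funext p
  funext q
  have := congrFun h ((ε : ℤ) * p, q)
  simpa [biSeriesCoeff_apply, units_mul_mul] using this

lemma exists_biSeriesCoeff_eq (ε : ℤˣ) (f : ℤ × ℤ → R) (k : ℤ)
    (hk : ∀ g, f g ≠ 0 → k ≤ (ε : ℤ) * g.1) : ∃ s, biSeriesCoeff ε s = f := by
  let f' : ℤ → BiSeries R := fun p q => f ((ε : ℤ) * p, q)
  refine ⟨HahnModule.of _ ⟨f', ?_⟩, ?_⟩
  · rw [Set.isPWO_iff_isWF]
    refine BddBelow.isWF ⟨k, fun p hp => ?_⟩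
    obtain ⟨q, hq⟩ : ∃ q, f' p q ≠ 0 := by
      by_contra! hcon
      exact hp (funext hcon)
    simpa [units_mul_mul] using hk _ hq
  · ext g
    change f ((ε : ℤ) * ((ε : ℤ) * g.1), g.2) = f g
    rw [units_mul_mul]

lemma biSeriesCoeff_bound (ε : ℤˣ) (s : BiSeriesLaurent R) :
    ∃ k : ℤ, ∀ g, biSeriesCoeff ε s g ≠ 0 → k ≤ (ε : ℤ) * g.1 := by
  have hwf : (Function.support ((HahnModule.of _).symm s).coeff).IsWF :=
    ((HahnModule.of _).symm s).isWF_support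
  obtain ⟨k, hk⟩ : BddBelow (Function.support ((HahnModule.of _).symm s).coeff) := by
    rcases (Function.support ((HahnModule.of _).symm s).coeff).eq_empty_or_nonempty with h0 | h0
    · simp [h0]
    · exact ⟨hwf.min h0, fun b hb => hwf.min_le h0 hb⟩
  refine ⟨k, fun g hg => hk fun h => hg ?_⟩
  rw [biSeriesCoeff_apply, h]
  rfl

end TwoSided

/-! ### From Novikov exactness to a homotopy with finite support. -/

section FiniteHomotopy

variable {R : Type u} [Ring R] {T : Type*} [Fintype T] [DecidableEq T]

/-- The identity of the differential module given by the matrix `D` is homotopic, as a map of right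
`R`-modules, to a map with coefficients supported in a finite set of monomials. -/
def HomotopyFinite (D : Matrix T T (LaurentPoly₂ R)) : Prop :=
  ∃ (H : (T → LaurentPoly₂ R) →ₗ[Rᵐᵒᵖ] (T → LaurentPoly₂ R)) (K : Finset (ℤ × ℤ)),
    ∀ c t, ∀ g ∉ K, ((c - leftMulLin D (H c) - H (leftMulLin D c)) t).coeff g = 0

lemma exists_contraction_map {S : Type*} [Ring S] (φ : LaurentPoly₂ R →+* S)
    {D : Matrix T T (LaurentPoly₂ R)} (hD : D * D = 0) {deg : T → ℤ}
    (hdeg : ∀ s t, D s t ≠ 0 → deg s = deg t + 1) (hex : DExact (leftReg φ) D) :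
    ∃ s : Matrix T T S, D.map φ * s + s * D.map φ = 1 := by
  refine exists_contraction (D.map φ) ?_ deg (fun s t h => hdeg s t fun h' => h ?_) hex
  · rw [← Matrix.map_mul, hD]
    exact Matrix.map_zero _ (map_zero φ)
  · rw [Matrix.map_apply, h', map_zero]

/-- Mayer-Vietoris: a cycle bounds in both `R((x^ε,y))` and `R((x^ε,y⁻¹))`; the difference of the
two primitives is a cycle in `R[[y,y⁻¹]]((x^ε))`, hence a boundary `Dκ`. Splitting `κ` by the sign
of the `y`-exponent corrects the primitives until they agree, and then they lie in the intersection.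
-/
lemma thin_exact {D : Matrix T T (LaurentPoly₂ R)} (hD : D * D = 0) {deg : T → ℤ}
    (hdeg : ∀ s t, D s t ≠ 0 → deg s = deg t + 1) (ε : ℤˣ)
    (h₁ : DExact (leftReg (vertexHom R ε 1)) D) (h₂ : DExact (leftReg (vertexHom R ε (-1))) D)
    (h₃ : DExact (leftReg (edgeHomX R ε)) D) : DExact (leftReg (thinHom (R := R) ε)) D := by
  -- The two-sided series form a module over `R[y,y⁻¹]((x^ε))`, and a contraction over a ring acts
  -- on all its modules.
  have hN : DExact (biSeriesLaurentAct (R := R) ε) D := by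
    obtain ⟨s, hs⟩ := exists_contraction_map (edgeHomX R ε) hD hdeg h₃
    exact DExact.of_contraction (Module.toAddMonoidEnd (EdgeNovikov R) (BiSeriesLaurent R)) _ s hs
  have c₁ := (vertexSeries (R := R) ε 1).matAct_eq D
  have c₂ := (vertexSeries (R := R) ε (-1)).matAct_eq D
  have cN := matAct_map (biSeriesLaurentAct (R := R) ε) funAct (biSeriesCoeff ε)
    (biSeriesCoeff_act ε) D
  change ∀ v, matAct funAct D (fun t => vertexCoeff ε 1 (v t))
    = fun t => vertexCoeff ε 1 (matAct (leftReg (vertexHom R ε 1)) D v t) at c₁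
  change ∀ v, matAct funAct D (fun t => vertexCoeff ε (-1) (v t))
    = fun t => vertexCoeff ε (-1) (matAct (leftReg (vertexHom R ε (-1))) D v t) at c₂
  have hthin : ∀ (w : T → thinSubring R) (t : T),
      ((matAct (leftReg (thinHom (R := R) ε)) D w t : thinSubring R) : Novikov₂ R)
        = matAct (leftReg (vertexHom R ε 1)) D (fun t => (w t : Novikov₂ R)) t := fun w t =>
    (congrFun (matAct_map (leftReg (thinHom (R := R) ε)) (leftReg (vertexHom R ε 1))
      (thinSubring R).subtype.toAddMonoidHom (fun _ _ => rfl) D w) t).symm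
  intro v hv
  have hv₁ : matAct (leftReg (vertexHom R ε 1)) D (fun t => (v t : Novikov₂ R)) = 0 := by
    ext1 t
    rw [← hthin, hv]
    rfl
  set f : T → ℤ × ℤ → R := fun t => vertexCoeff ε 1 (v t : Novikov₂ R) with hf
  obtain ⟨u₁, hu₁⟩ := h₁ _ hv₁
  -- The `y`-exponents of `v` are bounded above too, so the same coefficients define an element of
  -- `R((x^ε,y⁻¹))`.
  have hlift : ∀ t, ∃ s : Novikov₂ R, vertexCoeff ε (-1) s = f t := by
    intro t
    obtain ⟨k, hk⟩ := vertexCoeff_bound ε 1 (v t : Novikov₂ R)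
    obtain ⟨m, hm⟩ := mem_thinSubring.1 (v t).2
    refine exists_vertexCoeff_eq ε (-1) (f t) (min k (-m)) fun g hg => ⟨?_, ?_⟩
    · exact (min_le_left _ _).trans (hk g hg).1
    · have := hm _ hg
      simp only [Units.val_one, one_mul] at this
      refine (min_le_right _ _).trans ?_
      simpa using this
  choose v' hv' using hlift
  have hv₂ : matAct (leftReg (vertexHom R ε (-1))) D v' = 0 := by
    ext1 t
    refine vertexCoeff_injective ε (-1) ?_
    have e := congrFun (c₂ v') t
    rw [← e, funext hv', hf, c₁, hv₁]
    simp
  obtain ⟨u₂, hu₂⟩ := h₂ _ hv₂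
  have hz : ∀ t, ∃ n : BiSeriesLaurent R,
      biSeriesCoeff ε n = vertexCoeff ε 1 (u₁ t) - vertexCoeff ε (-1) (u₂ t) := by
    intro t
    obtain ⟨k, hk⟩ := vertexCoeff_bound ε 1 (u₁ t)
    obtain ⟨m, hm⟩ := vertexCoeff_bound ε (-1) (u₂ t)
    refine exists_biSeriesCoeff_eq ε _ (min k m) fun g hg => ?_
    by_cases h : vertexCoeff ε 1 (u₁ t) g = 0
    · refine (min_le_right _ _).trans (hm g fun h' => hg ?_).1
      rw [Pi.sub_apply, h, h', sub_zero]
    · exact (min_le_left _ _).trans (hk g h).1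
  choose n hn using hz
  have e₁ : matAct funAct D (fun t => vertexCoeff ε 1 (u₁ t)) = f := by rw [c₁, hu₁]
  have e₂ : matAct funAct D (fun t => vertexCoeff ε (-1) (u₂ t)) = f := by
    rw [c₂, hu₂]
    exact funext hv'
  have hDn : matAct (biSeriesLaurentAct (R := R) ε) D n = 0 := by
    ext1 t
    refine biSeriesCoeff_injective ε ?_
    have e := congrFun (cN n) t
    rw [← e, funext hn]
    change matAct funAct D ((fun t => vertexCoeff ε 1 (u₁ t)) - fun t => vertexCoeff ε (-1) (u₂ t)) t
      = _
    rw [map_sub, e₁, e₂]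
    simp
  obtain ⟨κ, hκ⟩ := hN n hDn
  have hk₁ : ∀ t, ∃ s : Novikov₂ R, vertexCoeff ε 1 s =
      fun g => if 0 ≤ g.2 then biSeriesCoeff ε (κ t) g else 0 := by
    intro t
    obtain ⟨k, hk⟩ := biSeriesCoeff_bound ε (κ t)
    refine exists_vertexCoeff_eq ε 1 _ (min k 0) fun g hg => ?_
    by_cases h : 0 ≤ g.2
    · rw [if_pos h] at hg
      refine ⟨(min_le_left _ _).trans (hk g hg), (min_le_right _ _).trans ?_⟩
      simpa using h
    · exact absurd (if_neg h) hg
  have hk₂ : ∀ t, ∃ s : Novikov₂ R, vertexCoeff ε (-1) s =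
      fun g => if 0 ≤ g.2 then 0 else - biSeriesCoeff ε (κ t) g := by
    intro t
    obtain ⟨k, hk⟩ := biSeriesCoeff_bound ε (κ t)
    refine exists_vertexCoeff_eq ε (-1) _ (min k 0) fun g hg => ?_
    by_cases h : 0 ≤ g.2
    · exact absurd (if_pos h) hg
    · rw [if_neg h] at hg
      refine ⟨(min_le_left _ _).trans (hk g fun h' => hg (by rw [h', neg_zero])),
        (min_le_right _ _).trans ?_⟩
      simp only [Units.val_neg, Units.val_one]
      omega
  choose k₁ hk₁ using hk₁
  choose k₂ hk₂ using hk₂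
  have hkk : (fun t => vertexCoeff ε 1 (k₁ t)) - (fun t => vertexCoeff ε (-1) (k₂ t))
      = fun t => biSeriesCoeff ε (κ t) := by
    ext t g
    rw [Pi.sub_apply, Pi.sub_apply, hk₁, hk₂]
    dsimp only
    split_ifs <;> simp
  have hw : ∀ t, vertexCoeff ε 1 ((u₁ - matAct (leftReg (vertexHom R ε 1)) D k₁) t)
      = vertexCoeff ε (-1) ((u₂ - matAct (leftReg (vertexHom R ε (-1))) D k₂) t) := by
    intro t
    have e := congrFun (congrArg (matAct funAct D) hkk) t
    rw [map_sub, c₁, c₂, cN, hκ, Pi.sub_apply] at e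
    rw [Pi.sub_apply, Pi.sub_apply, map_sub, map_sub]
    rw [sub_eq_sub_iff_sub_eq_sub]
    exact (e.trans (hn t)).symm
  -- Agreement with an element of `R((x^ε,y⁻¹))` supplies the missing upper bound on the
  -- `y`-exponents.
  have hmem : ∀ t, (u₁ - matAct (leftReg (vertexHom R ε 1)) D k₁) t ∈ thinSubring R := by
    intro t
    obtain ⟨k, hk⟩ := vertexCoeff_bound ε (-1)
      ((u₂ - matAct (leftReg (vertexHom R ε (-1))) D k₂) t)
    refine ⟨-k, fun g hg => ?_⟩
    have h1 : vertexCoeff ε 1 ((u₁ - matAct (leftReg (vertexHom R ε 1)) D k₁) t)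
        ((ε : ℤ) * g.1, g.2) ≠ 0 := by
      simpa [vertexCoeff_apply, units_mul_mul] using hg
    rw [hw t] at h1
    have := (hk _ h1).2
    simp only [Units.val_neg, Units.val_one] at this
    omega
  refine ⟨fun t => ⟨_, hmem t⟩, ?_⟩
  ext1 t
  refine Subtype.ext ?_
  rw [hthin]
  change matAct (leftReg (vertexHom R ε 1)) D (u₁ - matAct (leftReg (vertexHom R ε 1)) D k₁) t = _
  rw [map_sub, hu₁]
  have : matAct (leftReg (vertexHom R ε 1)) D (matAct (leftReg (vertexHom R ε 1)) D k₁) = 0 := by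
    have := congrArg (fun F => F k₁) (congrArg (matAct (leftReg (vertexHom R ε 1))) hD)
    rw [map_mul, map_zero] at this
    exact this
  rw [this, sub_zero]

/-- A matrix over `R((x^ε))[y, y⁻¹]` increases exponents of `y` by a bounded amount. -/
lemma thin_seriesOp_bound (ε : ℤˣ) (s : Matrix T T (thinSubring R)) :
    ∃ M : ℤ, ∀ (B : ℤ) (v : T → LaurentPoly₂ R), (∀ t g, B < |g.2| → (v t).coeff g = 0) →
      ∀ t g, B + M < |g.2| → seriesOp (thinSeries ε) s v t g = 0 := by
  have hb : ∀ t t', ∃ M : ℤ, ∀ g, (s t t' : Novikov₂ R).coeff g ≠ 0 → |g.2| ≤ M := by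
    intro t t'
    obtain ⟨k, hk⟩ := exists_lower_bound (s t t' : Novikov₂ R)
    obtain ⟨m, hm⟩ := mem_thinSubring.1 (s t t').2
    refine ⟨max (-k) m, fun g hg => abs_le.2 ⟨?_, (hm g hg).trans (le_max_right _ _)⟩⟩
    have := (hk g hg).2
    have := le_max_left (-k) m
    omega
  choose M hM using hb
  obtain ⟨N, hN⟩ := (Set.finite_range (fun x : T × T => M x.1 x.2)).bddAbove
  refine ⟨N, fun B v hv t g hg => ?_⟩
  rw [seriesOp_apply, map_sum, Finset.sum_apply]
  refine Finset.sum_eq_zero fun t' _ => ?_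
  by_contra hne
  change ((s t t' : Novikov₂ R) * vertexHom R ε 1 (v t')).coeff _ ≠ 0 at hne
  obtain ⟨a, ha, b, hb, hab⟩ :=
    HahnSeries.support_mul_subset ((HahnSeries.mem_support _ _).2 hne)
  have h1 := (hM t t' a ha).trans (hN ⟨(t, t'), rfl⟩)
  have h2 : |b.2| ≤ B := by
    by_contra! hlt
    have h3 : (v t').coeff ((ε : ℤ) * b.1, b.2) = 0 := hv t' _ hlt
    have h4 := congrFun ((vertexSeries (R := R) ε 1).map_coe (v t')) ((ε : ℤ) * b.1, b.2)
    rw [h3] at h4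
    refine hb ?_
    change (vertexHom R ε 1 (v t')).coeff ((ε : ℤ) * ((ε : ℤ) * b.1), (1 : ℤˣ) * b.2) = 0 at h4
    rw [units_mul_mul] at h4
    simpa using h4
  have h5 : g.2 = a.2 + b.2 := by
    have := congrArg Prod.snd hab
    simpa using this.symm
  rw [h5] at hg
  have := abs_add_le a.2 b.2
  omega

lemma finite_edgeY (δ : ℤˣ) (f : EdgeNovikov R) :
    {g : ℤ × ℤ | (δ : ℤ) * g.2 ≤ 0 ∧ edgeCoeffY δ f g ≠ 0}.Finite := by
  obtain ⟨k, hk⟩ : BddBelow (Function.support f.coeff) := by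
    rcases (Function.support f.coeff).eq_empty_or_nonempty with h0 | h0
    · simp [h0]
    · exact ⟨f.isWF_support.min h0, fun b hb => f.isWF_support.min_le h0 hb⟩
  refine ((Set.finite_Icc k 0).biUnion
    (t := fun q => (fun p => (p, (δ : ℤ) * q)) '' ((f.coeff q).coeff.support : Set ℤ))
    (fun q _ => (Finset.finite_toSet _).image _)).subset fun g hg => ?_
  rw [Set.mem_iUnion₂]
  have hg2 : (f.coeff ((δ : ℤ) * g.2)).coeff g.1 ≠ 0 := hg.2
  refine ⟨(δ : ℤ) * g.2, ⟨hk fun h => hg2 ?_, hg.1⟩, g.1, by simpa using hg2, ?_⟩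
  · rw [h]; rfl
  · simp [units_mul_mul]

lemma finite_thin (ε : ℤˣ) (f : thinSubring R) :
    {g : ℤ × ℤ | (ε : ℤ) * g.1 ≤ 0 ∧ (thinSeries ε).toHom f g ≠ 0}.Finite := by
  obtain ⟨k, hk⟩ := exists_lower_bound (f : Novikov₂ R)
  obtain ⟨m, hm⟩ := mem_thinSubring.1 f.2
  refine (((Set.finite_Icc k 0).prod (Set.finite_Icc k m)).image
    (fun g => ((ε : ℤ) * g.1, g.2))).subset fun g hg => ?_
  have hg2 : (f : Novikov₂ R).coeff ((ε : ℤ) * g.1, (1 : ℤˣ) * g.2) ≠ 0 := hg.2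
  simp only [Units.val_one, one_mul] at hg2
  refine ⟨((ε : ℤ) * g.1, g.2), ⟨⟨(hk _ hg2).1, hg.1⟩, (hk _ hg2).2, hm _ hg2⟩, ?_⟩
  simp [units_mul_mul]

/-- The composite of two maps homotopic to the identity is homotopic to the identity: the defect of
`τ + eσ` is the defect of `σ` followed by that of `τ`, since `e` commutes with `d`. -/
lemma homotopy_comp {A V : Type*} [Ring A] [AddCommGroup V] [Module A V] (d σ τ e : V →ₗ[A] V)
    (hd : ∀ v, d (d v) = 0) (he : ∀ v, e v = v - d (τ v) - τ (d v)) (v : V) :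
    v - d ((τ + e ∘ₗ σ) v) - (τ + e ∘ₗ σ) (d v) = e (v - d (σ v) - σ (d v)) := by
  simp only [LinearMap.add_apply, LinearMap.comp_apply, he, map_sub, map_add, hd]
  simp only [map_zero]
  abel

/-- Vanishing of the eight Novikov homologies implies homotopy finiteness. -/
theorem homotopyFinite_of_exact {D : Matrix T T (LaurentPoly₂ R)} (hD : D * D = 0) {deg : T → ℤ}
    (hdeg : ∀ s t, D s t ≠ 0 → deg s = deg t + 1)
    (hY : ∀ δ, DExact (leftReg (edgeHomY R δ)) D) (hX : ∀ ε, DExact (leftReg (edgeHomX R ε)) D)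
    (hV : ∀ ε δ, DExact (leftReg (vertexHom R ε δ)) D) : HomotopyFinite D := by
  have hA : ∀ ε, DExact (leftReg (thinHom (R := R) ε)) D :=
    fun ε => thin_exact hD hdeg ε (hV ε 1) (hV ε (-1)) (hX ε)
  obtain ⟨s₁, hs₁⟩ := exists_contraction_map _ hD hdeg (hY 1)
  obtain ⟨s₂, hs₂⟩ := exists_contraction_map _ hD hdeg (hY (-1))
  obtain ⟨w₁, hw₁⟩ := exists_contraction_map _ hD hdeg (hA 1)
  obtain ⟨w₂, hw₂⟩ := exists_contraction_map _ hD hdeg (hA (-1))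
  -- The defect of `σ` has bounded `y`-exponents, that of `τ` below bounded `x`-exponents.
  obtain ⟨σ, -, N, hσ⟩ := exists_glue D (AddMonoidHom.snd ℤ ℤ) _ _
    (seriesOp_contraction (edgeSeriesY 1) D s₁ hs₁)
    (seriesOp_contraction (edgeSeriesY (-1)) D s₂ hs₂)
    (fun v t => (finite_edgeY 1 _).subset fun g hg => ⟨by simpa using hg.1.le, hg.2⟩)
    (fun v t => (finite_edgeY (-1) _).subset fun g hg => ⟨by simpa using hg.1, hg.2⟩)
  obtain ⟨τ, hτ, N', hτ'⟩ := exists_glue D (AddMonoidHom.fst ℤ ℤ) _ _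
    (seriesOp_contraction (thinSeries 1) D w₁ hw₁)
    (seriesOp_contraction (thinSeries (-1)) D w₂ hw₂)
    (fun v t => (finite_thin 1 _).subset fun g hg => ⟨by simpa using hg.1.le, hg.2⟩)
    (fun v t => (finite_thin (-1) _).subset fun g hg => ⟨by simpa using hg.1, hg.2⟩)
  obtain ⟨M₁, hM₁⟩ := thin_seriesOp_bound 1 w₁
  obtain ⟨M₂, hM₂⟩ := thin_seriesOp_bound (-1) w₂
  obtain ⟨M₃, hM₃⟩ := exists_support_bound D (AddMonoidHom.snd ℤ ℤ)
  have bD : ∀ (B : ℤ) (v : T → LaurentPoly₂ R), (∀ t g, B < |g.2| → (v t).coeff g = 0) →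
      ∀ t g, B + M₃ < |g.2| → (leftMulLin D v t).coeff g = 0 := by
    intro B v hv t g hg
    have e : coeffFun (leftMulLin D v) t g = matAct funAct D (coeffFun v) t g := by
      rw [matAct_coeffFun]
    refine e.trans ((matAct_funAct_congr D _ 0 t g fun t' k hk => hv t' _ ?_).trans (by simp))
    have h1 := hM₃ t t' k hk
    have h2 := abs_sub_abs_le_abs_sub g.2 k.2
    simp only [AddMonoidHom.coe_snd] at h1
    rw [Prod.snd_sub]
    omega
  have bτ : ∀ (B : ℤ) (v : T → LaurentPoly₂ R), (∀ t g, B < |g.2| → (v t).coeff g = 0) →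
      ∀ t g, B + max M₁ M₂ < |g.2| → (τ v t).coeff g = 0 := by
    intro B v hv t g hg
    rw [hτ]
    have := le_max_left M₁ M₂
    have := le_max_right M₁ M₂
    split_ifs
    · exact hM₁ B v hv t g (by omega)
    · exact hM₂ B v hv t g (by omega)
  have hd : ∀ v, leftMulLin D (leftMulLin D v) = 0 := leftMulLin_comp_self hD
  obtain ⟨e, he⟩ : ∃ e : (T → LaurentPoly₂ R) →ₗ[Rᵐᵒᵖ] (T → LaurentPoly₂ R),
      ∀ v, e v = v - leftMulLin D (τ v) - τ (leftMulLin D v) :=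
    ⟨LinearMap.id - leftMulLin D ∘ₗ τ - τ ∘ₗ leftMulLin D, fun _ => rfl⟩
  -- On a vector with `y`-exponents bounded by `N`, the defect of `τ` applies `D` and `τ` once each,
  -- so `P` bounds the `y`-exponents of the result. The absolute values guard against negative
  -- bounds.
  obtain ⟨P, hP⟩ : ∃ P, P = N + |max M₁ M₂| + |M₃| := ⟨_, rfl⟩
  refine ⟨τ + e ∘ₗ σ, Finset.Icc (-N') N' ×ˢ Finset.Icc (-P) P, fun c t g hg => ?_⟩
  rw [homotopy_comp _ σ τ e hd he]
  have hv := hσ c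
  generalize c - leftMulLin D (σ c) - σ (leftMulLin D c) = v at hv
  rw [he]
  by_cases h1 : N' < |g.1|
  · exact hτ' v t g h1
  · have h2 : P < |g.2| := by
      by_contra! h2
      refine hg ?_
      rw [Finset.mem_product, Finset.mem_Icc, Finset.mem_Icc]
      exact ⟨abs_le.1 (not_lt.1 h1), abs_le.1 h2⟩
    have hM := le_abs_self M₃
    have hM' := le_abs_self (max M₁ M₂)
    have hM0 := abs_nonneg M₃
    have hM0' := abs_nonneg (max M₁ M₂)
    have e1 := hv t g (by simp only [AddMonoidHom.coe_snd]; omega)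
    have e2 := bD _ _ (bτ N v hv) t g (by omega)
    have e3 := bτ _ _ (bD N v hv) t g (by omega)
    rw [Pi.sub_apply, Pi.sub_apply, AddMonoidAlgebra.coeff_sub, AddMonoidAlgebra.coeff_sub,
      Finsupp.sub_apply, Finsupp.sub_apply, e1, e2, e3]
    simp

end FiniteHomotopy

/-! ### Induced modules and the exact sequence of `z ⊗ 1 - 1 ⊗ z`. -/

section Induction

variable {R : Type u} [Ring R] {N : Type*} [AddCommGroup N]

lemma end_mul_apply (f g : AddMonoid.End N) (n : N) : (f * g) n = f (g n) := rfl

lemma end_add_apply (f g : AddMonoid.End N) (n : N) : (f + g) n = f n + g n := rfl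

/-- Apply an additive endomorphism to all coefficients. -/
def mapEnd (f : AddMonoid.End N) : AddMonoid.End (ℤ →₀ N) := Finsupp.mapRange.addMonoidHom f

/-- Shift the exponents. -/
def shiftFinsupp (k : ℤ) : AddMonoid.End (ℤ →₀ N) := Finsupp.mapDomain.addMonoidHom (· + k)

@[simp] lemma mapEnd_single (f : AddMonoid.End N) (k : ℤ) (n : N) :
    mapEnd f (Finsupp.single k n) = Finsupp.single k (f n) :=
  Finsupp.mapRange_single (hf := map_zero f)

@[simp] lemma shiftFinsupp_single (k j : ℤ) (n : N) :
    shiftFinsupp k (Finsupp.single j n) = Finsupp.single (j + k) n :=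
  Finsupp.mapDomain_single

lemma mapEnd_apply (f : AddMonoid.End N) (w : ℤ →₀ N) (k : ℤ) : mapEnd f w k = f (w k) := rfl

lemma shiftFinsupp_apply (k j : ℤ) (w : ℤ →₀ N) : shiftFinsupp k w j = w (j - k) := by
  have h := Finsupp.mapDomain_apply (f := fun x : ℤ => x + k) (add_left_injective k) w (j - k)
  rw [sub_add_cancel] at h
  exact h

lemma end_finsupp_ext {f g : AddMonoid.End (ℤ →₀ N)}
    (h : ∀ k n, f (Finsupp.single k n) = g (Finsupp.single k n)) : f = g :=
  Finsupp.addHom_ext h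

/-- A splitting of `ℤ × ℤ` into the multiples of an element `z` and a complement. -/
structure LatticeSplitting where
  /-- the generator of the first summand -/
  z : ℤ × ℤ
  /-- the coordinate on the first summand -/
  π : ℤ × ℤ →+ ℤ
  /-- the projection to the second summand -/
  κ : ℤ × ℤ →+ ℤ × ℤ
  π_z : π z = 1
  κ_z : κ z = 0
  decomp : ∀ g, g = π g • z + κ g

/-- The splitting with respect to the first coordinate. -/
def splitX : LatticeSplitting where
  z := (1, 0)
  π := AddMonoidHom.fst ℤ ℤ
  κ := (AddMonoidHom.inr ℤ ℤ).comp (AddMonoidHom.snd ℤ ℤ)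
  π_z := rfl
  κ_z := rfl
  decomp g := by ext <;> simp

/-- The splitting with respect to the second coordinate. -/
def splitY : LatticeSplitting where
  z := (0, 1)
  π := AddMonoidHom.snd ℤ ℤ
  κ := (AddMonoidHom.inl ℤ ℤ).comp (AddMonoidHom.fst ℤ ℤ)
  π_z := rfl
  κ_z := rfl
  decomp g := by ext <;> simp

variable (s : LatticeSplitting) (ρ : LaurentPoly₂ R →+* AddMonoid.End N)

/-- The action of the Laurent polynomials induced from the action of the subring of Laurent
polynomials in the complementary variable. -/
def indAct : LaurentPoly₂ R →+* AddMonoid.End (ℤ →₀ N) :=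
  AddMonoidAlgebra.liftNCRingHom
    { toFun := fun r => mapEnd (ρ (AddMonoidAlgebra.single 0 r))
      map_one' := end_finsupp_ext fun k n => by
        rw [mapEnd_single, ← AddMonoidAlgebra.one_def, map_one]
        rfl
      map_mul' := fun r r' => end_finsupp_ext fun k n => by
        rw [end_mul_apply, mapEnd_single, mapEnd_single, mapEnd_single,
          ← end_mul_apply, ← map_mul, AddMonoidAlgebra.single_mul_single, add_zero]
      map_zero' := end_finsupp_ext fun k n => by
        rw [mapEnd_single, AddMonoidAlgebra.single_zero, map_zero]
        simp
      map_add' := fun r r' => end_finsupp_ext fun k n => by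
        rw [end_add_apply, mapEnd_single, mapEnd_single, mapEnd_single,
          AddMonoidAlgebra.single_add, map_add, end_add_apply, Finsupp.single_add] }
    { toFun := fun g =>
        shiftFinsupp (s.π g.toAdd) * mapEnd (ρ (AddMonoidAlgebra.single (s.κ g.toAdd) 1))
      map_one' := end_finsupp_ext fun k n => by
        rw [end_mul_apply, mapEnd_single, shiftFinsupp_single, toAdd_one, map_zero,
          map_zero, ← AddMonoidAlgebra.one_def, map_one, add_zero]
        rfl
      map_mul' := fun g h => end_finsupp_ext fun k n => by
        simp only [end_mul_apply, mapEnd_single, shiftFinsupp_single]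
        rw [← end_mul_apply, ← map_mul, AddMonoidAlgebra.single_mul_single, one_mul,
          toAdd_mul, map_add, map_add, add_comm (s.π _), add_assoc] }
    (fun r g => end_finsupp_ext fun k n => by
      change mapEnd (ρ (AddMonoidAlgebra.single 0 r)) (shiftFinsupp (s.π g.toAdd)
          (mapEnd (ρ (AddMonoidAlgebra.single (s.κ g.toAdd) 1)) (Finsupp.single k n)))
        = shiftFinsupp (s.π g.toAdd) (mapEnd (ρ (AddMonoidAlgebra.single (s.κ g.toAdd) 1))
          (mapEnd (ρ (AddMonoidAlgebra.single 0 r)) (Finsupp.single k n)))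
      simp only [mapEnd_single, shiftFinsupp_single]
      rw [← end_mul_apply, ← end_mul_apply, ← map_mul, ← map_mul,
        AddMonoidAlgebra.single_mul_single, AddMonoidAlgebra.single_mul_single, one_mul, mul_one,
        zero_add, add_zero])

lemma indAct_single_single (g : ℤ × ℤ) (r : R) (k : ℤ) (n : N) :
    indAct s ρ (AddMonoidAlgebra.single g r) (Finsupp.single k n)
      = Finsupp.single (k + s.π g) (ρ (AddMonoidAlgebra.single (s.κ g) r) n) := by
  have h : indAct s ρ (AddMonoidAlgebra.single g r) = mapEnd (ρ (AddMonoidAlgebra.single 0 r)) *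
      (shiftFinsupp (s.π g) * mapEnd (ρ (AddMonoidAlgebra.single (s.κ g) 1))) :=
    AddMonoidAlgebra.liftNC_single _ _ _ _
  rw [h]
  simp only [end_mul_apply, mapEnd_single, shiftFinsupp_single]
  rw [← end_mul_apply, ← map_mul, AddMonoidAlgebra.single_mul_single, zero_add, mul_one]

/-- The difference between the two ways in which the distinguished variable acts on the induced
module. -/
def indDiff : (ℤ →₀ N) →+ (ℤ →₀ N) :=
  AddMonoidHom.mk' (fun w => shiftFinsupp 1 w - mapEnd (ρ (AddMonoidAlgebra.single s.z 1)) w)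
    (fun v w => by rw [map_add, map_add]; abel)

lemma indDiff_eq (w : ℤ →₀ N) : indDiff s ρ w =
    shiftFinsupp 1 w - mapEnd (ρ (AddMonoidAlgebra.single s.z 1)) w := rfl

lemma indDiff_single (k : ℤ) (n : N) : indDiff s ρ (Finsupp.single k n)
    = Finsupp.single (k + 1) n - Finsupp.single k (ρ (AddMonoidAlgebra.single s.z 1) n) := by
  rw [indDiff_eq, mapEnd_single, shiftFinsupp_single]

lemma indDiff_apply (w : ℤ →₀ N) (k : ℤ) : indDiff s ρ w k
    = w (k - 1) - ρ (AddMonoidAlgebra.single s.z 1) (w k) := by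
  rw [indDiff_eq, Finsupp.sub_apply, mapEnd_apply, shiftFinsupp_apply]

/-- The augmentation of the induced module. -/
def indAug : (ℤ →₀ N) →+ N :=
  Finsupp.liftAddHom fun k => ρ (AddMonoidAlgebra.single (k • s.z) 1)

lemma indAug_single (k : ℤ) (n : N) :
    indAug s ρ (Finsupp.single k n) = ρ (AddMonoidAlgebra.single (k • s.z) 1) n :=
  Finsupp.liftAddHom_apply_single _ _ _

lemma act_act (l l' : LaurentPoly₂ R) (n : N) : ρ l (ρ l' n) = ρ (l * l') n := by
  rw [map_mul]; rfl

lemma indAug_act (l : LaurentPoly₂ R) (w : ℤ →₀ N) :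
    indAug s ρ (indAct s ρ l w) = ρ l (indAug s ρ w) := by
  refine equivariant_of_single _ _ _ (fun g r w => ?_) l w
  induction w using Finsupp.induction_linear with
  | zero => simp
  | add f g hf hg => simp only [map_add, hf, hg]
  | single k n =>
    rw [indAct_single_single, indAug_single, indAug_single, act_act, act_act,
      AddMonoidAlgebra.single_mul_single, AddMonoidAlgebra.single_mul_single, one_mul, mul_one]
    congr 3
    conv_rhs => rw [s.decomp g]
    rw [add_smul]
    abel

lemma indDiff_act (l : LaurentPoly₂ R) (w : ℤ →₀ N) :
    indDiff s ρ (indAct s ρ l w) = indAct s ρ l (indDiff s ρ w) := by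
  refine equivariant_of_single _ _ _ (fun g r w => ?_) l w
  induction w using Finsupp.induction_linear with
  | zero => simp
  | add f g hf hg => simp only [map_add, hf, hg]
  | single k n =>
    rw [indAct_single_single, indDiff_single, indDiff_single, map_sub, indAct_single_single,
      indAct_single_single, act_act, act_act,
      AddMonoidAlgebra.single_mul_single, AddMonoidAlgebra.single_mul_single, one_mul, mul_one,
      add_right_comm, add_comm s.z]

lemma indAug_indDiff (w : ℤ →₀ N) : indAug s ρ (indDiff s ρ w) = 0 := by
  induction w using Finsupp.induction_linear with
  | zero => simp
  | add f g hf hg => simp only [map_add, hf, hg, add_zero]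
  | single k n =>
    rw [indDiff_single, map_sub, indAug_single, indAug_single, act_act,
      AddMonoidAlgebra.single_mul_single, one_mul, add_smul, one_smul, sub_self]

lemma act_z_injective : Function.Injective (ρ (AddMonoidAlgebra.single s.z 1)) := by
  refine Function.LeftInverse.injective (g := ρ (AddMonoidAlgebra.single (-s.z) 1)) fun n => ?_
  rw [act_act, AddMonoidAlgebra.single_mul_single, one_mul, neg_add_cancel,
    ← AddMonoidAlgebra.one_def, map_one]
  rfl

/-- The coefficient of lowest exponent is only multiplied by `-z`, which is invertible. -/
lemma indDiff_injective : Function.Injective (indDiff s ρ) := by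
  rw [injective_iff_map_eq_zero]
  intro w hw
  by_contra hne
  have hsup : w.support.Nonempty := Finsupp.support_nonempty_iff.2 hne
  set k := w.support.min' hsup with hk
  have h1 := DFunLike.congr_fun hw k
  rw [indDiff_apply] at h1
  have h2 : w (k - 1) = 0 := by
    by_contra h
    have := w.support.min'_le (k - 1) (Finsupp.mem_support_iff.2 h)
    omega
  rw [h2, zero_sub, Finsupp.coe_zero, Pi.zero_apply, neg_eq_zero] at h1
  have h3 : w k ≠ 0 := Finsupp.mem_support_iff.1 (w.support.min'_mem hsup)
  exact h3 (act_z_injective s ρ (h1.trans (map_zero _).symm))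

/-- Modulo the range, `single (k + 1) n` equals `single k (z n)`. Moving all terms to exponent `0`,
in either direction as `z` is invertible, reduces `w` to its augmentation. -/
lemma exists_indDiff_eq (w : ℤ →₀ N) (hw : indAug s ρ w = 0) : ∃ w', indDiff s ρ w' = w := by
  have key : ∀ w : ℤ →₀ N, w - Finsupp.single 0 (indAug s ρ w) ∈ (indDiff s ρ).range := by
    intro w
    induction w using Finsupp.induction_linear with
    | zero => simp
    | add f g hf hg =>
      have := add_mem hf hg
      rw [map_add, Finsupp.single_add]
      convert this using 1
      abel
    | single k n =>
      have hsucc : ∀ (k : ℤ) (n : N), Finsupp.single (k + 1) n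
          - Finsupp.single k (ρ (AddMonoidAlgebra.single s.z 1) n) ∈ (indDiff s ρ).range :=
        fun k n => ⟨_, indDiff_single s ρ k n⟩
      have haug : ∀ (k : ℤ) (n : N), indAug s ρ (Finsupp.single (k + 1) n)
          = indAug s ρ (Finsupp.single k (ρ (AddMonoidAlgebra.single s.z 1) n)) := by
        intro k n
        rw [indAug_single, indAug_single, act_act, AddMonoidAlgebra.single_mul_single, one_mul,
          add_smul, one_smul]
      induction k using Int.induction_on generalizing n with
      | zero =>
        rw [indAug_single, zero_smul, ← AddMonoidAlgebra.one_def, map_one]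
        simp
      | succ k ih =>
        have := add_mem (hsucc k n) (ih (ρ (AddMonoidAlgebra.single s.z 1) n))
        rw [haug]
        convert this using 1
        abel
      | pred k ih =>
        obtain ⟨n', rfl⟩ : ∃ n', ρ (AddMonoidAlgebra.single s.z 1) n' = n :=
          ⟨ρ (AddMonoidAlgebra.single (-s.z) 1) n, by
            rw [act_act, AddMonoidAlgebra.single_mul_single, one_mul, add_neg_cancel,
              ← AddMonoidAlgebra.one_def, map_one]
            rfl⟩
        have h1 := hsucc (-k - 1) n'
        have h2 := haug (-k - 1) n'
        rw [sub_add_cancel] at h1 h2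
        have := sub_mem (ih n') h1
        rw [← h2]
        convert this using 1
        abel
  obtain ⟨w', hw'⟩ := key w
  exact ⟨w', by rw [hw', hw, Finsupp.single_zero, sub_zero]⟩

variable {T : Type*} [Fintype T] [DecidableEq T]

lemma matAct_matAct_self {A N : Type*} [Ring A] [AddCommGroup N] (ρ : A →+* AddMonoid.End N)
    {D : Matrix T T A} (hD : D * D = 0) (v : T → N) : matAct ρ D (matAct ρ D v) = 0 := by
  have := congrArg (fun F => F v) (congrArg (matAct ρ) hD)
  rw [map_mul, map_zero] at this
  exact this

/-- If the difference map is bijective on the homology of the induced module, then the original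
module is exact. -/
lemma DExact.of_indDiff {D : Matrix T T (LaurentPoly₂ R)} (hD : D * D = 0)
    (hinj : ∀ y w, matAct (indAct s ρ) D y = 0 →
      (fun t => indDiff s ρ (y t)) = matAct (indAct s ρ) D w → ∃ w', matAct (indAct s ρ) D w' = y)
    (hsurj : ∀ y, matAct (indAct s ρ) D y = 0 → ∃ w l, matAct (indAct s ρ) D w = 0 ∧
      y = (fun t => indDiff s ρ (w t)) + matAct (indAct s ρ) D l) : DExact ρ D := by
  intro v hv
  have hU : ∀ y, matAct (indAct s ρ) D (fun t => indDiff s ρ (y t))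
      = fun t => indDiff s ρ (matAct (indAct s ρ) D y t) := fun y =>
    matAct_map (indAct s ρ) (indAct s ρ) (indDiff s ρ) (indDiff_act s ρ) D y
  have hq : ∀ y, matAct ρ D (fun t => indAug s ρ (y t))
      = fun t => indAug s ρ (matAct (indAct s ρ) D y t) := fun y =>
    matAct_map (indAct s ρ) ρ (indAug s ρ) (indAug_act s ρ) D y
  obtain ⟨v', hv'⟩ : ∃ v' : T → ℤ →₀ N, ∀ t, indAug s ρ (v' t) = v t :=
    ⟨fun t => Finsupp.single 0 (v t), fun t => by
      rw [indAug_single, zero_smul, ← AddMonoidAlgebra.one_def, map_one]; rfl⟩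
  -- The cycle `E` represents the image of `v` under the connecting map of the long exact sequence;
  -- `hinj` makes it a boundary.
  have h1 : ∀ t, ∃ E, indDiff s ρ E = matAct (indAct s ρ) D v' t := fun t =>
    exists_indDiff_eq s ρ _ (by
      have := congrFun (hq v') t
      rw [← this, funext hv', hv]; rfl)
  choose E hE using h1
  have hE0 : matAct (indAct s ρ) D E = 0 := by
    ext1 t
    refine indDiff_injective s ρ ?_
    have := congrFun (hU E) t
    rw [← this, funext hE, matAct_matAct_self _ hD]
    simp
  obtain ⟨k, hk⟩ := hinj E v' hE0 (funext hE)
  -- The lift corrected by `k` is a cycle. Writing it as an `indDiff` value plus a boundary and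
  -- augmenting exhibits `v` as a boundary.
  obtain ⟨w, l, -, hwl⟩ := hsurj (v' - fun t => indDiff s ρ (k t)) (by
    rw [map_sub, hU, hk, funext hE, sub_self])
  refine ⟨fun t => indAug s ρ (l t), ?_⟩
  rw [hq]
  ext1 t
  have h2 := congrArg (indAug s ρ) (congrFun hwl t)
  rw [Pi.sub_apply, Pi.add_apply, map_sub, map_add, indAug_indDiff, indAug_indDiff, hv', sub_zero,
    zero_add] at h2
  exact h2.symm

lemma DExact.of_indAct {D : Matrix T T (LaurentPoly₂ R)} (hD : D * D = 0)
    (h : DExact (indAct s ρ) D) : DExact ρ D :=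
  DExact.of_indDiff s ρ hD (fun y _ hy _ => h y hy) (fun y hy => by
    obtain ⟨l, hl⟩ := h y hy
    refine ⟨0, l, map_zero _, ?_⟩
    rw [hl]
    ext1 t
    simp)

end Induction

/-! ### The module `L^T ⊗_R S` and operators on it. -/

section TensorOverBase

set_option linter.unusedSectionVars false

variable {R : Type u} [Ring R] {S : Type*} [Ring S] (φ : LaurentPoly₂ R →+* S)
variable {T : Type*} [Fintype T] [DecidableEq T]

/-- Laurent polynomials in two variables with coefficients in `S`, as an additive group. -/
def FreeMod (S : Type*) [Ring S] : Type _ := ℤ →₀ ℤ →₀ S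

instance : AddCommGroup (FreeMod S) := inferInstanceAs (AddCommGroup (ℤ →₀ ℤ →₀ S))

/-- The monomials in `FreeMod S`. -/
def FreeMod.single (g : ℤ × ℤ) : S →+ FreeMod S where
  toFun m := (Finsupp.single g.2 (Finsupp.single g.1 m) : ℤ →₀ ℤ →₀ S)
  map_zero' := by
    change (Finsupp.single g.2 (Finsupp.single g.1 0) : ℤ →₀ ℤ →₀ S) = 0
    simp
  map_add' m m' := by
    change (Finsupp.single g.2 (Finsupp.single g.1 (m + m')) : ℤ →₀ ℤ →₀ S)
      = Finsupp.single g.2 (Finsupp.single g.1 m) + Finsupp.single g.2 (Finsupp.single g.1 m')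
    simp

lemma FreeMod.induction {P : FreeMod S → Prop} (h0 : P 0)
    (hadd : ∀ v w, P v → P w → P (v + w)) (hsingle : ∀ g m, P (FreeMod.single g m))
    (v : FreeMod S) : P v := by
  refine Finsupp.induction_linear (motive := P) v h0 (fun f g hf hg => hadd _ _ hf hg)
    fun q w => ?_
  refine Finsupp.induction_linear (motive := fun w => P (Finsupp.single q w)) w ?_ ?_ fun p m => ?_
  · rwa [Finsupp.single_zero]
  · intro f g hf hg
    rw [Finsupp.single_add]
    exact hadd _ _ hf hg
  · exact hsingle (p, q) m

/-- The map out of `FreeMod S` determined by its values on monomials. -/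
def FreeMod.lift {Y : Type*} [AddCommGroup Y] (f : ℤ × ℤ → S →+ Y) : FreeMod S →+ Y :=
  (Finsupp.liftAddHom fun q => Finsupp.liftAddHom fun p => f (p, q) : (ℤ →₀ ℤ →₀ S) →+ Y)

lemma FreeMod.lift_single {Y : Type*} [AddCommGroup Y] (f : ℤ × ℤ → S →+ Y) (g : ℤ × ℤ) (m : S) :
    FreeMod.lift f (FreeMod.single g m) = f g m := by
  change Finsupp.liftAddHom (fun q => Finsupp.liftAddHom fun p => f (p, q))
    (Finsupp.single g.2 (Finsupp.single g.1 m)) = _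
  rw [Finsupp.liftAddHom_apply_single, Finsupp.liftAddHom_apply_single]

/-- The action of the Laurent polynomials on `L ⊗_R S`, realised as Laurent polynomials in two
variables with coefficients in `S`. -/
def freeAct : LaurentPoly₂ R →+* AddMonoid.End (FreeMod S) :=
  indAct splitY (indAct splitX (leftReg φ))

lemma freeAct_single (g h : ℤ × ℤ) (r : R) (m : S) :
    freeAct φ (AddMonoidAlgebra.single g r) (FreeMod.single h m)
      = FreeMod.single (h + g) (φ (AddMonoidAlgebra.single 0 r) * m) := by
  change indAct splitY (indAct splitX (leftReg φ)) (AddMonoidAlgebra.single g r)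
    (Finsupp.single h.2 (Finsupp.single h.1 m)) = _
  rw [indAct_single_single, indAct_single_single]
  rfl

lemma freeAct_mul (l l' : LaurentPoly₂ R) (w : FreeMod S) :
    freeAct φ (l * l') w = freeAct φ l (freeAct φ l' w) := by
  rw [map_mul]; rfl

lemma freeAct_sum {ι : Type*} (s : Finset ι) (f : ι → LaurentPoly₂ R) (w : FreeMod S) :
    freeAct φ (∑ i ∈ s, f i) w = ∑ i ∈ s, freeAct φ (f i) w := by
  rw [map_sum]
  exact endSum_apply s _ w

/-- The pure tensors in `L^T ⊗_R S`. -/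
def pureTensor : (T → LaurentPoly₂ R) →+ S →+ (T → FreeMod S) where
  toFun c :=
    { toFun := fun m t => freeAct φ (c t) (FreeMod.single 0 m)
      map_zero' := by ext1 t; simp
      map_add' := fun m m' => by ext1 t; simp }
  map_zero' := by
    ext m t : 2
    change freeAct φ 0 (FreeMod.single 0 m) = 0
    rw [map_zero]; rfl
  map_add' c c' := by
    ext m t : 2
    change freeAct φ (c t + c' t) (FreeMod.single 0 m) = _
    rw [map_add]; rfl

lemma pureTensor_apply (c : T → LaurentPoly₂ R) (m : S) (t : T) :
    pureTensor φ c m t = freeAct φ (c t) (FreeMod.single 0 m) := rfl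

lemma pureTensor_sub (c c' : T → LaurentPoly₂ R) (m : S) :
    pureTensor φ (c - c') m = pureTensor φ c m - pureTensor φ c' m := by
  rw [eq_sub_iff_add_eq]
  have h := map_add (pureTensor φ) (c - c') c'
  rw [sub_add_cancel] at h
  rw [h]
  rfl

/-- The standard basis of the right `R`-module `L^T`. -/
def stdVec (t : T) (g : ℤ × ℤ) : T → LaurentPoly₂ R := Pi.single t (AddMonoidAlgebra.single g 1)

lemma pureTensor_stdVec (t : T) (g : ℤ × ℤ) (m : S) :
    pureTensor φ (stdVec t g) m = Pi.single t (FreeMod.single g m) := by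
  ext1 t'
  rw [pureTensor_apply, stdVec]
  by_cases h : t' = t
  · subst h
    rw [Pi.single_eq_same, Pi.single_eq_same, freeAct_single, ← AddMonoidAlgebra.one_def, map_one,
      one_mul, zero_add]
  · rw [Pi.single_eq_of_ne h, Pi.single_eq_of_ne h, map_zero]
    rfl

lemma pureTensor_smul (r : R) (c : T → LaurentPoly₂ R) (m : S) :
    pureTensor φ (MulOpposite.op r • c) m
      = pureTensor φ c (φ (AddMonoidAlgebra.single 0 r) * m) := by
  ext1 t
  rw [pureTensor_apply, pureTensor_apply, Pi.smul_apply, op_smul_eq_mul_single, freeAct_mul,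
    freeAct_single]
  simp

lemma pureTensor_matAct (D : Matrix T T (LaurentPoly₂ R)) (c : T → LaurentPoly₂ R) (m : S) :
    matAct (freeAct φ) D (pureTensor φ c m) = pureTensor φ (leftMulLin D c) m := by
  ext1 s
  rw [pureTensor_apply, leftMulLin_apply, matAct_apply, matAct_apply, freeAct_sum]
  refine Finset.sum_congr rfl fun t _ => ?_
  rw [pureTensor_apply, leftReg_apply, freeAct_mul]
  rfl

/-- A vector of Laurent polynomials is a combination of the standard basis vectors. -/
lemma sum_stdVec (K : Finset (ℤ × ℤ)) (c : T → LaurentPoly₂ R)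
    (hc : ∀ t, ∀ g ∉ K, (c t).coeff g = 0) :
    c = ∑ t, ∑ g ∈ K, MulOpposite.op ((c t).coeff g) • stdVec t g := by
  ext t k
  rw [Finset.sum_apply, AddMonoidAlgebra.coeff_sum, Finsupp.finsetSum_apply,
    Finset.sum_eq_single t]
  · rw [Finset.sum_apply, AddMonoidAlgebra.coeff_sum, Finsupp.finsetSum_apply]
    simp only [stdVec, Pi.smul_apply, Pi.single_eq_same, AddMonoidAlgebra.smul_single,
      AddMonoidAlgebra.coeff_single, Finsupp.single_apply]
    rw [Finset.sum_ite_eq' K k]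
    by_cases hk : k ∈ K
    · simp [hk]
    · simp [hk, hc t k hk]
  · intro t' _ h
    rw [Finset.sum_apply, Finset.sum_eq_zero]
    · rfl
    · intro g _
      rw [Pi.smul_apply, stdVec, Pi.single_eq_of_ne h.symm, smul_zero]
  · simp

lemma exists_common_support (c : T → LaurentPoly₂ R) :
    ∃ K : Finset (ℤ × ℤ), ∀ t, ∀ g ∉ K, (c t).coeff g = 0 := by
  refine ⟨Finset.univ.biUnion fun t => (c t).coeff.support, fun t g hg => ?_⟩
  by_contra h
  exact hg (Finset.mem_biUnion.2 ⟨t, Finset.mem_univ t, Finsupp.mem_support_iff.2 h⟩)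

lemma tensor_induction {P : (T → FreeMod S) → Prop} (h0 : P 0)
    (hadd : ∀ v w, P v → P w → P (v + w)) (hpure : ∀ c m, P (pureTensor φ c m))
    (v : T → FreeMod S) : P v := by
  have h1 : ∀ t w, P (Pi.single t w) := by
    intro t w
    refine FreeMod.induction (P := fun w => P (Pi.single t w)) ?_ ?_ (fun g m => ?_) w
    · rwa [Pi.single_zero]
    · intro f g hf hg
      rw [Pi.single_add]
      exact hadd _ _ hf hg
    · have := hpure (stdVec t g) m
      rwa [pureTensor_stdVec] at this
  rw [← Finset.univ_sum_single v]
  exact Finset.sum_induction _ P hadd h0 fun t _ => h1 t _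

lemma tensor_hom_ext {Y : Type*} [AddCommGroup Y] (f g : (T → FreeMod S) →+ Y)
    (h : ∀ c m, f (pureTensor φ c m) = g (pureTensor φ c m)) (v : T → FreeMod S) : f v = g v :=
  tensor_induction φ (P := fun v => f v = g v) (by rw [map_zero, map_zero])
    (fun v w hv hw => by rw [map_add, map_add, hv, hw]) h v

/-- The map out of `L^T ⊗_R S` induced by a balanced biadditive map. -/
def tensorLift {Y : Type*} [AddCommGroup Y] (β : (T → LaurentPoly₂ R) →+ S →+ Y) :
    (T → FreeMod S) →+ Y :=
  ∑ t, (FreeMod.lift fun g => β (stdVec t g)).comp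
    (Pi.evalAddMonoidHom _ t)

lemma tensorLift_single {Y : Type*} [AddCommGroup Y] (β : (T → LaurentPoly₂ R) →+ S →+ Y)
    (t : T) (g : ℤ × ℤ) (m : S) :
    tensorLift β (Pi.single t (FreeMod.single g m)) = β (stdVec t g) m := by
  rw [tensorLift, AddMonoidHom.finsetSum_apply, Finset.sum_eq_single t]
  · rw [AddMonoidHom.comp_apply, Pi.evalAddMonoidHom_apply, Pi.single_eq_same,
      FreeMod.lift_single]
  · intro t' _ h
    rw [AddMonoidHom.comp_apply, Pi.evalAddMonoidHom_apply, Pi.single_eq_of_ne h, map_zero]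
  · simp

/-- `tensorLift` is defined by values on the `R`-basis `stdVec`; balancedness extends the formula to
all vectors. Operators on `L^T ⊗_R S` can thus be compared on pure tensors. -/
lemma tensorLift_pureTensor {Y : Type*} [AddCommGroup Y] (β : (T → LaurentPoly₂ R) →+ S →+ Y)
    (hβ : ∀ r c m, β (MulOpposite.op r • c) m = β c (φ (AddMonoidAlgebra.single 0 r) * m))
    (c : T → LaurentPoly₂ R) (m : S) : tensorLift β (pureTensor φ c m) = β c m := by
  obtain ⟨K, hK⟩ := exists_common_support c
  rw [sum_stdVec K c hK]
  simp only [map_sum, AddMonoidHom.finsetSum_apply]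
  refine Finset.sum_congr rfl fun t _ => Finset.sum_congr rfl fun g _ => ?_
  rw [pureTensor_smul, hβ, pureTensor_stdVec, tensorLift_single]

/-- The endomorphism of `L^T ⊗_R S` induced by an endomorphism of the right `R`-module `L^T`. -/
def tensorMap (Q : (T → LaurentPoly₂ R) →ₗ[Rᵐᵒᵖ] (T → LaurentPoly₂ R)) :
    (T → FreeMod S) →+ (T → FreeMod S) :=
  tensorLift (Y := T → FreeMod S) ((pureTensor φ).comp Q.toAddMonoidHom)

lemma tensorMap_pureTensor (Q : (T → LaurentPoly₂ R) →ₗ[Rᵐᵒᵖ] (T → LaurentPoly₂ R))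
    (c : T → LaurentPoly₂ R) (m : S) :
    tensorMap φ Q (pureTensor φ c m) = pureTensor φ (Q c) m :=
  tensorLift_pureTensor φ _ (fun r c m => by
    change pureTensor φ (Q (MulOpposite.op r • c)) m = _
    rw [map_smul, pureTensor_smul]
    rfl) c m

lemma tensorMap_comp (Q Q' : (T → LaurentPoly₂ R) →ₗ[Rᵐᵒᵖ] (T → LaurentPoly₂ R))
    (v : T → FreeMod S) : tensorMap φ (Q ∘ₗ Q') v = tensorMap φ Q (tensorMap φ Q' v) :=
  tensor_hom_ext φ (tensorMap φ (Q ∘ₗ Q')) ((tensorMap φ Q).comp (tensorMap φ Q')) (fun c m => by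
    rw [AddMonoidHom.comp_apply, tensorMap_pureTensor, tensorMap_pureTensor, tensorMap_pureTensor]
    rfl) v

lemma tensorMap_sub (Q Q' : (T → LaurentPoly₂ R) →ₗ[Rᵐᵒᵖ] (T → LaurentPoly₂ R))
    (v : T → FreeMod S) : tensorMap φ (Q - Q') v = tensorMap φ Q v - tensorMap φ Q' v :=
  tensor_hom_ext φ (tensorMap φ (Q - Q')) (tensorMap φ Q - tensorMap φ Q') (fun c m => by
    rw [AddMonoidHom.sub_apply, tensorMap_pureTensor, tensorMap_pureTensor, tensorMap_pureTensor,
      LinearMap.sub_apply, pureTensor_sub]) v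

lemma tensorMap_id (v : T → FreeMod S) :
    tensorMap φ (LinearMap.id : (T → LaurentPoly₂ R) →ₗ[Rᵐᵒᵖ] _) v = v :=
  tensor_hom_ext φ (tensorMap φ LinearMap.id) (AddMonoidHom.id _) (fun c m => by
    rw [tensorMap_pureTensor]
    rfl) v

lemma tensorMap_leftMulLin (D : Matrix T T (LaurentPoly₂ R)) (v : T → FreeMod S) :
    tensorMap φ (leftMulLin D) v = matAct (freeAct φ) D v :=
  tensor_hom_ext φ (tensorMap φ (leftMulLin D)) (matAct (freeAct φ) D) (fun c m => by
    rw [tensorMap_pureTensor]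
    exact (pureTensor_matAct φ D c m).symm) v

/-- Multiplication by a monomial on vectors of Laurent polynomials. -/
def monomialLin (g : ℤ × ℤ) : (T → LaurentPoly₂ R) →ₗ[Rᵐᵒᵖ] (T → LaurentPoly₂ R) where
  toFun c t := AddMonoidAlgebra.single g 1 * c t
  map_add' c c' := by ext1 t; exact mul_add _ _ _
  map_smul' r c := by ext1 t; simp [mul_smul_comm]

lemma monomialLin_apply (g : ℤ × ℤ) (c : T → LaurentPoly₂ R) (t : T) :
    monomialLin g c t = AddMonoidAlgebra.single g 1 * c t := rfl

lemma monomialLin_comp (g h : ℤ × ℤ) : (monomialLin g : (T → LaurentPoly₂ R) →ₗ[Rᵐᵒᵖ] _) ∘ₗ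
    monomialLin h = monomialLin (g + h) := by
  refine LinearMap.ext fun c => funext fun t => ?_
  rw [LinearMap.comp_apply, monomialLin_apply, monomialLin_apply, monomialLin_apply, ← mul_assoc,
    AddMonoidAlgebra.single_mul_single, one_mul]

lemma monomialLin_zero :
    (monomialLin 0 : (T → LaurentPoly₂ R) →ₗ[Rᵐᵒᵖ] _) = LinearMap.id := by
  refine LinearMap.ext fun c => funext fun t => ?_
  rw [monomialLin_apply, ← AddMonoidAlgebra.one_def, one_mul]
  rfl

lemma single_one_comm (g : ℤ × ℤ) (l : LaurentPoly₂ R) :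
    AddMonoidAlgebra.single g 1 * l = l * AddMonoidAlgebra.single g 1 := by
  rw [laurent_sum_single l, Finset.mul_sum, Finset.sum_mul]
  refine Finset.sum_congr rfl fun h _ => ?_
  rw [AddMonoidAlgebra.single_mul_single, AddMonoidAlgebra.single_mul_single, one_mul, mul_one,
    add_comm]

lemma leftMulLin_monomialLin (D : Matrix T T (LaurentPoly₂ R)) (g : ℤ × ℤ) :
    leftMulLin D ∘ₗ monomialLin g = monomialLin g ∘ₗ leftMulLin D := by
  refine LinearMap.ext fun c => funext fun t => ?_
  rw [LinearMap.comp_apply, LinearMap.comp_apply, monomialLin_apply, leftMulLin_apply,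
    leftMulLin_apply, matAct_apply, matAct_apply, Finset.mul_sum]
  refine Finset.sum_congr rfl fun s _ => ?_
  simp only [leftReg_apply, RingHom.id_apply, monomialLin_apply]
  rw [← mul_assoc, ← single_one_comm, mul_assoc]

/-- Left multiplication by an element of `S` on the coefficients. -/
def coeffMul (x : S) : (T → FreeMod S) →+ (T → FreeMod S) where
  toFun v t := FreeMod.lift (fun g => (FreeMod.single g).comp (AddMonoidHom.mulLeft x)) (v t)
  map_zero' := by ext1 t; exact map_zero _
  map_add' v w := by ext1 t; exact map_add _ _ _

lemma coeffMul_single (x : S) (t : T) (g : ℤ × ℤ) (m : S) :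
    coeffMul x (Pi.single t (FreeMod.single g m)) = Pi.single t (FreeMod.single g (x * m)) := by
  ext1 t'
  change FreeMod.lift (fun g => (FreeMod.single g).comp (AddMonoidHom.mulLeft x)) _ = _
  by_cases h : t' = t
  · subst h
    rw [Pi.single_eq_same, Pi.single_eq_same, FreeMod.lift_single]
    rfl
  · rw [Pi.single_eq_of_ne h, Pi.single_eq_of_ne h, map_zero]

/-- This is the operator `1 ⊗ x`; commutation of `x` with `R` makes it independent of the basis. -/
lemma coeffMul_pureTensor (x : S)
    (hx : ∀ r, x * φ (AddMonoidAlgebra.single 0 r) = φ (AddMonoidAlgebra.single 0 r) * x)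
    (c : T → LaurentPoly₂ R) (m : S) :
    coeffMul x (pureTensor φ c m) = pureTensor φ c (x * m) := by
  obtain ⟨K, hK⟩ := exists_common_support c
  rw [sum_stdVec K c hK]
  simp only [map_sum, AddMonoidHom.finsetSum_apply]
  refine Finset.sum_congr rfl fun t _ => Finset.sum_congr rfl fun g _ => ?_
  rw [pureTensor_smul, pureTensor_smul, pureTensor_stdVec, pureTensor_stdVec]
  rw [coeffMul_single, ← mul_assoc, ← mul_assoc, hx]

end TensorOverBase

/-! ### The geometric series in `y⁻¹ ⊗ y` and exactness over rings with power series. -/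

section GeometricSeries

set_option linter.unusedSectionVars false

variable {R : Type u} [Ring R] {S : Type*} [Ring S] (φ : LaurentPoly₂ R →+* S)
variable {T : Type*} [Fintype T] [DecidableEq T]
variable (Ψ : PowerSeries R →+* S)

/-- The sum `∑ k, a k ⊗ y ^ k • m` in `L^T ⊗_R S`, for a sequence of vectors of Laurent polynomials
supported in a common finite set `K`. -/
def powerSum (K : Finset (ℤ × ℤ)) (a : ℕ → T → LaurentPoly₂ R) : S →+ (T → FreeMod S) :=
  ∑ t, ∑ g ∈ K, (pureTensor φ (stdVec t g)).comp
    (AddMonoidHom.mulLeft (Ψ (PowerSeries.mk fun k => (a k t).coeff g)))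

lemma powerSum_apply (K : Finset (ℤ × ℤ)) (a : ℕ → T → LaurentPoly₂ R) (m : S) :
    powerSum φ Ψ K a m = ∑ t, ∑ g ∈ K, pureTensor φ (stdVec t g)
      (Ψ (PowerSeries.mk fun k => (a k t).coeff g) * m) := by
  simp only [powerSum, AddMonoidHom.finsetSum_apply]
  rfl

lemma powerSum_add (K : Finset (ℤ × ℤ)) (a b : ℕ → T → LaurentPoly₂ R) :
    powerSum φ Ψ K (fun k => a k + b k) = powerSum φ Ψ K a + powerSum φ Ψ K b := by
  ext1 m
  rw [AddMonoidHom.add_apply, powerSum_apply, powerSum_apply, powerSum_apply,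
    ← Finset.sum_add_distrib]
  refine Finset.sum_congr rfl fun t _ => ?_
  rw [← Finset.sum_add_distrib]
  refine Finset.sum_congr rfl fun g _ => ?_
  rw [← map_add, ← add_mul, ← map_add]
  congr 3

lemma powerSum_subset {K K' : Finset (ℤ × ℤ)} (h : K ⊆ K') (a : ℕ → T → LaurentPoly₂ R)
    (ha : ∀ k t, ∀ g ∉ K, (a k t).coeff g = 0) (m : S) :
    powerSum φ Ψ K a m = powerSum φ Ψ K' a m := by
  rw [powerSum_apply, powerSum_apply]
  refine Finset.sum_congr rfl fun t _ => Finset.sum_subset h fun g _ hg => ?_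
  have : (PowerSeries.mk fun k => (a k t).coeff g) = 0 := by
    ext k
    rw [PowerSeries.coeff_mk, ha k t g hg, map_zero]
  rw [this, map_zero, zero_mul, map_zero]

variable (hC : ∀ r, Ψ (PowerSeries.C r) = φ (AddMonoidAlgebra.single 0 r))
include hC

/-- Infinite sums commute with `Q` because only finitely many basis vectors occur: `Q` acts through
a finite matrix over `R`, by which the power series of coefficients are multiplied. -/
lemma tensorMap_powerSum (Q : (T → LaurentPoly₂ R) →ₗ[Rᵐᵒᵖ] (T → LaurentPoly₂ R))
    (K : Finset (ℤ × ℤ)) (a : ℕ → T → LaurentPoly₂ R)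
    (ha : ∀ k t, ∀ g ∉ K, (a k t).coeff g = 0)
    (hQa : ∀ k t, ∀ g ∉ K, (Q (a k) t).coeff g = 0) (m : S) :
    tensorMap φ Q (powerSum φ Ψ K a m) = powerSum φ Ψ K (fun k => Q (a k)) m := by
  choose K₀ hK₀ using fun x : T × (ℤ × ℤ) => exists_common_support (Q (stdVec x.1 x.2))
  -- Although the `Q (a k)` are supported in `K`, the images of single basis vectors need not be.
  let K' : Finset (ℤ × ℤ) := K ∪ (Finset.univ ×ˢ K).biUnion K₀
  have hK' : ∀ t, ∀ g ∈ K, ∀ t', ∀ g' ∉ K', (Q (stdVec t g) t').coeff g' = 0 := by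
    intro t g hg t' g' hg'
    refine hK₀ (t, g) t' g' fun h => hg' ?_
    exact Finset.mem_union_right _ (Finset.mem_biUnion.2 ⟨(t, g), by simp [hg], h⟩)
  rw [powerSum_subset φ Ψ (Finset.subset_union_left : K ⊆ K') _ hQa, powerSum_apply,
    powerSum_apply]
  simp only [map_sum]
  have h1 : ∀ t, ∀ g ∈ K, tensorMap φ Q (pureTensor φ (stdVec t g)
        (Ψ (PowerSeries.mk fun k => (a k t).coeff g) * m))
      = ∑ t', ∑ g' ∈ K', pureTensor φ (stdVec t' g') (Ψ (PowerSeries.C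
        ((Q (stdVec t g) t').coeff g') * PowerSeries.mk fun k => (a k t).coeff g) * m) := by
    intro t g hg
    rw [tensorMap_pureTensor, sum_stdVec K' (Q (stdVec t g)) (hK' t g hg)]
    simp only [map_sum, AddMonoidHom.finsetSum_apply]
    refine Finset.sum_congr rfl fun t' _ => Finset.sum_congr rfl fun g' _ => ?_
    rw [pureTensor_smul, ← hC, ← mul_assoc, ← map_mul,
      ← sum_stdVec K' (Q (stdVec t g)) (hK' t g hg)]
  rw [Finset.sum_congr rfl fun t _ => Finset.sum_congr rfl fun g hg => h1 t g hg]
  have h2 : ∀ t' g', (PowerSeries.mk fun k => (Q (a k) t').coeff g') = ∑ t, ∑ g ∈ K,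
      PowerSeries.C ((Q (stdVec t g) t').coeff g') * PowerSeries.mk fun k => (a k t).coeff g := by
    intro t' g'
    ext k
    simp only [map_sum, PowerSeries.coeff_C_mul, PowerSeries.coeff_mk]
    conv_lhs => rw [sum_stdVec K (a k) (ha k)]
    simp only [map_sum, map_smul, Finset.sum_apply, AddMonoidAlgebra.coeff_sum,
      Finsupp.finsetSum_apply, Pi.smul_apply, AddMonoidAlgebra.coeff_smul_apply]
    rfl
  simp only [h2, map_sum, Finset.sum_mul]
  rw [Finset.sum_congr rfl fun t _ => Finset.sum_comm, Finset.sum_comm]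
  refine Finset.sum_congr rfl fun t' _ => ?_
  rw [Finset.sum_congr rfl fun t _ => Finset.sum_comm, Finset.sum_comm]

/-- The operator `∑ k, Q (y⁻ᵏ ·) ⊗ yᵏ` on `L^T ⊗_R S`, for an operator `Q` with values supported in
the finite set `K`. -/
def geomOp (K : Finset (ℤ × ℤ)) (Q : (T → LaurentPoly₂ R) →ₗ[Rᵐᵒᵖ] (T → LaurentPoly₂ R)) :
    (T → FreeMod S) →+ (T → FreeMod S) :=
  tensorLift (Y := T → FreeMod S)
    (AddMonoidHom.mk' (fun c => powerSum φ Ψ K fun k : ℕ => Q (monomialLin (0, -(k : ℤ)) c))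
      (fun c c' => by
        simp only [map_add]
        exact powerSum_add φ Ψ K _ _))

lemma powerSum_smul (K : Finset (ℤ × ℤ)) (a : ℕ → T → LaurentPoly₂ R) (r : R) (m : S) :
    powerSum φ Ψ K (fun k => MulOpposite.op r • a k) m
      = powerSum φ Ψ K a (φ (AddMonoidAlgebra.single 0 r) * m) := by
  rw [powerSum_apply, powerSum_apply]
  refine Finset.sum_congr rfl fun t _ => Finset.sum_congr rfl fun g _ => ?_
  rw [← hC, ← mul_assoc, ← map_mul]
  congr 3
  ext k
  rw [PowerSeries.coeff_mul_C, PowerSeries.coeff_mk, PowerSeries.coeff_mk, Pi.smul_apply,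
    AddMonoidAlgebra.coeff_smul_apply]
  rfl

lemma geomOp_pureTensor (K : Finset (ℤ × ℤ))
    (Q : (T → LaurentPoly₂ R) →ₗ[Rᵐᵒᵖ] (T → LaurentPoly₂ R)) (c : T → LaurentPoly₂ R) (m : S) :
    geomOp φ Ψ K Q (pureTensor φ c m)
      = powerSum φ Ψ K (fun k : ℕ => Q (monomialLin (0, -(k : ℤ)) c)) m := by
  refine tensorLift_pureTensor φ _ (fun r c m => ?_) c m
  change powerSum φ Ψ K (fun k : ℕ => Q (monomialLin (0, -(k : ℤ)) (MulOpposite.op r • c))) m = _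
  simp only [map_smul]
  exact powerSum_smul φ Ψ hC K _ r m

lemma geomOp_sub (K : Finset (ℤ × ℤ))
    (Q Q' : (T → LaurentPoly₂ R) →ₗ[Rᵐᵒᵖ] (T → LaurentPoly₂ R)) (v : T → FreeMod S) :
    geomOp φ Ψ K (Q - Q') v = geomOp φ Ψ K Q v - geomOp φ Ψ K Q' v :=
  tensor_hom_ext φ (geomOp φ Ψ K (Q - Q')) (geomOp φ Ψ K Q - geomOp φ Ψ K Q') (fun c m => by
    rw [AddMonoidHom.sub_apply, geomOp_pureTensor φ Ψ hC, geomOp_pureTensor φ Ψ hC,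
      geomOp_pureTensor φ Ψ hC, eq_sub_iff_add_eq, ← AddMonoidHom.add_apply, ← powerSum_add]
    simp only [LinearMap.sub_apply, sub_add_cancel]) v

lemma tensorMap_geomOp (K : Finset (ℤ × ℤ))
    (P Q : (T → LaurentPoly₂ R) →ₗ[Rᵐᵒᵖ] (T → LaurentPoly₂ R))
    (hQ : ∀ c t, ∀ g ∉ K, (Q c t).coeff g = 0) (hPQ : ∀ c t, ∀ g ∉ K, (P (Q c) t).coeff g = 0)
    (v : T → FreeMod S) : tensorMap φ P (geomOp φ Ψ K Q v) = geomOp φ Ψ K (P ∘ₗ Q) v :=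
  tensor_hom_ext φ ((tensorMap φ P).comp (geomOp φ Ψ K Q)) (geomOp φ Ψ K (P ∘ₗ Q))
    (fun c m => by
      rw [AddMonoidHom.comp_apply, geomOp_pureTensor φ Ψ hC, geomOp_pureTensor φ Ψ hC,
        tensorMap_powerSum φ Ψ hC P K (fun k : ℕ => Q (monomialLin (0, -(k : ℤ)) c))
          (fun k t g hg => hQ _ t g hg) (fun k t g hg => hPQ _ t g hg)]
      rfl) v

lemma geomOp_tensorMap (K : Finset (ℤ × ℤ))
    (P Q : (T → LaurentPoly₂ R) →ₗ[Rᵐᵒᵖ] (T → LaurentPoly₂ R))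
    (hP : ∀ g, P ∘ₗ monomialLin g = monomialLin g ∘ₗ P)
    (v : T → FreeMod S) : geomOp φ Ψ K Q (tensorMap φ P v) = geomOp φ Ψ K (Q ∘ₗ P) v :=
  tensor_hom_ext φ ((geomOp φ Ψ K Q).comp (tensorMap φ P)) (geomOp φ Ψ K (Q ∘ₗ P))
    (fun c m => by
      rw [AddMonoidHom.comp_apply, tensorMap_pureTensor, geomOp_pureTensor φ Ψ hC,
        geomOp_pureTensor φ Ψ hC]
      congr 2
      ext1 k
      rw [LinearMap.comp_apply]
      exact congrArg Q (LinearMap.congr_fun (hP _) c).symm) v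

variable (hX : Ψ PowerSeries.X = φ (AddMonoidAlgebra.single (0, 1) 1))
include hX

/-- Reindexing `∑ Q(y⁻ᵏ c) ⊗ yᵏ⁺¹ m` by `k + 1` gives the series for `Q ∘ y` without its term `k =
0`. -/
lemma geomOp_coeffMul (K : Finset (ℤ × ℤ))
    (Q : (T → LaurentPoly₂ R) →ₗ[Rᵐᵒᵖ] (T → LaurentPoly₂ R))
    (hQ : ∀ c t, ∀ g ∉ K, (Q c t).coeff g = 0) (v : T → FreeMod S) :
    geomOp φ Ψ K Q (coeffMul (φ (AddMonoidAlgebra.single (0, 1) 1)) v)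
      = geomOp φ Ψ K (Q ∘ₗ monomialLin (0, 1)) v - tensorMap φ (Q ∘ₗ monomialLin (0, 1)) v :=
  tensor_hom_ext φ ((geomOp φ Ψ K Q).comp (coeffMul (φ (AddMonoidAlgebra.single (0, 1) 1))))
    (geomOp φ Ψ K (Q ∘ₗ monomialLin (0, 1)) - tensorMap φ (Q ∘ₗ monomialLin (0, 1)))
    (fun c m => by
      rw [AddMonoidHom.comp_apply, AddMonoidHom.sub_apply, coeffMul_pureTensor φ _ (fun r => by
          rw [← map_mul, ← map_mul, single_one_comm]), geomOp_pureTensor φ Ψ hC,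
        geomOp_pureTensor φ Ψ hC, tensorMap_pureTensor, eq_sub_iff_add_eq, powerSum_apply,
        powerSum_apply]
      have h1 := sum_stdVec K ((Q ∘ₗ monomialLin (0, 1)) c) (hQ _)
      have h2 : pureTensor φ ((Q ∘ₗ monomialLin (0, 1)) c) m = ∑ t, ∑ g ∈ K,
          pureTensor φ (stdVec t g) (φ (AddMonoidAlgebra.single 0
            (((Q ∘ₗ monomialLin (0, 1)) c t).coeff g)) * m) := by
        conv_lhs => rw [h1]
        simp only [map_sum, AddMonoidHom.finsetSum_apply, pureTensor_smul]
      rw [h2, ← Finset.sum_add_distrib]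
      refine Finset.sum_congr rfl fun t _ => ?_
      rw [← Finset.sum_add_distrib]
      refine Finset.sum_congr rfl fun g _ => ?_
      rw [← map_add, ← hX, ← mul_assoc, ← map_mul, ← hC, ← add_mul, ← map_add]
      congr 3
      ext k
      rw [map_add, PowerSeries.coeff_mk]
      cases k with
      | zero =>
        have h0 : monomialLin ((0 : ℤ), (0 : ℤ)) c = c := LinearMap.congr_fun monomialLin_zero c
        simp [h0]
      | succ k =>
        rw [PowerSeries.coeff_succ_mul_X, PowerSeries.coeff_mk, PowerSeries.coeff_succ_C,
          add_zero]
        rw [LinearMap.comp_apply, ← LinearMap.comp_apply (monomialLin (0, 1)), monomialLin_comp]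
        congr 5
        simp) v

lemma coeffMul_geomOp (K : Finset (ℤ × ℤ))
    (Q : (T → LaurentPoly₂ R) →ₗ[Rᵐᵒᵖ] (T → LaurentPoly₂ R)) (v : T → FreeMod S) :
    coeffMul (φ (AddMonoidAlgebra.single (0, 1) 1)) (geomOp φ Ψ K Q v)
      = geomOp φ Ψ K Q (coeffMul (φ (AddMonoidAlgebra.single (0, 1) 1)) v) :=
  tensor_hom_ext φ ((coeffMul (φ (AddMonoidAlgebra.single (0, 1) 1))).comp (geomOp φ Ψ K Q))
    ((geomOp φ Ψ K Q).comp (coeffMul (φ (AddMonoidAlgebra.single (0, 1) 1))))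
    (fun c m => by
      have hcomm : ∀ r, φ (AddMonoidAlgebra.single (0, 1) 1) * φ (AddMonoidAlgebra.single 0 r)
          = φ (AddMonoidAlgebra.single 0 r) * φ (AddMonoidAlgebra.single (0, 1) 1) := fun r => by
        rw [← map_mul, ← map_mul, single_one_comm]
      rw [AddMonoidHom.comp_apply, AddMonoidHom.comp_apply, coeffMul_pureTensor φ _ hcomm,
        geomOp_pureTensor φ Ψ hC, geomOp_pureTensor φ Ψ hC, powerSum_apply, powerSum_apply]
      simp only [map_sum]
      refine Finset.sum_congr rfl fun t _ => Finset.sum_congr rfl fun g _ => ?_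
      rw [coeffMul_pureTensor φ _ hcomm, ← hX, ← mul_assoc, ← mul_assoc, ← map_mul, ← map_mul,
        (PowerSeries.commute_X _).eq]) v

omit hC hX

/-- The difference between the two actions of `y` on `L ⊗_R S`. -/
def freeDiff : FreeMod S →+ FreeMod S := indDiff splitY (indAct splitX (leftReg φ))

lemma freeDiff_eq (v : T → FreeMod S) : (fun t => freeDiff φ (v t))
    = tensorMap φ (monomialLin (0, 1)) v
      - coeffMul (φ (AddMonoidAlgebra.single (0, 1) 1)) v := by
  let F : (T → FreeMod S) →+ (T → FreeMod S) :=
    { toFun := fun v t => freeDiff φ (v t)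
      map_zero' := by ext1 t; exact map_zero _
      map_add' := fun v w => by ext1 t; exact map_add _ _ _ }
  refine tensor_hom_ext φ F (tensorMap φ (monomialLin (0, 1)) -
    coeffMul (φ (AddMonoidAlgebra.single (0, 1) 1))) (fun c m => ?_) v
  have hcomm : ∀ r, φ (AddMonoidAlgebra.single (0, 1) 1) * φ (AddMonoidAlgebra.single 0 r)
      = φ (AddMonoidAlgebra.single 0 r) * φ (AddMonoidAlgebra.single (0, 1) 1) := fun r => by
    rw [← map_mul, ← map_mul, single_one_comm]
  rw [AddMonoidHom.sub_apply, tensorMap_pureTensor, coeffMul_pureTensor φ _ hcomm]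
  ext1 t
  rw [Pi.sub_apply, pureTensor_apply, pureTensor_apply, monomialLin_apply, single_one_comm,
    freeAct_mul, freeAct_single, ← AddMonoidAlgebra.one_def, map_one, one_mul, ← map_sub, zero_add]
  have h1 : freeDiff φ (FreeMod.single 0 m)
      = FreeMod.single (0, 1) m - FreeMod.single 0 (φ (AddMonoidAlgebra.single (0, 1) 1) * m) := by
    refine (indDiff_single splitY (indAct splitX (leftReg φ)) 0 (Finsupp.single 0 m)).trans ?_
    rw [indAct_single_single]
    rfl
  rw [← h1]
  exact indDiff_act splitY (indAct splitX (leftReg φ)) (c t) (FreeMod.single 0 m)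

/-- A homotopy finite differential module becomes exact over every ring `S` in which power series
in `y` make sense. -/
theorem HomotopyFinite.exact_of_powerSeries {D : Matrix T T (LaurentPoly₂ R)} (hD : D * D = 0)
    (hfin : HomotopyFinite D) (hC : ∀ r, Ψ (PowerSeries.C r) = φ (AddMonoidAlgebra.single 0 r))
    (hX : Ψ PowerSeries.X = φ (AddMonoidAlgebra.single (0, 1) 1)) : DExact (leftReg φ) D := by
  obtain ⟨H, K, hK⟩ := hfin
  obtain ⟨d, hd⟩ : ∃ d, d = leftMulLin D := ⟨_, rfl⟩
  obtain ⟨z, hz⟩ : ∃ z : (T → LaurentPoly₂ R) →ₗ[Rᵐᵒᵖ] (T → LaurentPoly₂ R),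
    z = monomialLin (0, 1) := ⟨_, rfl⟩
  obtain ⟨z', hz'⟩ : ∃ z : (T → LaurentPoly₂ R) →ₗ[Rᵐᵒᵖ] (T → LaurentPoly₂ R),
    z = monomialLin (0, -1) := ⟨_, rfl⟩
  -- `θ` is a chain map homotopic to the identity with values over `K`. Below, `z` stands for `y ⊗
  -- 1`, `ζ` for `1 ⊗ y`, and `geomOp` of `θ` for the series.
  obtain ⟨θ, hθ⟩ : ∃ θ : (T → LaurentPoly₂ R) →ₗ[Rᵐᵒᵖ] (T → LaurentPoly₂ R),
    θ = LinearMap.id - d ∘ₗ H - H ∘ₗ d := ⟨_, rfl⟩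
  have hθK : ∀ c t, ∀ g ∉ K, (θ c t).coeff g = 0 := by
    rw [hθ, hd]
    exact hK
  have hdd : ∀ c, d (d c) = 0 := by
    rw [hd]
    exact leftMulLin_comp_self hD
  have hθa : ∀ c, θ c = c - d (H c) - H (d c) := fun c => by rw [hθ]; rfl
  have hdz : ∀ g, d ∘ₗ monomialLin g = monomialLin g ∘ₗ d := fun g => by
    rw [hd]
    exact leftMulLin_monomialLin D g
  have hzz : ∀ g, z ∘ₗ monomialLin g = monomialLin g ∘ₗ z := fun g => by
    rw [hz, monomialLin_comp, monomialLin_comp, add_comm]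
  have hzz' : ∀ v : T → FreeMod S, tensorMap φ z (tensorMap φ z' v) = v := fun v => by
    rw [← tensorMap_comp, hz, hz', monomialLin_comp]
    exact (congrArg (fun P => tensorMap φ P v) monomialLin_zero).trans (tensorMap_id φ v)
  have hz'z : ∀ v : T → FreeMod S, tensorMap φ z' (tensorMap φ z v) = v := fun v => by
    rw [← tensorMap_comp, hz, hz', monomialLin_comp]
    exact (congrArg (fun P => tensorMap φ P v) monomialLin_zero).trans (tensorMap_id φ v)
  have hdθ : d ∘ₗ θ = θ ∘ₗ d := LinearMap.ext fun c => by
    simp only [LinearMap.comp_apply, hθa, map_sub, hdd]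
    rw [map_zero]
    abel
  have hdzc : ∀ v : T → FreeMod S, tensorMap φ d (tensorMap φ z v)
      = tensorMap φ z (tensorMap φ d v) := fun v => by
    rw [← tensorMap_comp, hz, hdz, tensorMap_comp]
  have hdz'c : ∀ v : T → FreeMod S, tensorMap φ d (tensorMap φ z' v)
      = tensorMap φ z' (tensorMap φ d v) := fun v => by
    rw [← tensorMap_comp, hz', hdz, tensorMap_comp]
  have hddc : ∀ v : T → FreeMod S, tensorMap φ d (tensorMap φ d v) = 0 := fun v => by
    rw [hd, tensorMap_leftMulLin, tensorMap_leftMulLin, matAct_matAct_self _ hD]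
  have hθc : ∀ v : T → FreeMod S, tensorMap φ d v = 0 →
      tensorMap φ θ v = v - tensorMap φ d (tensorMap φ H v) := fun v hv => by
    rw [hθ, tensorMap_sub, tensorMap_sub, tensorMap_id, tensorMap_comp, tensorMap_comp, hv,
      map_zero, sub_zero]
  obtain ⟨ζ, hζ⟩ : ∃ ζ : (T → FreeMod S) →+ (T → FreeMod S),
    ζ = coeffMul (φ (AddMonoidAlgebra.single (0, 1) 1)) := ⟨_, rfl⟩
  have hU : ∀ v : T → FreeMod S, (fun t => freeDiff φ (v t)) = tensorMap φ z v - ζ v := by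
    rw [hz, hζ]
    exact freeDiff_eq φ
  have hθAd : ∀ v : T → FreeMod S, geomOp φ Ψ K θ (tensorMap φ d v)
      = tensorMap φ d (geomOp φ Ψ K θ v) := fun v => by
    rw [geomOp_tensorMap φ Ψ hC K d θ hdz, tensorMap_geomOp φ Ψ hC K d θ hθK, hdθ]
    intro c t g hg
    have := hθK (d c) t g hg
    rwa [← LinearMap.comp_apply, ← hdθ] at this
  have hAU : ∀ (Q : (T → LaurentPoly₂ R) →ₗ[Rᵐᵒᵖ] (T → LaurentPoly₂ R)),
      (∀ c t, ∀ g ∉ K, (Q c t).coeff g = 0) → ∀ v : T → FreeMod S, geomOp φ Ψ K Q (ζ v)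
      = geomOp φ Ψ K (Q ∘ₗ z) v - tensorMap φ (Q ∘ₗ z) v := fun Q hQ v => by
    rw [hζ, geomOp_coeffMul φ Ψ hC hX K Q hQ, hz]
  refine DExact.of_indAct splitX (leftReg φ) hD
    (DExact.of_indDiff splitY (indAct splitX (leftReg φ)) hD ?_ ?_)
  · change ∀ y w : T → FreeMod S, matAct (freeAct φ) D y = 0 →
      (fun t => freeDiff φ (y t)) = matAct (freeAct φ) D w →
        ∃ w' : T → FreeMod S, matAct (freeAct φ) D w' = y
    simp only [← tensorMap_leftMulLin, ← hd, hU]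
    intro y w hy hyw
    -- The series applied to `zy - ζy` telescopes to `θ(zy)`, which is homologous to `zy`. So `zy`
    -- is a boundary, and so is `y`.
    have h1 := congrArg (geomOp φ Ψ K θ) hyw
    rw [map_sub, geomOp_tensorMap φ Ψ hC K z θ hzz, hAU θ hθK, sub_sub_cancel, hθAd,
      tensorMap_comp, hθc _ (by rw [hdzc, hy, map_zero])] at h1
    refine ⟨tensorMap φ z' (geomOp φ Ψ K θ w + tensorMap φ H (tensorMap φ z y)), ?_⟩
    rw [hdz'c, map_add, ← h1, sub_add_cancel, hz'z]
  · change ∀ y : T → FreeMod S, matAct (freeAct φ) D y = 0 → ∃ w l : T → FreeMod S,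
      matAct (freeAct φ) D w = 0 ∧ y = (fun t => freeDiff φ (w t)) + matAct (freeAct φ) D l
    simp only [← tensorMap_leftMulLin, ← hd, hU]
    intro y₀ hy₀
    obtain ⟨y, hy⟩ : ∃ y, y = tensorMap φ z' y₀ := ⟨_, rfl⟩
    have hdy : tensorMap φ d y = 0 := by rw [hy, hdz'c, hy₀, map_zero]
    have hzy : tensorMap φ z y = y₀ := by rw [hy, hzz']
    obtain ⟨w, hw⟩ : ∃ w, w = geomOp φ Ψ K θ y := ⟨_, rfl⟩
    have hdw : tensorMap φ d w = 0 := by rw [hw, ← hθAd, hdy, map_zero]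
    -- `θ` need not commute with `z`; as `θ` is homotopic to the identity through `H`, the
    -- commutator is `θz - zθ = dG + Gd`.
    obtain ⟨G, hG⟩ : ∃ G : (T → LaurentPoly₂ R) →ₗ[Rᵐᵒᵖ] (T → LaurentPoly₂ R),
      G = z ∘ₗ H - H ∘ₗ z := ⟨_, rfl⟩
    have hdζ : ∀ (P : (T → LaurentPoly₂ R) →ₗ[Rᵐᵒᵖ] (T → LaurentPoly₂ R)) (v : T → FreeMod S),
        tensorMap φ P (ζ v) = ζ (tensorMap φ P v) := fun P v => by
      rw [hζ]
      have hcomm : ∀ r, φ (AddMonoidAlgebra.single (0, 1) 1) * φ (AddMonoidAlgebra.single 0 r)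
          = φ (AddMonoidAlgebra.single 0 r) * φ (AddMonoidAlgebra.single (0, 1) 1) := fun r => by
        rw [← map_mul, ← map_mul, single_one_comm]
      refine tensor_hom_ext φ
        ((tensorMap φ P).comp (coeffMul (φ (AddMonoidAlgebra.single (0, 1) 1))))
        ((coeffMul (φ (AddMonoidAlgebra.single (0, 1) 1))).comp (tensorMap φ P))
        (fun c m => ?_) v
      rw [AddMonoidHom.comp_apply, AddMonoidHom.comp_apply, coeffMul_pureTensor φ _ hcomm,
        tensorMap_pureTensor, tensorMap_pureTensor, coeffMul_pureTensor φ _ hcomm]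
    -- Telescoping modulo boundaries. The extra `θ` on the left keeps all series supported in `K`;
    -- it is removed at the end since `θ` is the identity on homology.
    have hUw : tensorMap φ θ (tensorMap φ z w - ζ w)
        = tensorMap φ θ (tensorMap φ θ y₀) - tensorMap φ d (geomOp φ Ψ K (θ ∘ₗ G) y) := by
      have e1 : tensorMap φ θ (tensorMap φ z w) = geomOp φ Ψ K ((θ ∘ₗ z) ∘ₗ θ) y := by
        rw [hw, ← tensorMap_comp, tensorMap_geomOp φ Ψ hC K (θ ∘ₗ z) θ hθK
          (fun c => hθK _)]
      have e2 : tensorMap φ θ (ζ w) = geomOp φ Ψ K ((θ ∘ₗ θ) ∘ₗ z) y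
          - tensorMap φ ((θ ∘ₗ θ) ∘ₗ z) y := by
        rw [hdζ, hw, tensorMap_geomOp φ Ψ hC K θ θ hθK (fun c => hθK _), hζ,
          coeffMul_geomOp φ Ψ hC hX, ← hζ, hAU (θ ∘ₗ θ) (fun c => hθK _)]
      have hdz1 : ∀ c, d (z c) = z (d c) := fun c => by
        rw [hz]
        exact LinearMap.congr_fun (hdz (0, 1)) c
      have hdθ1 : ∀ c, d (θ c) = θ (d c) := fun c => LinearMap.congr_fun hdθ c
      have e3 : (θ ∘ₗ z) ∘ₗ θ = (θ ∘ₗ θ) ∘ₗ z - d ∘ₗ (θ ∘ₗ G) - (θ ∘ₗ G) ∘ₗ d := by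
        refine LinearMap.ext fun c => ?_
        have h1 : z (θ c) = θ (z c) - d (G c) - G (d c) := by
          rw [hθa, hθa, hG]
          simp only [LinearMap.sub_apply, LinearMap.comp_apply, map_sub, hdz1]
          abel
        simp only [LinearMap.sub_apply, LinearMap.comp_apply, h1, map_sub, hdθ1]
      have e4 : geomOp φ Ψ K (d ∘ₗ (θ ∘ₗ G)) y = tensorMap φ d (geomOp φ Ψ K (θ ∘ₗ G) y) := by
        rw [tensorMap_geomOp φ Ψ hC K d (θ ∘ₗ G) (fun c => hθK _)]
        intro c
        rw [LinearMap.comp_apply, hdθ1]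
        exact hθK _
      have e5 : geomOp φ Ψ K ((θ ∘ₗ G) ∘ₗ d) y = 0 := by
        rw [← geomOp_tensorMap φ Ψ hC K d (θ ∘ₗ G) hdz, hdy, map_zero]
      rw [map_sub, e1, e2, e3, geomOp_sub φ Ψ hC, geomOp_sub φ Ψ hC, e4, e5, tensorMap_comp,
        tensorMap_comp, hzy]
      abel
    have h1 : tensorMap φ d (tensorMap φ z w - ζ w) = 0 := by
      rw [map_sub, hdzc, hdζ, hdw, map_zero, hζ, map_zero, sub_zero]
    rw [hθc _ h1, hθc _ hy₀, map_sub (tensorMap φ θ), hθc _ hy₀, ← tensorMap_comp φ θ d, ← hdθ,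
      tensorMap_comp] at hUw
    refine ⟨w, tensorMap φ H y₀ + tensorMap φ θ (tensorMap φ H y₀)
      + geomOp φ Ψ K (θ ∘ₗ G) y - tensorMap φ H (tensorMap φ z w - ζ w), hdw, ?_⟩
    rw [map_sub (tensorMap φ d), map_add, map_add]
    generalize tensorMap φ z w - ζ w = x at hUw ⊢
    generalize tensorMap φ d (tensorMap φ H x) = q at hUw ⊢
    rw [eq_add_of_sub_eq hUw]
    abel

end GeometricSeries

/-! ### Change of variables and the eight rings. -/

section AllNovikovRings

set_option linter.unusedSectionVars false

variable {R : Type u} [Ring R] {T : Type*} [Fintype T] [DecidableEq T]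

/-- The automorphism of the Laurent polynomial ring given by an automorphism of the lattice of
exponents. -/
def monomialAut (e : ℤ × ℤ ≃+ ℤ × ℤ) : LaurentPoly₂ R ≃+* LaurentPoly₂ R :=
  AddMonoidAlgebra.mapDomainRingEquiv R e

lemma monomialAut_single (e : ℤ × ℤ ≃+ ℤ × ℤ) (g : ℤ × ℤ) (r : R) :
    monomialAut e (AddMonoidAlgebra.single g r) = AddMonoidAlgebra.single (e g) r := by
  simp [monomialAut]

lemma monomialAut_symm_single (e : ℤ × ℤ ≃+ ℤ × ℤ) (g : ℤ × ℤ) (r : R) :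
    (monomialAut e).symm (AddMonoidAlgebra.single g r) = AddMonoidAlgebra.single (e.symm g) r := by
  rw [RingEquiv.symm_apply_eq, monomialAut_single, AddEquiv.apply_symm_apply]

lemma coeff_monomialAut (e : ℤ × ℤ ≃+ ℤ × ℤ) (l : LaurentPoly₂ R) (g : ℤ × ℤ) :
    (monomialAut e l).coeff g = l.coeff (e.symm g) := by
  conv_lhs => rw [laurent_sum_single l]
  conv_rhs => rw [laurent_sum_single l]
  simp only [map_sum, monomialAut_single, AddMonoidAlgebra.coeff_sum, Finsupp.finsetSum_apply,
    AddMonoidAlgebra.coeff_single, Finsupp.single_apply]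
  refine Finset.sum_congr rfl fun h _ => ?_
  simp only [← AddEquiv.eq_symm_apply]

/-- The automorphism of vectors of Laurent polynomials given by an automorphism of the lattice of
exponents. -/
def monomialAutLin (e : ℤ × ℤ ≃+ ℤ × ℤ) :
    (T → LaurentPoly₂ R) ≃ₗ[Rᵐᵒᵖ] (T → LaurentPoly₂ R) where
  toFun c t := monomialAut e (c t)
  invFun c t := (monomialAut e).symm (c t)
  left_inv c := by ext1 t; simp
  right_inv c := by ext1 t; simp
  map_add' c c' := by ext1 t; simp
  map_smul' r c := by
    ext1 t
    rw [Pi.smul_apply, op_smul_eq_mul_single, map_mul, monomialAut_single, map_zero, RingHom.id_apply,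
      Pi.smul_apply, op_smul_eq_mul_single]

lemma monomialAutLin_apply (e : ℤ × ℤ ≃+ ℤ × ℤ) (c : T → LaurentPoly₂ R) (t : T) :
    monomialAutLin e c t = monomialAut e (c t) := rfl

lemma leftMulLin_map_monomialAut (e : ℤ × ℤ ≃+ ℤ × ℤ) (D : Matrix T T (LaurentPoly₂ R))
    (c : T → LaurentPoly₂ R) :
    leftMulLin (D.map (monomialAut e)) (monomialAutLin e c) = monomialAutLin e (leftMulLin D c) := by
  ext1 t
  simp only [leftMulLin_apply, matAct_apply, monomialAutLin_apply, leftReg_apply, map_sum, map_mul,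
    Matrix.map_apply, RingHom.id_apply]

lemma HomotopyFinite.map_monomialAut {D : Matrix T T (LaurentPoly₂ R)} (h : HomotopyFinite D)
    (e : ℤ × ℤ ≃+ ℤ × ℤ) : HomotopyFinite (D.map (monomialAut e)) := by
  obtain ⟨H, K, hK⟩ := h
  refine ⟨(monomialAutLin e).toLinearMap ∘ₗ H ∘ₗ (monomialAutLin e).symm.toLinearMap,
    K.image e, fun c t g hg => ?_⟩
  obtain ⟨c, rfl⟩ := (monomialAutLin e).surjective c
  have h1 : monomialAutLin e c - leftMulLin (D.map (monomialAut e))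
        (((monomialAutLin e).toLinearMap ∘ₗ H ∘ₗ (monomialAutLin e).symm.toLinearMap)
          (monomialAutLin e c))
      - ((monomialAutLin e).toLinearMap ∘ₗ H ∘ₗ (monomialAutLin e).symm.toLinearMap)
        (leftMulLin (D.map (monomialAut e)) (monomialAutLin e c))
      = monomialAutLin e (c - leftMulLin D (H c) - H (leftMulLin D c)) := by
    simp only [LinearMap.comp_apply, LinearEquiv.coe_coe, leftMulLin_map_monomialAut,
      LinearEquiv.symm_apply_apply, map_sub]
  rw [h1, monomialAutLin_apply, coeff_monomialAut]
  refine hK c t _ fun h => hg (Finset.mem_image.2 ⟨_, h, e.apply_symm_apply g⟩)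

/-- A homotopy finite differential module becomes exact over every ring `S` in which power series
in some primitive monomial make sense. -/
lemma HomotopyFinite.exact_of_powerSeries_monomial {S : Type*} [Ring S] (φ : LaurentPoly₂ R →+* S)
    (Ψ : PowerSeries R →+* S) {D : Matrix T T (LaurentPoly₂ R)} (hD : D * D = 0)
    (hfin : HomotopyFinite D) (e : ℤ × ℤ ≃+ ℤ × ℤ)
    (hC : ∀ r, Ψ (PowerSeries.C r) = φ (AddMonoidAlgebra.single 0 r))
    (hX : Ψ PowerSeries.X = φ (AddMonoidAlgebra.single (e.symm (0, 1)) 1)) :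
    DExact (leftReg φ) D := by
  -- The change of variables sends the chosen monomial to `y`; precomposing `φ` with its inverse
  -- compensates.
  have h := (hfin.map_monomialAut e).exact_of_powerSeries
    (φ.comp (monomialAut e).symm.toRingHom) Ψ
    (by
      have h2 := congrArg (fun M : Matrix T T (LaurentPoly₂ R) => M.map (monomialAut e)) hD
      simpa [Matrix.map_mul] using h2)
    (fun r => by
      change _ = φ ((monomialAut e).symm _)
      rw [hC, monomialAut_symm_single, map_zero])
    (by
      change _ = φ ((monomialAut e).symm _)
      rw [hX, monomialAut_symm_single])
  have h1 : (D.map (monomialAut e)).map (monomialAut e).symm.toRingHom = D := by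
    refine Matrix.ext fun s t => ?_
    exact (monomialAut e).symm_apply_apply (D s t)
  have h2 : matAct (leftReg (φ.comp (monomialAut e).symm.toRingHom)) (D.map (monomialAut e))
      = matAct (leftReg φ) D := by
    refine (matAct_comp (leftReg φ) (monomialAut e).symm.toRingHom _).trans ?_
    rw [h1]
  rw [DExact, h2] at h
  exact h

lemma units_mul_self (ε : ℤˣ) : (ε : ℤ) * ε = 1 := by
  have := units_mul_mul ε 1
  rwa [mul_one] at this

/-- The automorphism `(p, q) ↦ (p, ε q)` of `ℤ × ℤ`. -/
def signSnd (ε : ℤˣ) : ℤ × ℤ ≃+ ℤ × ℤ where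
  toFun g := (g.1, ε * g.2)
  invFun g := (g.1, ε * g.2)
  left_inv g := by simp [units_mul_mul]
  right_inv g := by simp [units_mul_mul]
  map_add' g h := by simp [mul_add]

variable {D : Matrix T T (LaurentPoly₂ R)} (hD : D * D = 0) (h : HomotopyFinite D)
include hD h

lemma HomotopyFinite.exact_edgeHomY (δ : ℤˣ) : DExact (leftReg (edgeHomY R δ)) D := by
  refine h.exact_of_powerSeries_monomial (edgeHomY R δ)
    ((HahnSeries.ofPowerSeries ℤ _).comp (PowerSeries.map LaurentPolynomial.C)) hD (signSnd δ)
    (fun r => ?_) ?_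
  · rw [RingHom.comp_apply, PowerSeries.map_C, HahnSeries.ofPowerSeries_C, edgeHomY_single]
    simp [HahnSeries.C_apply]
  · rw [RingHom.comp_apply, PowerSeries.map_X, HahnSeries.ofPowerSeries_X]
    have h1 : (signSnd δ).symm (0, 1) = (0, (δ : ℤ)) := by simp [signSnd]
    rw [h1, edgeHomY_single, units_mul_self]
    rfl

lemma HomotopyFinite.exact_edgeHomX (ε : ℤˣ) : DExact (leftReg (edgeHomX R ε)) D := by
  refine h.exact_of_powerSeries_monomial (edgeHomX R ε)
    ((HahnSeries.ofPowerSeries ℤ _).comp (PowerSeries.map LaurentPolynomial.C)) hD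
    (AddEquiv.prodComm.trans (signSnd ε)) (fun r => ?_) ?_
  · rw [RingHom.comp_apply, PowerSeries.map_C, HahnSeries.ofPowerSeries_C, edgeHomX_single]
    simp [HahnSeries.C_apply]
  · rw [RingHom.comp_apply, PowerSeries.map_X, HahnSeries.ofPowerSeries_X]
    have h1 : (AddEquiv.prodComm.trans (signSnd ε)).symm (0, 1) = ((ε : ℤ), 0) := by simp [signSnd]
    rw [h1, edgeHomX_single, units_mul_self]
    rfl

/-- Power series in the single variable `y^δ` suffice, embedded along the exponents `(0, k)`. -/
lemma HomotopyFinite.exact_vertexHom (ε δ : ℤˣ) : DExact (leftReg (vertexHom R ε δ)) D := by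
  refine h.exact_of_powerSeries_monomial (vertexHom R ε δ)
    ((HahnSeries.embDomainRingHom (AddMonoidHom.inr ℤ ℤ) (fun _ _ h => by simpa using h)
      (fun _ _ => by simp [Prod.le_def])).comp (HahnSeries.ofPowerSeries ℤ R)) hD
    (signSnd δ) (fun r => ?_) ?_
  · rw [RingHom.comp_apply, HahnSeries.ofPowerSeries_C, vertexHom_single]
    refine HahnSeries.embDomainRingHom_C.trans ?_
    simp only [HahnSeries.C_apply, Prod.fst_zero, Prod.snd_zero, mul_zero]
    rfl
  · have h1 : (signSnd δ).symm (0, 1) = (0, (δ : ℤ)) := by simp [signSnd]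
    rw [RingHom.comp_apply, HahnSeries.ofPowerSeries_X, h1, vertexHom_single, units_mul_self,
      mul_zero]
    exact HahnSeries.embDomain_single

end AllNovikovRings

/-! ### Matrix presentation of a bounded complex of finitely generated free modules. -/

section Presentation

variable {A : Type u} [Ring A]

/-- A description of a cochain complex of right `A`-modules by a matrix `D`, acting on column
vectors indexed by a finite set `T` of graded basis elements. -/
structure MatrixPresentation (C : CochainComplex (ModuleCat.{u} Aᵐᵒᵖ) ℤ) (T : Type)
    [Fintype T] [DecidableEq T] where
  /-- the degrees of the basis elements -/
  deg : T → ℤ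
  /-- the matrix of the differential -/
  D : Matrix T T A
  /-- the inclusion of the degree `n` part -/
  incl : ∀ n, C.X n →ₗ[Aᵐᵒᵖ] (T → A)
  /-- the projection to the degree `n` part -/
  proj : ∀ n, (T → A) →ₗ[Aᵐᵒᵖ] C.X n
  proj_incl : ∀ n c, proj n (incl n c) = c
  incl_proj : ∀ n v t, incl n (proj n v) t = if deg t = n then v t else 0
  incl_d : ∀ n c, incl (n + 1) (C.d n (n + 1) c) = matAct (leftReg (RingHom.id A)) D (incl n c)

lemma pi_sum_single_smul {T : Type} [Fintype T] [DecidableEq T] (v : T → A) :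
    v = ∑ t, MulOpposite.op (v t) • (Pi.single t (1 : A) : T → A) := by
  ext s
  rw [Finset.sum_apply, Finset.sum_eq_single s]
  · simp
  · intro t _ h
    simp [Pi.single_eq_of_ne h.symm]
  · simp

/-- The identity of the component of degree `n` for `m = n`, and zero otherwise. -/
def componentMap (C : CochainComplex (ModuleCat.{u} Aᵐᵒᵖ) ℤ) (n m : ℤ) :
    C.X n →ₗ[Aᵐᵒᵖ] C.X m :=
  if h : n = m then by subst h; exact LinearMap.id else 0

lemma componentMap_self (C : CochainComplex (ModuleCat.{u} Aᵐᵒᵖ) ℤ) (n : ℤ) (c : C.X n) :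
    componentMap C n n c = c := by
  simp [componentMap]

lemma componentMap_of_ne (C : CochainComplex (ModuleCat.{u} Aᵐᵒᵖ) ℤ) {n m : ℤ} (h : n ≠ m)
    (c : C.X n) : componentMap C n m c = 0 := by
  simp [componentMap, h]

/-- A bounded complex of finitely generated free modules has a matrix presentation. -/
lemma exists_matrixPresentation (C : CochainComplex (ModuleCat.{u} Aᵐᵒᵖ) ℤ)
    (hbdd : IsBoundedComplex C)
    (hfree : ∀ n, Module.Finite Aᵐᵒᵖ (C.X n) ∧ Module.Free Aᵐᵒᵖ (C.X n)) :
    ∃ (T : Type) (_ : Fintype T) (_ : DecidableEq T), Nonempty (MatrixPresentation C T) := by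
  obtain ⟨a, b, hGE, hLE⟩ := hbdd
  have hE : ∀ n, ∃ k : ℕ, Nonempty (C.X n ≃ₗ[Aᵐᵒᵖ] (Fin k → A)) := by
    intro n
    obtain ⟨h1, h2⟩ := hfree n
    let β := Module.Free.chooseBasis Aᵐᵒᵖ (C.X n)
    have : Fintype (Module.Free.ChooseBasisIndex Aᵐᵒᵖ (C.X n)) := inferInstance
    let e := Fintype.equivFin (Module.Free.ChooseBasisIndex Aᵐᵒᵖ (C.X n))
    let op : Aᵐᵒᵖ ≃ₗ[Aᵐᵒᵖ] A :=
      { MulOpposite.opAddEquiv.symm with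
        map_smul' := fun r x => by simp }
    exact ⟨_, ⟨(β.reindex e).equivFun.trans (LinearEquiv.piCongrRight fun _ => op)⟩⟩
  choose k hk using hE
  let E := fun n => (hk n).some
  have hzero : ∀ n, n ∉ Finset.Icc a b → ∀ c : C.X n, c = 0 := by
    intro n hn c
    have : Limits.IsZero (C.X n) := by
      rw [Finset.mem_Icc, not_and_or, not_le, not_le] at hn
      rcases hn with hn | hn
      · exact C.isZero_of_isStrictlyGE a n hn
      · exact C.isZero_of_isStrictlyLE b n hn
    have := ModuleCat.subsingleton_of_isZero this
    exact Subsingleton.elim _ _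
  let T : Type := Σ n : Finset.Icc a b, Fin (k n)
  let deg : T → ℤ := fun t => t.1
  let incl : ∀ n, C.X n →ₗ[Aᵐᵒᵖ] (T → A) := fun n => LinearMap.pi fun t =>
    LinearMap.proj t.2 ∘ₗ (E t.1).toLinearMap ∘ₗ componentMap C n t.1
  let proj : ∀ n, (T → A) →ₗ[Aᵐᵒᵖ] C.X n := fun n =>
    if h : n ∈ Finset.Icc a b then
      (E n).symm.toLinearMap ∘ₗ LinearMap.pi fun i => LinearMap.proj (⟨⟨n, h⟩, i⟩ : T)
    else 0
  have hincl : ∀ n c t, incl n c t = E t.1 (componentMap C n t.1 c) t.2 := fun n c t => rfl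
  have hproj : ∀ n (h : n ∈ Finset.Icc a b) v,
      proj n v = (E n).symm (fun i => v ⟨⟨n, h⟩, i⟩) := fun n h v => by
    simp only [proj, h, dif_pos]
    rfl
  have hincl_proj : ∀ n v t, incl n (proj n v) t = if deg t = n then v t else 0 := by
    rintro n v ⟨⟨m, hm⟩, i⟩
    rw [hincl]
    by_cases h : m = n
    · subst h
      rw [if_pos rfl, componentMap_self, hproj _ hm, LinearEquiv.apply_symm_apply]
    · rw [if_neg h, componentMap_of_ne C (Ne.symm h), map_zero]
      rfl
  have hproj_incl : ∀ n c, proj n (incl n c) = c := by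
    intro n c
    by_cases h : n ∈ Finset.Icc a b
    · rw [hproj n h, LinearEquiv.symm_apply_eq]
      ext i
      rw [hincl, componentMap_self]
    · rw [hzero n h c, hzero n h (proj n _)]
  refine ⟨T, inferInstance, inferInstance, ⟨{
    deg := deg
    -- Column `t` holds the coordinates of the differential of the basis element `t`.
    D := Matrix.of fun s t =>
      incl (deg t + 1) (C.d (deg t) (deg t + 1) (proj (deg t) (Pi.single t 1))) s
    incl := incl
    proj := proj
    proj_incl := hproj_incl
    incl_proj := hincl_proj
    incl_d := fun n c => ?_ }⟩⟩
  ext s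
  rw [matAct_apply]
  have h1 : incl (n + 1) (C.d n (n + 1) c)
      = ∑ t, MulOpposite.op (incl n c t) •
        incl (n + 1) (C.d n (n + 1) (proj n (Pi.single t 1))) := by
    conv_lhs => rw [← hproj_incl n c, pi_sum_single_smul (incl n c)]
    simp only [map_sum, map_smul]
  rw [h1, Finset.sum_apply]
  refine Finset.sum_congr rfl fun t _ => ?_
  by_cases h : deg t = n
  · subst h
    rfl
  · have h0 : incl n c t = 0 := by
      rw [← hproj_incl n c, hincl_proj, if_neg h]
    simp [h0]

end Presentation

/-! ### Universal property of the balanced tensor product. -/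

section BalancedTensor

variable {A : Type u} [Ring A] (N : ModuleCat.{u} A) {M : ModuleCat.{u} Aᵐᵒᵖ}

/-- The pure tensors in `M ⊗_A N`. -/
def balancedMk : M →+ N →+ (tensorFunctor N).obj M :=
  AddMonoidHom.mk' (fun c => AddMonoidHom.mk' (fun s => (Submodule.Quotient.mk (c ⊗ₜ[ℤ] s) :
      (M ⊗[ℤ] N) ⧸ balancedRelations (A := A) M N))
      (fun s s' => by
        rw [TensorProduct.tmul_add]
        rfl))
    (fun c c' => by
      ext s
      change (Submodule.Quotient.mk ((c + c') ⊗ₜ[ℤ] s) :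
        (M ⊗[ℤ] N) ⧸ balancedRelations (A := A) M N) = _
      rw [TensorProduct.add_tmul]
      rfl)

lemma balancedMk_smul (a : A) (c : M) (x : N) :
    balancedMk N (MulOpposite.op a • c) x = balancedMk N c (a • x) :=
  (Submodule.Quotient.eq (balancedRelations (A := A) M N)).2 (Submodule.subset_span ⟨c, a, x, rfl⟩)

/-- The map out of `M ⊗_A N` given by a balanced biadditive map. -/
def balancedLift {Y : Type*} [AddCommGroup Y] (β : M →+ N →+ Y)
    (hβ : ∀ (a : A) c x, β (MulOpposite.op a • c) x = β c (a • x)) : (tensorFunctor N).obj M →+ Y :=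
  (Submodule.liftQ (balancedRelations (A := A) M N)
    (TensorProduct.lift (LinearMap.mk₂ ℤ (fun (c : M) (x : N) => β c x)
      (fun c c' x => by rw [map_add]; rfl) (fun k c x => by rw [map_zsmul]; rfl)
      (fun c x x' => map_add _ _ _) (fun k c x => map_zsmul _ _ _)))
    (by
      refine Submodule.span_le.2 ?_
      rintro _ ⟨m, a, s, rfl⟩
      exact LinearMap.mem_ker.2 ((map_sub _ _ _).trans (sub_eq_zero.2 (hβ a m s))))).toAddMonoidHom

lemma balanced_hom_ext {Y : Type*} [AddCommGroup Y] (f g : (tensorFunctor N).obj M →+ Y)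
    (h : ∀ c x, f (balancedMk N c x) = g (balancedMk N c x)) (y : (tensorFunctor N).obj M) :
    f y = g y := by
  obtain ⟨z, rfl⟩ := Submodule.Quotient.mk_surjective (balancedRelations (A := A) M N) y
  induction z using TensorProduct.induction_on with
  | zero => exact (map_zero f).trans (map_zero g).symm
  | tmul c x => exact h c x
  | add z w hz hw => exact (map_add f _ _).trans ((congrArg₂ _ hz hw).trans (map_add g _ _).symm)

end BalancedTensor

/-! ### Acyclicity of `C ⊗_A N` as exactness of the matrix. -/

namespace MatrixPresentation

variable {A : Type u} [Ring A] {C : CochainComplex (ModuleCat.{u} Aᵐᵒᵖ) ℤ} {T : Type}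
  [Fintype T] [DecidableEq T] (P : MatrixPresentation C T)

lemma incl_apply (n : ℤ) (c : C.X n) (t : T) (h : P.deg t ≠ n) : P.incl n c t = 0 := by
  rw [← P.proj_incl n c, P.incl_proj, if_neg h]

lemma incl_proj_single (t : T) (a : A) :
    P.incl (P.deg t) (P.proj (P.deg t) (Pi.single t a)) = Pi.single t a := by
  ext s
  rw [P.incl_proj]
  by_cases h : s = t
  · rw [h, if_pos rfl]
  · rw [Pi.single_eq_of_ne h, ite_self]

lemma d_apply (s t : T) : P.D s t = P.incl (P.deg t + 1)
    (C.d (P.deg t) (P.deg t + 1) (P.proj (P.deg t) (Pi.single t 1))) s := by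
  rw [P.incl_d, P.incl_proj_single, matAct_single]
  simp

lemma deg_eq (s t : T) (h : P.D s t ≠ 0) : P.deg s = P.deg t + 1 := by
  by_contra h'
  exact h (by rw [P.d_apply, P.incl_apply _ _ _ h'])

lemma d_mul_d : P.D * P.D = 0 := by
  ext s t
  have h := P.incl_d (P.deg t + 1)
    (C.d (P.deg t) (P.deg t + 1) (P.proj (P.deg t) (Pi.single t 1)))
  rw [P.incl_d (P.deg t), P.incl_proj_single] at h
  have h1 : C.d (P.deg t + 1) (P.deg t + 1 + 1)
      (C.d (P.deg t) (P.deg t + 1) (P.proj (P.deg t) (Pi.single t 1))) = 0 := by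
    rw [← ConcreteCategory.comp_apply, C.d_comp_d]
    rfl
  rw [h1, map_zero] at h
  have h2 := congrFun h s
  rw [matAct_apply] at h2
  simp only [matAct_single, leftReg_apply, RingHom.id_apply, mul_one] at h2
  rw [Matrix.mul_apply, ← h2]
  rfl

variable (N : ModuleCat.{u} A)

/-- The coordinates of an element of `C ⊗_A N`. -/
def coord (n : ℤ) : (tensorFunctor N).obj (C.X n) →+ (T → N) :=
  balancedLift N (AddMonoidHom.mk' (fun c => AddMonoidHom.mk' (fun x t => P.incl n c t • x)
      (fun x x' => by ext t; exact smul_add _ _ _))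
    (fun c c' => by
      ext x t
      change P.incl n (c + c') t • x = P.incl n c t • x + P.incl n c' t • x
      rw [map_add, Pi.add_apply, add_smul]))
    (fun a c x => by
      ext t
      change P.incl n (MulOpposite.op a • c) t • x = P.incl n c t • a • x
      rw [map_smul, Pi.smul_apply, op_smul_eq_mul, mul_smul])

lemma coord_balancedMk (n : ℤ) (c : C.X n) (x : N) (t : T) :
    P.coord N n (balancedMk N c x) t = P.incl n c t • x := rfl

/-- The element of `C ⊗_A N` with given coordinates. -/
def ofCoord (n : ℤ) : (T → N) →+ (tensorFunctor N).obj (C.X n) :=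
  ∑ t, (balancedMk N (P.proj n (Pi.single t 1))).comp (Pi.evalAddMonoidHom _ t)

lemma ofCoord_apply (n : ℤ) (v : T → N) :
    P.ofCoord N n v = ∑ t, balancedMk N (P.proj n (Pi.single t 1)) (v t) := by
  rw [ofCoord, AddMonoidHom.finsetSum_apply]
  rfl

lemma ofCoord_coord (n : ℤ) (x : (tensorFunctor N).obj (C.X n)) :
    P.ofCoord N n (P.coord N n x) = x := by
  refine balanced_hom_ext N ((P.ofCoord N n).comp (P.coord N n)) (AddMonoidHom.id _)
    (fun c y => ?_) x
  rw [AddMonoidHom.comp_apply, ofCoord_apply]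
  simp only [coord_balancedMk, ← balancedMk_smul]
  rw [← AddMonoidHom.finsetSum_apply, ← map_sum]
  conv_rhs => rw [← P.proj_incl n c, pi_sum_single_smul (P.incl n c)]
  simp only [map_sum, map_smul]
  rfl

lemma coord_ofCoord (n : ℤ) (v : T → N) (t : T) :
    P.coord N n (P.ofCoord N n v) t = if P.deg t = n then v t else 0 := by
  rw [ofCoord_apply, map_sum, Finset.sum_apply]
  simp only [coord_balancedMk, P.incl_proj]
  rw [Finset.sum_eq_single t]
  · simp
  · intro s _ h
    simp [Pi.single_eq_of_ne h.symm]
  · simp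

lemma coord_apply (n : ℤ) (x : (tensorFunctor N).obj (C.X n)) (t : T) (h : P.deg t ≠ n) :
    P.coord N n x t = 0 := by
  rw [← P.ofCoord_coord N n x, coord_ofCoord, if_neg h]

lemma coord_map (n : ℤ) (x : (tensorFunctor N).obj (C.X n)) :
    P.coord N (n + 1) ((tensorFunctor N).map (C.d n (n + 1)) x)
      = matAct (Module.toAddMonoidEnd A N) P.D (P.coord N n x) := by
  refine balanced_hom_ext N ((P.coord N (n + 1)).comp
      ((tensorFunctor N).map (C.d n (n + 1))).hom.toAddMonoidHom)
    ((matAct (Module.toAddMonoidEnd A N) P.D : (T → N) →+ (T → N)).comp (P.coord N n))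
    (fun c y => ?_) x
  ext s
  change P.incl (n + 1) (C.d n (n + 1) c) s • y = ∑ t, P.D s t • P.incl n c t • y
  rw [P.incl_d, matAct_apply, Finset.sum_smul]
  simp only [leftReg_apply, RingHom.id_apply, mul_smul]

/-- `D` is homogeneous of degree one, so it exchanges the projections to degrees `n` and `n + 1`. -/
lemma matAct_ite (ρ : A →+* AddMonoid.End N) (n : ℤ) (v : T → N) (s : T) :
    matAct ρ P.D (fun t => if P.deg t = n then v t else 0) s
      = if P.deg s = n + 1 then matAct ρ P.D v s else 0 := by
  simp only [matAct_apply]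
  split_ifs with h
  · refine Finset.sum_congr rfl fun t _ => ?_
    by_cases h0 : P.D s t = 0
    · rw [h0, map_zero]
      rfl
    · rw [if_pos]
      have := P.deg_eq s t h0
      omega
  · refine Finset.sum_eq_zero fun t _ => ?_
    by_cases h0 : P.D s t = 0
    · rw [h0, map_zero]
      rfl
    · rw [if_neg, map_zero]
      have := P.deg_eq s t h0
      omega

/-- The complex `C ⊗_A N` is acyclic if and only if the differential module `N ^ T` is exact. -/
lemma acyclic_iff_dExact :
    (((tensorFunctor N).mapHomologicalComplex (ComplexShape.up ℤ)).obj C).Acyclic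
      ↔ DExact (Module.toAddMonoidEnd A N) P.D := by
  have hac : (((tensorFunctor N).mapHomologicalComplex (ComplexShape.up ℤ)).obj C).Acyclic ↔
      ∀ (n : ℤ) (x : (tensorFunctor N).obj (C.X (n + 1))),
        (tensorFunctor N).map (C.d (n + 1) (n + 1 + 1)) x = 0 →
        ∃ y : (tensorFunctor N).obj (C.X n), (tensorFunctor N).map (C.d n (n + 1)) y = x := by
    have : ∀ n, (((tensorFunctor N).mapHomologicalComplex (ComplexShape.up ℤ)).obj C).ExactAt
        (n + 1) ↔ ∀ (x : (tensorFunctor N).obj (C.X (n + 1))),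
        (tensorFunctor N).map (C.d (n + 1) (n + 1 + 1)) x = 0 →
        ∃ y : (tensorFunctor N).obj (C.X n), (tensorFunctor N).map (C.d n (n + 1)) y = x := by
      intro n
      rw [HomologicalComplex.exactAt_iff' _ n (n + 1) (n + 1 + 1) (by simp) (by simp),
        ShortComplex.moduleCat_exact_iff]
      rfl
    refine ⟨fun h n => (this n).1 (h (n + 1)), fun h n => ?_⟩
    obtain ⟨m, rfl⟩ : ∃ m, n = m + 1 := ⟨n - 1, by omega⟩
    exact (this m).2 (h m)
  have hinj : ∀ n, Function.Injective (P.coord N n) := fun n =>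
    Function.LeftInverse.injective (P.ofCoord_coord N n)
  have hcut : ∀ n v, P.coord N n (P.ofCoord N n v) = fun t => if P.deg t = n then v t else 0 :=
    fun n v => funext (P.coord_ofCoord N n v)
  rw [hac]
  constructor
  · intro h v hv
    have h1 : ∀ n, ∃ y : (tensorFunctor N).obj (C.X n),
        (tensorFunctor N).map (C.d n (n + 1)) y = P.ofCoord N (n + 1) v := by
      intro n
      refine h n _ (hinj _ ?_)
      rw [coord_map, hcut, map_zero]
      ext s
      rw [matAct_ite, hv, Pi.zero_apply, ite_self]
    choose y hy using h1
    -- The part of `v` of degree `n` has its primitive in degree `n - 1`; only the finitely many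
    -- degrees of basis elements contribute.
    refine ⟨∑ n ∈ Finset.univ.image P.deg, P.coord N (n - 1) (y (n - 1)), ?_⟩
    rw [map_sum]
    ext s
    rw [Finset.sum_apply, Finset.sum_eq_single (P.deg s)]
    · rw [← coord_map, hy, coord_ofCoord, if_pos (by omega)]
    · intro n _ hn
      rw [← coord_map, coord_apply _ _ _ _ _ (by omega)]
    · simp
  · intro h n x hx
    obtain ⟨w, hw⟩ := h (P.coord N (n + 1) x) (by rw [← coord_map, hx, map_zero])
    refine ⟨P.ofCoord N n w, hinj _ ?_⟩
    rw [coord_map, hcut]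
    ext s
    rw [matAct_ite, hw]
    split_ifs with hs
    · rfl
    · rw [coord_apply _ _ _ _ _ hs]

lemma acyclic_tensorComplex_iff {S : Type u} [Ring S] (φ : A →+* S) :
    (tensorComplex φ C).Acyclic ↔ DExact (leftReg φ) P.D :=
  P.acyclic_iff_dExact ((ModuleCat.restrictScalars φ).obj (ModuleCat.of S S))

end MatrixPresentation

/-! ### Finite domination gives a homotopy with finite support. -/

section Domination

variable {R : Type u} [Ring R]

/-- The underlying complex of right `R`-modules of a complex of right modules over the Laurent
polynomial ring. -/
abbrev baseComplex (C : CochainComplex (ModuleCat.{u} (LaurentPoly₂ R)ᵐᵒᵖ) ℤ) :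
    CochainComplex (ModuleCat.{u} Rᵐᵒᵖ) ℤ :=
  ((ModuleCat.restrictScalars
    (RingHom.op (AddMonoidAlgebra.singleZeroRingHom : R →+* LaurentPoly₂ R))).mapHomologicalComplex
      (ComplexShape.up ℤ)).obj C

namespace MatrixPresentation

variable {C : CochainComplex (ModuleCat.{u} (LaurentPoly₂ R)ᵐᵒᵖ) ℤ} {T : Type}
  [Fintype T] [DecidableEq T] (P : MatrixPresentation C T)

/-- The inclusion of the degree `n` part, as an `R`-linear map. -/
def baseIncl (n : ℤ) : (baseComplex C).X n →ₗ[Rᵐᵒᵖ] (T → LaurentPoly₂ R) where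
  toFun c := P.incl n c
  map_add' c c' := map_add (P.incl n) c c'
  map_smul' r c := by
    refine (map_smul (P.incl n)
      (MulOpposite.op (AddMonoidAlgebra.single (0 : ℤ × ℤ) r.unop)) (show C.X n from c)).trans ?_
    ext1 t
    rw [Pi.smul_apply, op_smul_eq_mul, RingHom.id_apply, Pi.smul_apply, op_smul_eq_mul_single]

/-- The projection to the degree `n` part, as an `R`-linear map. -/
def baseProj (n : ℤ) : (T → LaurentPoly₂ R) →ₗ[Rᵐᵒᵖ] (baseComplex C).X n where
  toFun c := P.proj n c
  map_add' c c' := map_add (P.proj n) c c'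
  map_smul' r c := by
    refine Eq.trans ?_ (map_smul (P.proj n)
      (MulOpposite.op (AddMonoidAlgebra.single (0 : ℤ × ℤ) r.unop)) c)
    congr 1
    ext1 t
    rw [Pi.smul_apply, Pi.smul_apply, op_smul_eq_mul, op_smul_eq_mul_single]

lemma baseProj_baseIncl (n : ℤ) (c : (baseComplex C).X n) : P.baseProj n (P.baseIncl n c) = c :=
  P.proj_incl n c

lemma baseIncl_baseProj (n : ℤ) (v : T → LaurentPoly₂ R) (t : T) :
    P.baseIncl n (P.baseProj n v) t = if P.deg t = n then v t else 0 :=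
  P.incl_proj n v t

lemma baseIncl_d (n : ℤ) (c : (baseComplex C).X n) :
    P.baseIncl (n + 1) ((baseComplex C).d n (n + 1) c) = leftMulLin P.D (P.baseIncl n c) :=
  P.incl_d n c

lemma baseIncl_injective (n : ℤ) : Function.Injective (P.baseIncl n) :=
  Function.LeftInverse.injective (P.baseProj_baseIncl n)

lemma d_baseProj (n : ℤ) (v : T → LaurentPoly₂ R) :
    (baseComplex C).d n (n + 1) (P.baseProj n v) = P.baseProj (n + 1) (leftMulLin P.D v) := by
  refine P.baseIncl_injective _ (funext fun s => ?_)
  rw [baseIncl_d, baseIncl_baseProj]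
  have h : P.baseIncl n (P.baseProj n v) = fun t => if P.deg t = n then v t else 0 :=
    funext (P.baseIncl_baseProj n v)
  rw [h, leftMulLin_apply, leftMulLin_apply]
  exact P.matAct_ite (ModuleCat.of _ (LaurentPoly₂ R)) _ n v s

end MatrixPresentation

/-- The supports of the images of finitely many generators suffice, as scalars from `R` do not
enlarge supports. -/
lemma exists_support_of_finite {T : Type} [Fintype T] [DecidableEq T] {M : Type*} [AddCommGroup M]
    [Module Rᵐᵒᵖ M] [Module.Finite Rᵐᵒᵖ M] (f : M →ₗ[Rᵐᵒᵖ] (T → LaurentPoly₂ R)) :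
    ∃ K : Finset (ℤ × ℤ), ∀ m t, ∀ g ∉ K, (f m t).coeff g = 0 := by
  obtain ⟨s, hs⟩ := (Module.Finite.fg_top : (⊤ : Submodule Rᵐᵒᵖ M).FG)
  choose K hK using fun m => exists_common_support (f m)
  refine ⟨s.biUnion K, fun m t g hg => ?_⟩
  have hm : m ∈ Submodule.span Rᵐᵒᵖ (s : Set M) := by rw [hs]; trivial
  induction hm using Submodule.span_induction with
  | mem x hx => exact hK x t g fun h => hg (Finset.mem_biUnion.2 ⟨x, hx, h⟩)
  | zero => rw [map_zero]; rfl
  | add x y _ _ hx hy =>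
    rw [map_add, Pi.add_apply, AddMonoidAlgebra.coeff_add, Finsupp.add_apply, hx, hy, add_zero]
  | smul r x _ hx =>
    rw [map_smul, Pi.smul_apply, AddMonoidAlgebra.coeff_smul_apply, hx, smul_zero]

/-- The identity is homotopic to the composite `C → B → C`, whose image in each degree comes from a
finitely generated module and so has finite support. Only the finitely many degrees of basis
elements matter. -/
lemma IsFinitelyDominated.homotopyFinite {C : CochainComplex (ModuleCat.{u} (LaurentPoly₂ R)ᵐᵒᵖ) ℤ}
    {T : Type} [Fintype T] [DecidableEq T] (P : MatrixPresentation C T)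
    (h : IsFinitelyDominated (AddMonoidAlgebra.singleZeroRingHom : R →+* LaurentPoly₂ R) C) :
    HomotopyFinite P.D := by
  obtain ⟨B, -, hB, ⟨e⟩⟩ := h
  let η : ∀ n, (baseComplex C).X (n + 1) →ₗ[Rᵐᵒᵖ] (baseComplex C).X n :=
    fun n => (e.homotopyHomInvId.symm.hom (n + 1) n).hom
  have hη : ∀ n (c : (baseComplex C).X (n + 1)),
      c = η (n + 1) ((baseComplex C).d (n + 1) (n + 1 + 1) c)
        + (baseComplex C).d n (n + 1) (η n c) + (e.inv.f (n + 1)) (e.hom.f (n + 1) c) := by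
    intro n c
    have h1 := e.homotopyHomInvId.symm.comm (n + 1)
    rw [dNext_eq _ (show (ComplexShape.up ℤ).Rel (n + 1) (n + 1 + 1) by simp),
      prevD_eq _ (show (ComplexShape.up ℤ).Rel n (n + 1) by simp)] at h1
    exact congrArg (fun f : (baseComplex C).X (n + 1) ⟶ (baseComplex C).X (n + 1) => f c) h1
  have hK : ∀ n, ∃ K : Finset (ℤ × ℤ), ∀ (m : B.X n) t, ∀ g ∉ K,
      ((P.baseIncl n ∘ₗ (e.inv.f n).hom) m t).coeff g = 0 := fun n => by
    have := (hB n).1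
    exact exists_support_of_finite _
  choose K hK using hK
  -- The components of the homotopy are assembled into one operator of degree `-1`.
  let H : (T → LaurentPoly₂ R) →ₗ[Rᵐᵒᵖ] (T → LaurentPoly₂ R) := LinearMap.pi fun t =>
    LinearMap.proj t ∘ₗ P.baseIncl (P.deg t) ∘ₗ η (P.deg t) ∘ₗ P.baseProj (P.deg t + 1)
  have hH : ∀ n v, P.baseProj n (H v) = η n (P.baseProj (n + 1) v) := by
    intro n v
    refine P.baseIncl_injective _ (funext fun t => ?_)
    rw [P.baseIncl_baseProj]
    split_ifs with ht
    · subst ht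
      rfl
    · exact (P.incl_apply _ _ _ ht).symm
  refine ⟨H, Finset.univ.biUnion fun t => K (P.deg t), fun c t g hg => ?_⟩
  obtain ⟨n, hn⟩ : ∃ n, P.deg t = n + 1 := ⟨P.deg t - 1, by omega⟩
  have h1 : P.baseProj (n + 1) (c - leftMulLin P.D (H c) - H (leftMulLin P.D c))
      = e.inv.f (n + 1) (e.hom.f (n + 1) (P.baseProj (n + 1) c)) := by
    rw [map_sub, map_sub, hH, ← P.d_baseProj, ← P.d_baseProj, hH]
    conv_lhs => enter [1, 1]; rw [hη n (P.baseProj (n + 1) c)]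
    abel
  have h2 := P.baseIncl_baseProj (n + 1) (c - leftMulLin P.D (H c) - H (leftMulLin P.D c)) t
  rw [if_pos hn, h1] at h2
  rw [← h2]
  refine hK (n + 1) _ t g fun h => hg (Finset.mem_biUnion.2 ⟨t, Finset.mem_univ t, ?_⟩)
  rwa [hn]

end Domination

/-! ### The differential on the polynomials `V[u]`. -/

section Telescope

variable {𝓡 : Type u} [Ring 𝓡] {V : Type u} [AddCommGroup V] [Module 𝓡 V] (d h : V →ₗ[𝓡] V)

/-- The deviation of `h` from being a contraction of `(V, d)`. -/
def defect : V →ₗ[𝓡] V := LinearMap.id - d ∘ₗ h - h ∘ₗ d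

lemma defect_apply (v : V) : defect d h v = v - d (h v) - h (d v) := rfl

variable (𝓡 V)

/-- The constants in the module `V[u]` of polynomials. -/
def polyConst : V →ₗ[𝓡] (ℕ →₀ V) := Finsupp.lsingle 0

/-- Multiplication by `u` on the module `V[u]` of polynomials. -/
def polyShift : (ℕ →₀ V) →ₗ[𝓡] (ℕ →₀ V) := Finsupp.lmapDomain V 𝓡 Nat.succ

variable {𝓡 V}

lemma polyShift_single (k : ℕ) (y : V) :
    polyShift 𝓡 V (Finsupp.single k y) = Finsupp.single (k + 1) y := by
  simp [polyShift, Finsupp.mapDomain_single]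

/-- Evaluation of polynomials at `u = h`. -/
def polyEval : (ℕ →₀ V) →ₗ[𝓡] V := Finsupp.lsum ℕ fun k => h ^ k

lemma polyEval_const (y : V) : polyEval h (polyConst 𝓡 V y) = y := by
  simp [polyEval, polyConst]

/-- The differential on `V[u]`, on polynomials of the form `u ^ k y`. -/
def polyDiffAux : ℕ → V →ₗ[𝓡] (ℕ →₀ V)
  | 0 => polyConst 𝓡 V ∘ₗ d
  | k + 1 => Finsupp.lsingle k - polyConst 𝓡 V ∘ₗ defect d h ∘ₗ h ^ k
      - polyShift 𝓡 V ∘ₗ polyDiffAux k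

/-- The differential `∂` on `V[u]` that extends `d` and for which multiplication by `u` is a
homotopy from the identity to `w ↦ defect (w(h))`. -/
def polyDiff : (ℕ →₀ V) →ₗ[𝓡] (ℕ →₀ V) := Finsupp.lsum ℕ (polyDiffAux d h)

lemma polyDiff_const (y : V) : polyDiff d h (polyConst 𝓡 V y) = polyConst 𝓡 V (d y) := by
  simp [polyDiff, polyConst, polyDiffAux]

lemma poly_induction {Q : (ℕ →₀ V) → Prop} (hadd : ∀ v w, Q v → Q w → Q (v + w))
    (hconst : ∀ y, Q (polyConst 𝓡 V y)) (hshift : ∀ w, Q w → Q (polyShift 𝓡 V w)) (w : ℕ →₀ V) :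
    Q w := by
  refine Finsupp.induction_linear w ?_ hadd fun k y => ?_
  · simpa using hconst 0
  · induction k with
    | zero => exact hconst y
    | succ k ih =>
      have := hshift _ ih
      rwa [polyShift_single] at this

lemma polyEval_shift (w : ℕ →₀ V) : polyEval h (polyShift 𝓡 V w) = h (polyEval h w) := by
  refine Finsupp.induction_linear w ?_ ?_ fun k y => ?_
  · simp
  · intro v w hv hw
    simp only [map_add, hv, hw]
  · rw [polyShift_single]
    simp [polyEval, pow_succ']

/-- The recursion behind `polyDiffAux`. It says that `∂u + u∂` is the identity minus the constant
`defect (w(h))`, and it drives all later inductions. -/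
lemma polyDiff_shift (w : ℕ →₀ V) : polyDiff d h (polyShift 𝓡 V w)
    = w - polyConst 𝓡 V (defect d h (polyEval h w)) - polyShift 𝓡 V (polyDiff d h w) := by
  refine Finsupp.induction_linear w ?_ ?_ fun k y => ?_
  · simp
  · intro v w hv hw
    simp only [map_add, hv, hw]
    abel
  · rw [polyShift_single]
    simp [polyDiff, polyEval, polyDiffAux]

/-- Evaluation at `u = h` is a chain map: on `u w` the recursion turns into `dh = 1 - defect - hd`.
-/
lemma polyEval_diff (w : ℕ →₀ V) : polyEval h (polyDiff d h w) = d (polyEval h w) := by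
  refine poly_induction (𝓡 := 𝓡)
    (Q := fun w => polyEval h (polyDiff d h w) = d (polyEval h w)) ?_ (fun y => ?_) (fun w hw => ?_) w
  · intro v w hv hw
    simp only [map_add, hv, hw]
  · rw [polyDiff_const, polyEval_const, polyEval_const]
  · rw [polyDiff_shift, map_sub, map_sub, polyEval_const, polyEval_shift, polyEval_shift, hw,
      defect_apply]
    abel

variable {d} (hd : ∀ v, d (d v) = 0)
include hd

lemma d_defect (v : V) : d (defect d h v) = defect d h (d v) := by
  simp only [defect_apply, map_sub, hd, map_zero]
  abel

lemma polyDiff_diff (w : ℕ →₀ V) : polyDiff d h (polyDiff d h w) = 0 := by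
  refine poly_induction (𝓡 := 𝓡) (Q := fun w => polyDiff d h (polyDiff d h w) = 0) ?_ (fun y => ?_) (fun w hw => ?_) w
  · intro v w hv hw
    simp only [map_add, hv, hw, add_zero]
  · rw [polyDiff_const, polyDiff_const, hd, map_zero]
  · rw [polyDiff_shift, map_sub, map_sub, polyDiff_const, polyDiff_shift, hw, polyEval_diff,
      d_defect h hd, map_zero]
    abel

end Telescope

/-! ### Grading and truncation of `F[u]`. -/

section GradedTelescope

variable {𝓡 : Type u} [Ring 𝓡] {V : Type u} [AddCommGroup V] [Module 𝓡 V]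

/-- The part of degree `n` of the polynomials with coefficients in a graded submodule, where `u`
has degree `-1`. -/
def gradedPoly (F : ℤ → Submodule 𝓡 V) (n : ℤ) : Submodule 𝓡 (ℕ →₀ V) :=
  ⨅ k : ℕ, (F (n + k)).comap (Finsupp.lapply k)

lemma mem_gradedPoly {F : ℤ → Submodule 𝓡 V} {n : ℤ} {w : ℕ →₀ V} :
    w ∈ gradedPoly F n ↔ ∀ k : ℕ, w k ∈ F (n + k) := by
  simp [gradedPoly]

lemma single_mem_gradedPoly {F : ℤ → Submodule 𝓡 V} {n : ℤ} {k : ℕ} {y : V} (hy : y ∈ F (n + k)) :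
    Finsupp.single k y ∈ gradedPoly F n := by
  refine mem_gradedPoly.2 fun j => ?_
  rw [Finsupp.single_apply]
  split_ifs with hj
  · rwa [← hj]
  · exact zero_mem _

lemma polyConst_mem {F : ℤ → Submodule 𝓡 V} {n : ℤ} {y : V} (hy : y ∈ F n) :
    polyConst 𝓡 V y ∈ gradedPoly F n :=
  single_mem_gradedPoly (k := 0) (by simpa using hy)

/-- A linear map that maps the monomials of degree `n` into a submodule maps all polynomials of
degree `n` there. -/
lemma map_mem_of_single {F : ℤ → Submodule 𝓡 V} {n : ℤ} {U : Type*} [AddCommGroup U] [Module 𝓡 U]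
    (f : (ℕ →₀ V) →ₗ[𝓡] U) (G : Submodule 𝓡 U)
    (hf : ∀ (k : ℕ), ∀ y ∈ F (n + k), f (Finsupp.single k y) ∈ G)
    {w : ℕ →₀ V} (hw : w ∈ gradedPoly F n) : f w ∈ G := by
  rw [← Finsupp.sum_single w, Finsupp.sum, map_sum]
  exact Submodule.sum_mem _ fun k _ => hf k _ (mem_gradedPoly.1 hw k)

lemma polyShift_mem {F : ℤ → Submodule 𝓡 V} {n : ℤ} {w : ℕ →₀ V} (hw : w ∈ gradedPoly F (n + 1)) :
    polyShift 𝓡 V w ∈ gradedPoly F n := by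
  refine map_mem_of_single _ _ (fun k y hy => ?_) hw
  rw [polyShift_single]
  refine single_mem_gradedPoly ?_
  have : n + ((k + 1 : ℕ) : ℤ) = n + 1 + k := by push_cast; ring
  rwa [this]

variable {d h : V →ₗ[𝓡] V} {G F : ℤ → Submodule 𝓡 V}
  (hh : ∀ n, ∀ v ∈ G (n + 1), h v ∈ G n) (hFG : ∀ n, F n ≤ G n)

include hh hFG in
lemma polyEval_mem {n : ℤ} {w : ℕ →₀ V} (hw : w ∈ gradedPoly F n) : polyEval h w ∈ G n := by
  have key : ∀ (k : ℕ) (n : ℤ), ∀ y ∈ G (n + k), (h ^ k) y ∈ G n := by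
    intro k
    induction k with
    | zero => intro n y hy; simpa using hy
    | succ k ih =>
      intro n y hy
      rw [pow_succ']
      refine hh n _ (ih (n + 1) y ?_)
      have : n + ((k + 1 : ℕ) : ℤ) = n + 1 + k := by push_cast; ring
      rwa [this] at hy
  refine map_mem_of_single _ _ (fun k y hy => ?_) hw
  have : polyEval h (Finsupp.single k y) = (h ^ k) y := by simp [polyEval]
  rw [this]
  exact key k n y (hFG _ hy)

include hh hFG in
lemma polyDiff_mem (hdF : ∀ n, ∀ v ∈ F n, d v ∈ F (n + 1))
    (he : ∀ n, ∀ v ∈ G n, defect d h v ∈ F n) {n : ℤ} {w : ℕ →₀ V} (hw : w ∈ gradedPoly F n) :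
    polyDiff d h w ∈ gradedPoly F (n + 1) := by
  refine map_mem_of_single _ _ (fun k y hy => ?_) hw
  induction k generalizing n w with
  | zero =>
    have := polyDiff_const d h (𝓡 := 𝓡) y
    rw [polyConst, Finsupp.lsingle_apply] at this
    rw [this]
    refine polyConst_mem (hdF _ _ ?_)
    simpa using hy
  | succ k ih =>
    have h1 : n + ((k + 1 : ℕ) : ℤ) = n + 1 + k := by push_cast; ring
    rw [h1] at hy
    have h2 := single_mem_gradedPoly hy
    rw [← polyShift_single (𝓡 := 𝓡), polyDiff_shift]
    refine sub_mem (sub_mem h2 (polyConst_mem (he _ _ (polyEval_mem hh hFG h2)))) ?_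
    exact polyShift_mem (ih h2 hy)

variable (d h) in
/-- The projection to the complement of the image of `∂` in degree `a`, truncated below. -/
def polyTrunc (a n : ℤ) : (ℕ →₀ V) →ₗ[𝓡] (ℕ →₀ V) :=
  if n < a then 0 else if n = a then LinearMap.id - polyDiff d h ∘ₗ polyShift 𝓡 V
  else LinearMap.id

lemma polyTrunc_of_lt {a n : ℤ} (hn : n < a) (w : ℕ →₀ V) : polyTrunc d h a n w = 0 := by
  simp [polyTrunc, hn]

lemma polyTrunc_self (a : ℤ) (w : ℕ →₀ V) :
    polyTrunc d h a a w = w - polyDiff d h (polyShift 𝓡 V w) := by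
  simp [polyTrunc]

lemma polyTrunc_of_gt {a n : ℤ} (hn : a < n) (w : ℕ →₀ V) : polyTrunc d h a n w = w := by
  simp [polyTrunc, hn.not_gt, hn.ne']

section

variable (hd : ∀ v, d (d v) = 0) {a : ℤ} (ha : ∀ n < a, G n = ⊥)
  (hdF : ∀ n, ∀ v ∈ F n, d v ∈ F (n + 1)) (he : ∀ n, ∀ v ∈ G n, defect d h v ∈ F n)
include hh hFG hd ha

/-- Below degree `a` evaluation vanishes, so `∂u + u∂ = 1` there. Hence `∂u∂ = ∂`, which makes `1 -
∂u` an idempotent in degree `a` that kills the boundaries from below. -/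
lemma polyDiff_shift_diff {n : ℤ} (hn : n < a) {v : ℕ →₀ V} (hv : v ∈ gradedPoly F n) :
    polyDiff d h (polyShift 𝓡 V (polyDiff d h v)) = polyDiff d h v := by
  have h1 : polyEval h v = 0 := by
    have := polyEval_mem hh hFG hv
    rwa [ha n hn, Submodule.mem_bot] at this
  rw [polyDiff_shift, polyDiff_diff h hd, map_zero, polyEval_diff, h1]
  simp

/-- The delicate degrees are `n + 1 = a`, where `1 - ∂u` annihilates `∂w`, and `n = a`, where `∂∂ =
0` removes the correction. -/
lemma polyTrunc_diff {n : ℤ} {w : ℕ →₀ V} (hw : w ∈ gradedPoly F n) :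
    polyTrunc d h a (n + 1) (polyDiff d h w) = polyDiff d h (polyTrunc d h a n w) := by
  rcases lt_trichotomy n a with hn | rfl | hn
  · rw [polyTrunc_of_lt hn, map_zero]
    rcases lt_or_eq_of_le (show n + 1 ≤ a by omega) with hn' | rfl
    · rw [polyTrunc_of_lt hn']
    · rw [polyTrunc_self, polyDiff_shift_diff hh hFG hd ha hn hw, sub_self]
  · rw [polyTrunc_self, polyTrunc_of_gt (by omega), map_sub, polyDiff_diff h hd, sub_zero]
  · rw [polyTrunc_of_gt hn, polyTrunc_of_gt (by omega)]

lemma polyTrunc_trunc {n : ℤ} {w : ℕ →₀ V} (hw : w ∈ gradedPoly F n) :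
    polyTrunc d h a n (polyTrunc d h a n w) = polyTrunc d h a n w := by
  rcases lt_trichotomy n a with hn | rfl | hn
  · rw [polyTrunc_of_lt hn, polyTrunc_of_lt hn]
  · have h1 : polyShift 𝓡 V w ∈ gradedPoly F (n - 1) :=
      polyShift_mem (by rwa [sub_add_cancel])
    rw [polyTrunc_self, polyTrunc_self, map_sub, map_sub,
      polyDiff_shift_diff hh hFG hd ha (by omega) h1]
    abel
  · rw [polyTrunc_of_gt hn, polyTrunc_of_gt hn]

omit hd

lemma polyEval_trunc {n : ℤ} {w : ℕ →₀ V} (hw : w ∈ gradedPoly F n) :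
    polyEval h (polyTrunc d h a n w) = polyEval h w := by
  have h0 := polyEval_mem hh hFG hw
  rcases lt_trichotomy n a with hn | rfl | hn
  · rw [ha n hn, Submodule.mem_bot] at h0
    rw [polyTrunc_of_lt hn, map_zero, h0]
  · have h1 := hh (n - 1) _ (by rwa [sub_add_cancel])
    rw [ha _ (by omega), Submodule.mem_bot] at h1
    rw [polyTrunc_self, map_sub, polyEval_diff, polyEval_shift, h1, map_zero, sub_zero]
  · rw [polyTrunc_of_gt hn]

omit ha

include hdF he in
lemma polyTrunc_mem {n : ℤ} {w : ℕ →₀ V} (hw : w ∈ gradedPoly F n) :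
    polyTrunc d h a n w ∈ gradedPoly F n := by
  rcases lt_trichotomy n a with hn | rfl | hn
  · rw [polyTrunc_of_lt hn]
    exact zero_mem _
  · rw [polyTrunc_self]
    refine sub_mem hw ?_
    have h1 : polyShift 𝓡 V w ∈ gradedPoly F (n - 1) :=
      polyShift_mem (by rwa [sub_add_cancel])
    have h2 := polyDiff_mem hh hFG hdF he h1
    rwa [sub_add_cancel] at h2
  · rwa [polyTrunc_of_gt hn]

end

end GradedTelescope

/-! ### Homotopies given degree by degree. -/

section HomotopyOfSucc

/-- A homotopy between maps of cochain complexes given by maps lowering the degree by one. -/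
def homotopyOfSucc {𝓡 : Type u} [Ring 𝓡] {X Y : CochainComplex (ModuleCat.{u} 𝓡) ℤ} (f g : X ⟶ Y)
    (s : ∀ n, X.X (n + 1) ⟶ Y.X n)
    (hs : ∀ n, f.f (n + 1) = X.d (n + 1) (n + 1 + 1) ≫ s (n + 1) + s n ≫ Y.d n (n + 1)
      + g.f (n + 1)) : Homotopy f g where
  hom i j := if h : j + 1 = i then eqToHom (by rw [h]) ≫ s j else 0
  zero i j hij := dif_neg hij
  comm i := by
    obtain ⟨n, rfl⟩ : ∃ n, i = n + 1 := ⟨i - 1, by omega⟩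
    rw [dNext_eq _ (show (ComplexShape.up ℤ).Rel (n + 1) (n + 1 + 1) by simp),
      prevD_eq _ (show (ComplexShape.up ℤ).Rel n (n + 1) by simp), hs]
    simp

end HomotopyOfSucc

/-! ### The bounded model by finitely generated projective modules. -/

section FiniteModel

variable {𝓡 : Type u} [Ring 𝓡] {V : Type u} [AddCommGroup V] [Module 𝓡 V]
  (d h : V →ₗ[𝓡] V) (F : ℤ → Submodule 𝓡 V) (a : ℤ)

/-- The truncated polynomials of degree `n`. -/
def truncPoly (n : ℤ) : Submodule 𝓡 (ℕ →₀ V) :=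
  gradedPoly F n ⊓ LinearMap.ker (polyTrunc d h a n - LinearMap.id)

variable {d h F a}

lemma mem_truncPoly {n : ℤ} {w : ℕ →₀ V} :
    w ∈ truncPoly d h F a n ↔ w ∈ gradedPoly F n ∧ polyTrunc d h a n w = w := by
  rw [truncPoly, Submodule.mem_inf, LinearMap.mem_ker, LinearMap.sub_apply, sub_eq_zero]
  rfl

/-- Since `F` vanishes above `b`, the polynomials of degree `n` are a finite sum of the modules `F
(n + k)`, and the truncation is a retract of it. -/
lemma truncPoly_finite_projective {b : ℤ} (hb : ∀ n, b < n → F n = ⊥)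
    (hF : ∀ n, Module.Finite 𝓡 (F n) ∧ Module.Projective 𝓡 (F n)) (n : ℤ)
    (hT : ∀ w ∈ gradedPoly F n, polyTrunc d h a n w ∈ truncPoly d h F a n) :
    Module.Finite 𝓡 (truncPoly d h F a n) ∧ Module.Projective 𝓡 (truncPoly d h F a n) := by
  have h1 := fun n => (hF n).1
  have h2 := fun n => (hF n).2
  -- `k < N` means `n + k ≤ b`.
  let N : ℕ := (b - n + 1).toNat
  let r : truncPoly d h F a n →ₗ[𝓡] ∀ k : Fin N, F (n + (k : ℕ)) := LinearMap.pi fun k =>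
    ((Finsupp.lapply (k : ℕ)).comp (truncPoly d h F a n).subtype).codRestrict _
      fun w => mem_gradedPoly.1 (mem_truncPoly.1 w.2).1 k
  let s₀ : (∀ k : Fin N, F (n + (k : ℕ))) →ₗ[𝓡] (ℕ →₀ V) := ∑ k : Fin N,
    Finsupp.lsingle (k : ℕ) ∘ₗ (F (n + (k : ℕ))).subtype ∘ₗ LinearMap.proj k
  have hs₀ : ∀ x, s₀ x = ∑ k : Fin N, Finsupp.single (k : ℕ) (x k : V) := fun x => by
    simp [s₀, LinearMap.sum_apply]
  let s : (∀ k : Fin N, F (n + (k : ℕ))) →ₗ[𝓡] truncPoly d h F a n :=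
    (polyTrunc d h a n ∘ₗ s₀).codRestrict _ fun x => hT _ (by
      rw [hs₀]
      exact Submodule.sum_mem _ fun k _ => single_mem_gradedPoly (x k).2)
  have hsr : s ∘ₗ r = LinearMap.id := by
    refine LinearMap.ext fun w => Subtype.ext ?_
    obtain ⟨hw1, hw2⟩ := mem_truncPoly.1 w.2
    change polyTrunc d h a n (s₀ (r w)) = w
    have : s₀ (r w) = w := by
      rw [hs₀]
      ext j
      rw [Finsupp.finsetSum_apply]
      change ∑ k : Fin N, (Finsupp.single (k : ℕ) ((w : ℕ →₀ V) k)) j = _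
      by_cases hj : j < N
      · rw [Finset.sum_eq_single ⟨j, hj⟩]
        · simp
        · intro k _ hk
          rw [Finsupp.single_apply, if_neg]
          exact fun h => hk (Fin.ext h)
        · simp
      · rw [Finset.sum_eq_zero]
        · have := mem_gradedPoly.1 hw1 j
          rw [hb _ (by omega), Submodule.mem_bot] at this
          exact this.symm
        · intro k _
          rw [Finsupp.single_apply, if_neg]
          have := k.2
          omega
    rw [this, hw2]
  have : Module.Projective 𝓡 (∀ k : Fin N, F (n + (k : ℕ))) :=
    Module.Projective.of_equiv DFinsupp.linearEquivFunOnFintype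
  have hsurj : Function.Surjective s := fun w => ⟨r w, LinearMap.congr_fun hsr w⟩
  exact ⟨Module.Finite.of_surjective s hsurj, Module.Projective.of_split r s hsr⟩

/-- A bounded complex with a homotopy from the identity to a map with values in a subcomplex of
finitely generated projective modules is homotopy equivalent to a bounded complex of finitely
generated projective modules. -/
theorem exists_finite_model (X : CochainComplex (ModuleCat.{u} 𝓡) ℤ) {b : ℤ}
    (incl : ∀ n, X.X n →ₗ[𝓡] V) (proj : ∀ n, V →ₗ[𝓡] X.X n)
    (hpi : ∀ n x, proj n (incl n x) = x)
    (hid : ∀ n x, incl (n + 1) (X.d n (n + 1) x) = d (incl n x))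
    (hd : ∀ v, d (d v) = 0)
    (hh : ∀ n, ∀ v ∈ LinearMap.range (incl (n + 1)), h v ∈ LinearMap.range (incl n))
    (hF : ∀ n, Module.Finite 𝓡 (F n) ∧ Module.Projective 𝓡 (F n))
    (hFG : ∀ n, F n ≤ LinearMap.range (incl n))
    (hdF : ∀ n, ∀ v ∈ F n, d v ∈ F (n + 1))
    (he : ∀ n, ∀ v ∈ LinearMap.range (incl n), defect d h v ∈ F n)
    (ha : ∀ n < a, LinearMap.range (incl n) = ⊥) (hb : ∀ n, b < n → LinearMap.range (incl n) = ⊥) :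
    ∃ B : CochainComplex (ModuleCat.{u} 𝓡) ℤ, IsBoundedComplex B ∧
      (∀ n, Module.Finite 𝓡 (B.X n) ∧ Module.Projective 𝓡 (B.X n)) ∧
      Nonempty (HomotopyEquiv X B) := by
  have hip : ∀ n, ∀ v ∈ LinearMap.range (incl n), incl n (proj n v) = v := by
    rintro n _ ⟨x, rfl⟩
    rw [hpi]
  have hinj : ∀ n, Function.Injective (incl n) := fun n =>
    Function.LeftInverse.injective (hpi n)
  have hFb : ∀ n, b < n → F n = ⊥ := fun n hn => by
    rw [eq_bot_iff, ← hb n hn]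
    exact hFG n
  have hT : ∀ n, ∀ w ∈ gradedPoly F n, polyTrunc d h a n w ∈ truncPoly d h F a n := fun n w hw =>
    mem_truncPoly.2 ⟨polyTrunc_mem hh hFG hdF he hw, polyTrunc_trunc hh hFG hd ha hw⟩
  have hdB : ∀ n, ∀ w ∈ truncPoly d h F a n, polyDiff d h w ∈ truncPoly d h F a (n + 1) := by
    intro n w hw
    rw [mem_truncPoly] at hw ⊢
    refine ⟨polyDiff_mem hh hFG hdF he hw.1, ?_⟩
    rw [polyTrunc_diff hh hFG hd ha hw.1, hw.2]
  let dB : ∀ n, ModuleCat.of 𝓡 (truncPoly d h F a n)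
      ⟶ ModuleCat.of 𝓡 (truncPoly d h F a (n + 1)) :=
    fun n => ModuleCat.ofHom ((polyDiff d h).restrict (hdB n))
  let B : CochainComplex (ModuleCat.{u} 𝓡) ℤ :=
    CochainComplex.of (fun n => ModuleCat.of 𝓡 (truncPoly d h F a n)) dB
      (fun n => by
        refine ModuleCat.hom_ext (LinearMap.ext fun w => Subtype.ext ?_)
        exact polyDiff_diff h hd (w : ℕ →₀ V))
  have hBd : ∀ n, B.d n (n + 1) = dB n := fun n =>
    CochainComplex.of_d (fun n => ModuleCat.of 𝓡 (truncPoly d h F a n)) dB n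
  have hmem : ∀ n x, polyConst 𝓡 V (defect d h (incl n x)) ∈ gradedPoly F n := fun n x =>
    polyConst_mem (he n _ ⟨x, rfl⟩)
  -- The defect takes values in `F`, seen as truncated constant polynomials; the map back is
  -- evaluation at `u = h`. On `X` the composite is the defect, homotopic to the identity by `h`; on
  -- the model the homotopy is truncated multiplication by `u`.
  let f : X ⟶ B :=
    { f := fun n => ModuleCat.ofHom ((polyTrunc d h a n ∘ₗ polyConst 𝓡 V ∘ₗ defect d h ∘ₗ
        incl n).codRestrict (truncPoly d h F a n) fun x => hT n _ (hmem n x))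
      comm' := by
        rintro i j hij
        obtain rfl : i + 1 = j := hij
        rw [hBd]
        refine ModuleCat.hom_ext (LinearMap.ext fun x => Subtype.ext ?_)
        change polyDiff d h (polyTrunc d h a i (polyConst 𝓡 V (defect d h (incl i x))))
          = polyTrunc d h a (i + 1) (polyConst 𝓡 V (defect d h (incl (i + 1) (X.d i (i + 1) x))))
        rw [hid, ← d_defect h hd, ← polyDiff_const d h, polyTrunc_diff hh hFG hd ha (hmem i x)] }
  let g : B ⟶ X :=
    { f := fun n => ModuleCat.ofHom (proj n ∘ₗ polyEval h ∘ₗ (truncPoly d h F a n).subtype)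
      comm' := by
        rintro i j hij
        obtain rfl : i + 1 = j := hij
        rw [hBd]
        ext w
        refine hinj _ ?_
        change incl (i + 1) (X.d i (i + 1) (proj i (polyEval h (w : ℕ →₀ V))))
          = incl (i + 1) (proj (i + 1) (polyEval h (polyDiff d h w)))
        have hw := (mem_truncPoly.1 w.2).1
        rw [hid, hip _ _ (polyEval_mem hh hFG hw),
          hip _ _ (polyEval_mem hh hFG (polyDiff_mem hh hFG hdF he hw)), polyEval_diff] }
  have hgf : ∀ n x, incl n (g.f n (f.f n x)) = defect d h (incl n x) := by
    intro n x
    change incl n (proj n (polyEval h (polyTrunc d h a n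
      (polyConst 𝓡 V (defect d h (incl n x)))))) = _
    rw [polyEval_trunc hh hFG ha (hmem n x), polyEval_const, hip _ _ (hFG _ (he n _ ⟨x, rfl⟩))]
  have hfg : ∀ n (w : truncPoly d h F a n), ((f.f n (g.f n w) : truncPoly d h F a n) : ℕ →₀ V)
      = polyTrunc d h a n (polyConst 𝓡 V (defect d h (polyEval h (w : ℕ →₀ V)))) := by
    intro n w
    change polyTrunc d h a n (polyConst 𝓡 V (defect d h (incl n (proj n (polyEval h
      (w : ℕ →₀ V)))))) = _
    rw [hip _ _ (polyEval_mem hh hFG (mem_truncPoly.1 w.2).1)]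
  refine ⟨B, ⟨a, b, ?_, ?_⟩, fun n => truncPoly_finite_projective hFb hF n (hT n),
    ⟨{ hom := f, inv := g, homotopyHomInvId := Homotopy.symm ?_,
       homotopyInvHomId := Homotopy.symm ?_ }⟩⟩
  · rw [CochainComplex.isStrictlyGE_iff]
    intro n hn
    have : Subsingleton (truncPoly d h F a n) := ⟨fun v w => Subtype.ext (by
      rw [← (mem_truncPoly.1 v.2).2, ← (mem_truncPoly.1 w.2).2, polyTrunc_of_lt hn,
        polyTrunc_of_lt hn])⟩
    exact ModuleCat.isZero_of_subsingleton (ModuleCat.of 𝓡 (truncPoly d h F a n))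
  · rw [CochainComplex.isStrictlyLE_iff]
    intro n hn
    have h0 : ∀ v : truncPoly d h F a n, (v : ℕ →₀ V) = 0 := fun v => by
      ext k
      have := mem_gradedPoly.1 (mem_truncPoly.1 v.2).1 k
      rwa [hFb _ (by omega), Submodule.mem_bot] at this
    have : Subsingleton (truncPoly d h F a n) := ⟨fun v w => Subtype.ext (by rw [h0, h0])⟩
    exact ModuleCat.isZero_of_subsingleton (ModuleCat.of 𝓡 (truncPoly d h F a n))
  · refine homotopyOfSucc _ _ (fun n => ModuleCat.ofHom (proj n ∘ₗ h ∘ₗ incl (n + 1))) fun n => ?_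
    ext x
    refine hinj _ ?_
    change incl (n + 1) x = incl (n + 1) (proj (n + 1) (h (incl (n + 1 + 1)
        (X.d (n + 1) (n + 1 + 1) x)))
      + X.d n (n + 1) (proj n (h (incl (n + 1) x))) + g.f (n + 1) (f.f (n + 1) x))
    rw [map_add, map_add, hgf, hid, hid, hip n _ (hh n _ ⟨x, rfl⟩), ← hid,
      hip (n + 1) _ (hh (n + 1) _ ⟨_, rfl⟩), hid, defect_apply]
    abel
  · have hmem' : ∀ n, ∀ w ∈ truncPoly d h F a (n + 1),
        polyShift 𝓡 V w ∈ gradedPoly F n := fun n w hw => polyShift_mem (mem_truncPoly.1 hw).1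
    refine homotopyOfSucc _ _ (fun n => ModuleCat.ofHom
      ((polyTrunc d h a n ∘ₗ polyShift 𝓡 V).restrict fun w hw => hT n _ (hmem' n w hw)))
      fun n => ?_
    rw [hBd, hBd]
    refine ModuleCat.hom_ext (LinearMap.ext fun w => Subtype.ext ?_)
    change (w : ℕ →₀ V) = polyTrunc d h a (n + 1) (polyShift 𝓡 V (polyDiff d h w))
      + polyDiff d h (polyTrunc d h a n (polyShift 𝓡 V w))
      + ((f.f (n + 1) (g.f (n + 1) w) : truncPoly d h F a (n + 1)) : ℕ →₀ V)
    rw [hfg, ← polyTrunc_diff hh hFG hd ha (hmem' n _ w.2), polyDiff_shift, map_sub, map_sub,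
      (mem_truncPoly.1 w.2).2]
    abel

end FiniteModel

/-! ### Vectors with support in a finite box. -/

section Box

variable {R : Type u} [Ring R] {T : Type} [Fintype T] [DecidableEq T]

/-- The vectors of Laurent polynomials with entries supported in a finite set `K`, whose entries
outside `I` vanish. -/
def boxSubmodule (I : Set T) (K : Finset (ℤ × ℤ)) : Submodule Rᵐᵒᵖ (T → LaurentPoly₂ R) where
  carrier := {v | ∀ t g, (t ∉ I ∨ g ∉ K) → (v t).coeff g = 0}
  zero_mem' t g _ := rfl
  add_mem' {v w} hv hw t g htg := by
    rw [Pi.add_apply, AddMonoidAlgebra.coeff_add, Finsupp.add_apply, hv t g htg, hw t g htg,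
      add_zero]
  smul_mem' r v hv t g htg := by
    rw [Pi.smul_apply, AddMonoidAlgebra.coeff_smul_apply, hv t g htg, smul_zero]

/-- Reading off coefficients embeds the box as a direct summand of the free module on `T × K`. -/
lemma boxSubmodule_finite_projective (I : Set T) (K : Finset (ℤ × ℤ)) :
    Module.Finite Rᵐᵒᵖ (boxSubmodule (R := R) I K) ∧
      Module.Projective Rᵐᵒᵖ (boxSubmodule (R := R) I K) := by
  classical
  let r : boxSubmodule (R := R) I K →ₗ[Rᵐᵒᵖ] (T × K → Rᵐᵒᵖ) :=
    { toFun := fun v x => MulOpposite.op (((v : T → LaurentPoly₂ R) x.1).coeff x.2)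
      map_add' := fun v w => rfl
      map_smul' := fun c v => by
        ext1 x
        change MulOpposite.op ((c • (v : T → LaurentPoly₂ R) x.1).coeff x.2) = _
        rw [AddMonoidAlgebra.coeff_smul_apply]
        rfl }
  let s₀ : (T × K → Rᵐᵒᵖ) →ₗ[Rᵐᵒᵖ] (T → LaurentPoly₂ R) := ∑ t, ∑ g : K,
    if t ∈ I then (LinearMap.toSpanSingleton Rᵐᵒᵖ _ (stdVec t (g : ℤ × ℤ))) ∘ₗ LinearMap.proj (t, g)
    else 0
  have hs₀ : ∀ x, s₀ x = ∑ t, ∑ g : K, if t ∈ I then x (t, g) • stdVec t (g : ℤ × ℤ) else 0 := by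
    intro x
    simp only [s₀, LinearMap.sum_apply]
    refine Finset.sum_congr rfl fun t _ => Finset.sum_congr rfl fun g _ => ?_
    split_ifs <;> rfl
  have hstd : ∀ t ∈ I, ∀ g ∈ K, stdVec t g ∈ boxSubmodule (R := R) I K := by
    intro t ht g hg t' g' h
    by_cases h1 : t' = t
    · subst h1
      rw [stdVec, Pi.single_eq_same, AddMonoidAlgebra.coeff_single, Finsupp.single_apply, if_neg]
      rintro rfl
      exact h.elim (fun h => h ht) (fun h => h hg)
    · rw [stdVec, Pi.single_eq_of_ne h1]
      rfl
  let s : (T × K → Rᵐᵒᵖ) →ₗ[Rᵐᵒᵖ] boxSubmodule (R := R) I K := s₀.codRestrict _ fun x => by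
    rw [hs₀]
    refine Submodule.sum_mem _ fun t _ => Submodule.sum_mem _ fun g _ => ?_
    split_ifs with ht
    · exact Submodule.smul_mem _ _ (hstd t ht g g.2)
    · exact zero_mem _
  have hsr : s ∘ₗ r = LinearMap.id := by
    refine LinearMap.ext fun v => Subtype.ext ?_
    change s₀ (r v) = v
    rw [hs₀, sum_stdVec K (v : T → LaurentPoly₂ R) fun t g hg => v.2 t g (Or.inr hg)]
    refine Finset.sum_congr rfl fun t _ => ?_
    rw [← Finset.sum_coe_sort K]
    refine Finset.sum_congr rfl fun g _ => ?_
    split_ifs with ht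
    · rfl
    · rw [v.2 t g (Or.inl ht), MulOpposite.op_zero, zero_smul]
  have hsurj : Function.Surjective s := fun v => ⟨r v, LinearMap.congr_fun hsr v⟩
  exact ⟨Module.Finite.of_surjective s hsurj, Module.Projective.of_split r s hsr⟩

/-- An operator maps vectors with bounded support to vectors with bounded support. -/
lemma exists_support_image (Q : (T → LaurentPoly₂ R) →ₗ[Rᵐᵒᵖ] (T → LaurentPoly₂ R))
    (K : Finset (ℤ × ℤ)) : ∃ K' : Finset (ℤ × ℤ), ∀ c, (∀ t, ∀ g ∉ K, (c t).coeff g = 0) →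
      ∀ t, ∀ g ∉ K', (Q c t).coeff g = 0 := by
  have := (boxSubmodule_finite_projective (R := R) (Set.univ : Set T) K).1
  obtain ⟨K', hK'⟩ := exists_support_of_finite (Q ∘ₗ (boxSubmodule Set.univ K).subtype)
  refine ⟨K', fun c hc => hK' ⟨c, fun t g h => hc t g ?_⟩⟩
  simpa using h

end Box

/-! ### From a homotopy with finite support back to finite domination. -/

section Realisation

variable {R : Type u} [Ring R] {C : CochainComplex (ModuleCat.{u} (LaurentPoly₂ R)ᵐᵒᵖ) ℤ} {T : Type}
  [Fintype T] [DecidableEq T] (P : MatrixPresentation C T)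

namespace MatrixPresentation

lemma mem_range_baseIncl (n : ℤ) (v : T → LaurentPoly₂ R) :
    v ∈ LinearMap.range (P.baseIncl n) ↔ ∀ t, P.deg t ≠ n → v t = 0 := by
  constructor
  · rintro ⟨x, rfl⟩ t ht
    exact P.incl_apply n x t ht
  · intro h
    refine ⟨P.baseProj n v, funext fun t => ?_⟩
    rw [P.baseIncl_baseProj]
    split_ifs with ht
    · rfl
    · exact (h t ht).symm

/-- The projection to the part of degree `n`. -/
def cut (n : ℤ) : (T → LaurentPoly₂ R) →ₗ[Rᵐᵒᵖ] (T → LaurentPoly₂ R) :=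
  P.baseIncl n ∘ₗ P.baseProj n

lemma cut_apply (n : ℤ) (v : T → LaurentPoly₂ R) (t : T) :
    P.cut n v t = if P.deg t = n then v t else 0 := P.baseIncl_baseProj n v t

lemma leftMulLin_cut (n : ℤ) (v : T → LaurentPoly₂ R) :
    leftMulLin P.D (P.cut n v) = P.cut (n + 1) (leftMulLin P.D v) := by
  rw [cut, LinearMap.comp_apply, ← baseIncl_d, d_baseProj]
  rfl

lemma cut_of_mem_range {m n : ℤ} (hmn : m ≠ n) {v : T → LaurentPoly₂ R}
    (hv : v ∈ LinearMap.range (P.baseIncl n)) : P.cut m v = 0 := by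
  ext1 t
  rw [cut_apply]
  split_ifs with ht
  · exact (P.mem_range_baseIncl n v).1 hv t (by omega)
  · rfl

/-- The part of degree `-1` of an operator. -/
def lowering (H : (T → LaurentPoly₂ R) →ₗ[Rᵐᵒᵖ] (T → LaurentPoly₂ R)) :
    (T → LaurentPoly₂ R) →ₗ[Rᵐᵒᵖ] (T → LaurentPoly₂ R) :=
  LinearMap.pi fun t => LinearMap.proj t ∘ₗ H ∘ₗ P.cut (P.deg t + 1)

lemma lowering_apply (H : (T → LaurentPoly₂ R) →ₗ[Rᵐᵒᵖ] (T → LaurentPoly₂ R))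
    (v : T → LaurentPoly₂ R) (t : T) : P.lowering H v t = H (P.cut (P.deg t + 1) v) t := rfl

/-- `H` in `HomotopyFinite` need not respect the grading. Each component of the defect of its degree
`-1` part is a component of the defect of `H` at a homogeneous vector, so the support bound
persists. -/
lemma defect_lowering (H : (T → LaurentPoly₂ R) →ₗ[Rᵐᵒᵖ] (T → LaurentPoly₂ R))
    (v : T → LaurentPoly₂ R) (t : T) : defect (leftMulLin P.D) (P.lowering H) v t
      = (P.cut (P.deg t) v - leftMulLin P.D (H (P.cut (P.deg t) v))
        - H (leftMulLin P.D (P.cut (P.deg t) v))) t := by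
  rw [defect_apply, Pi.sub_apply, Pi.sub_apply, Pi.sub_apply, Pi.sub_apply, cut_apply, if_pos rfl,
    lowering_apply, leftMulLin_cut, leftMulLin_apply, leftMulLin_apply _ (H _), matAct_apply,
    matAct_apply]
  congr 2
  refine Finset.sum_congr rfl fun s _ => ?_
  rw [lowering_apply]
  by_cases h : P.D t s = 0
  · rw [h, map_zero]
    rfl
  · rw [P.deg_eq t s h]

end MatrixPresentation

lemma HomotopyFinite.isFinitelyDominated (h : HomotopyFinite P.D) :
    IsFinitelyDominated (AddMonoidAlgebra.singleZeroRingHom : R →+* LaurentPoly₂ R) C := by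
  obtain ⟨H, K, hK⟩ := h
  obtain ⟨a, ha⟩ : ∃ a, ∀ t, a ≤ P.deg t := by
    obtain ⟨a, ha⟩ := (Set.finite_range P.deg).bddBelow
    exact ⟨a, fun t => ha ⟨t, rfl⟩⟩
  obtain ⟨b, hb⟩ : ∃ b, ∀ t, P.deg t ≤ b := by
    obtain ⟨b, hb⟩ := (Set.finite_range P.deg).bddAbove
    exact ⟨b, fun t => hb ⟨t, rfl⟩⟩
  choose next hnext using exists_support_image (leftMulLin P.D)
  -- The boxes grow with the degree so that `D` maps each into the next, and each contains `K`,
  -- hence the values of the defect. Counting starts at the lowest degree `a`.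
  let Kseq : ℕ → Finset (ℤ × ℤ) := fun k => Nat.rec K (fun _ K' => K ∪ next K') k
  have hKseq : ∀ k, K ⊆ Kseq k := fun k => by
    cases k with
    | zero => exact subset_rfl
    | succ k => exact Finset.subset_union_left
  let F : ℤ → Submodule Rᵐᵒᵖ (T → LaurentPoly₂ R) := fun n =>
    boxSubmodule {t | P.deg t = n} (Kseq (n - a).toNat)
  have hF : ∀ {n} {v : T → LaurentPoly₂ R}, (∀ t, P.deg t ≠ n → v t = 0) →
      (∀ t, ∀ g ∉ Kseq (n - a).toNat, (v t).coeff g = 0) → v ∈ F n := by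
    intro n v h1 h2 t g htg
    rcases htg with ht | hg
    · rw [h1 t ht]
      rfl
    · exact h2 t g hg
  have hFG : ∀ n, F n ≤ LinearMap.range (P.baseIncl n) := fun n v hv => by
    rw [P.mem_range_baseIncl]
    intro t ht
    ext g
    exact hv t g (Or.inl ht)
  refine exists_finite_model (d := leftMulLin P.D) (h := P.lowering H) (F := F) (a := a) (b := b)
    (baseComplex C) P.baseIncl P.baseProj P.baseProj_baseIncl P.baseIncl_d
    (leftMulLin_comp_self P.d_mul_d) ?_ (fun n => boxSubmodule_finite_projective _ _) hFG ?_ ?_ ?_ ?_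
  · intro n v hv
    rw [P.mem_range_baseIncl]
    intro t ht
    rw [P.lowering_apply, P.cut_of_mem_range (by omega) hv, map_zero]
    rfl
  · intro n v hv
    have hr : leftMulLin P.D v ∈ LinearMap.range (P.baseIncl (n + 1)) := by
      obtain ⟨x, rfl⟩ := hFG n hv
      exact ⟨_, P.baseIncl_d n x⟩
    refine hF ((P.mem_range_baseIncl _ _).1 hr) fun t g hg => ?_
    by_cases hn : a ≤ n
    · have h1 : (n + 1 - a).toNat = (n - a).toNat + 1 := by omega
      rw [h1] at hg
      exact hnext (Kseq (n - a).toNat) v (fun t g hg => hv t g (Or.inr hg)) t g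
        fun h => hg (Finset.mem_union_right _ h)
    -- Below `a` the index `(n - a).toNat` no longer grows with `n`, but the module is zero.
    · have h0 : v = 0 := funext fun t => (P.mem_range_baseIncl n v).1 (hFG n hv) t (by
        have := ha t
        omega)
      rw [h0, map_zero]
      rfl
  · intro n v hv
    refine hF (fun t ht => ?_) fun t g hg => ?_
    · rw [P.defect_lowering, P.cut_of_mem_range ht hv]
      simp
    · rw [P.defect_lowering]
      exact hK _ t g fun h => hg (hKseq _ h)
  · intro n hn
    rw [eq_bot_iff]
    intro v hv
    exact funext fun t => (P.mem_range_baseIncl n v).1 hv t (by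
      have := ha t
      omega)
  · intro n hn
    rw [eq_bot_iff]
    intro v hv
    exact funext fun t => (P.mem_range_baseIncl n v).1 hv t (by
      have := hb t
      omega)

end Realisation
end

theorem mainTheorem1 {R : Type u} [Ring R]
    (C : CochainComplex (ModuleCat.{u} (LaurentPoly₂ R)ᵐᵒᵖ) ℤ)
    (hbdd : IsBoundedComplex C)
    (hfree : ∀ n, Module.Finite (LaurentPoly₂ R)ᵐᵒᵖ (C.X n) ∧
      Module.Free (LaurentPoly₂ R)ᵐᵒᵖ (C.X n)) :
    IsFinitelyDominated (AddMonoidAlgebra.singleZeroRingHom : R →+* LaurentPoly₂ R) C ↔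
      (tensorComplex (edgeHomY R 1) C).Acyclic ∧
      (tensorComplex (edgeHomY R (-1)) C).Acyclic ∧
      (tensorComplex (edgeHomX R 1) C).Acyclic ∧
      (tensorComplex (edgeHomX R (-1)) C).Acyclic ∧
      (tensorComplex (vertexHom R 1 1) C).Acyclic ∧
      (tensorComplex (vertexHom R (-1) (-1)) C).Acyclic ∧
      (tensorComplex (vertexHom R 1 (-1)) C).Acyclic ∧
      (tensorComplex (vertexHom R (-1) 1) C).Acyclic := by
  obtain ⟨T, _, _, ⟨P⟩⟩ := exists_matrixPresentation C hbdd hfree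
  simp only [P.acyclic_tensorComplex_iff]
  constructor
  · intro h
    have hfin := h.homotopyFinite P
    exact ⟨hfin.exact_edgeHomY P.d_mul_d 1, hfin.exact_edgeHomY P.d_mul_d (-1),
      hfin.exact_edgeHomX P.d_mul_d 1, hfin.exact_edgeHomX P.d_mul_d (-1),
      hfin.exact_vertexHom P.d_mul_d 1 1, hfin.exact_vertexHom P.d_mul_d (-1) (-1),
      hfin.exact_vertexHom P.d_mul_d 1 (-1), hfin.exact_vertexHom P.d_mul_d (-1) 1⟩
  · rintro ⟨hY, hY', hX, hX', h1, h2, h3, h4⟩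
    refine HomotopyFinite.isFinitelyDominated P
      (homotopyFinite_of_exact P.d_mul_d P.deg_eq (fun δ => ?_) (fun ε => ?_) fun ε δ => ?_)
    · rcases Int.units_eq_one_or δ with rfl | rfl
      exacts [hY, hY']
    · rcases Int.units_eq_one_or ε with rfl | rfl
      exacts [hX, hX']
    · rcases Int.units_eq_one_or ε with rfl | rfl <;>
        rcases Int.units_eq_one_or δ with rfl | rfl
      exacts [h1, h3, h4, h2]
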